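/- Notation. For integers $1\le k\le d$ let $G(d,k)$ be the Grassmannian of $k$-dimensional linear subspaces of $\mathbb{R}^d$, equipped with its $O(d)$-invariant Borel probability measure. For $L\in G(d,k)$, $a\in\mathbb{R}^d$ and $\delta>0$ let $L_\delta(a)$ be the $\delta$-neighborhood in $\mathbb{R}^d$ of $B(a,\tfrac12)\cap(a+L)$. For measurable $f\ge 0$ on $\mathbb{R}^d$ define $$\mathcal{M}^k_\delta[f](L)=\sup_{a\in\mathbb{R}^d}\frac{1}{|L_\delta(a)|}\int_{L_\delta(a)}f(y)\,dy,\qquad \mathcal{N}^k[f](L)=\sup_{x\in\mathbb{R}^d}\int_{x+L}f(y)\,dy,$$ where the last integral is with respect to $k$-dimensional Lebesgue measure on $x+L$. Proposition. Let $2\le k\le d$ be integers, let $2\le p<\infty$ and $\alpha\in\mathbb{R}$. Suppose that there is a constant $A$ such that for all $0<\delta\le 1$ and all $f\in L^p(\mathbb{R}^{d-1})$ $$\big\|\mathcal{M}^{k-1}_\delta[|f|]\big\|_{L^p(G(d-1,k-1))}\le A\,\delta^{-\alpha/p}\,\|f\|_{L^p(\mathbb{R}^{d-1})}.$$ (i)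 If $\alpha\ge 1$, then for every $\varepsilon>0$ there is a constant $C$, independent of $\delta$ and $f$, such that for all $0<\delta\le1$ and all $f\in L^p(\mathbb{R}^d)$ $$\big\|\mathcal{M}^{k}_\delta[|f|]\big\|_{L^p(G(d,k))}\le C\,\delta^{-(\alpha-1+\varepsilon)/p}\,\|f\|_{L^p(\mathbb{R}^{d})}.$$ (ii) If $\alpha<1$, then there is a constant $C$, independent of $f$, such that for every $f\in L^p(\mathbb{R}^d)$ supported in the closed unit ball of $\mathbb{R}^d$ the function $\mathcal{N}^k[|f|]$ is measurable with respect to the completion of the invariant measure on $G(d,k)$ and $$\big\|\mathcal{N}^{k}[|f|]\big\|_{L^p(G(d,k))}\le C\,\|f\|_{L^p(\mathbb{R}^{d})}.$$ -/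

import Mathlib

open MeasureTheory Set
open scoped ENNReal NNReal

noncomputable section

/-- The Grassmannian `G(d,k)` of `k`-dimensional linear subspaces of `ℝᵈ`. -/
def Gr (d k : ℕ) : Type :=
  {L : Submodule ℝ (EuclideanSpace ℝ (Fin d)) // Module.finrank ℝ L = k}

/-- The usual topology of the Grassmannian: subspaces are identified with the orthogonal
projections onto them, and convergence is convergence in operator norm. -/
instance Gr.instTopologicalSpace (d k : ℕ) : TopologicalSpace (Gr d k) :=
  TopologicalSpace.induced (fun L : Gr d k => L.1.starProjection) inferInstance

instance Gr.instMeasurableSpace (d k : ℕ) : MeasurableSpace (Gr d k) := borel (Gr d k)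

instance Gr.instBorelSpace (d k : ℕ) : BorelSpace (Gr d k) := ⟨rfl⟩

/-- The orthogonal group `O(d)` is compact. -/
instance orthogonalGroup_compactSpace (d : ℕ) :
    CompactSpace (Matrix.orthogonalGroup (Fin d) ℝ) := by
  refine isCompact_iff_compactSpace.mp ?_
  have hK : IsCompact (Set.pi univ (fun _ : Fin d => Set.pi univ
      (fun _ : Fin d => Metric.closedBall (0 : ℝ) 1))) :=
    isCompact_univ_pi (fun _ => isCompact_univ_pi (fun _ => isCompact_closedBall 0 1))
  refine IsCompact.of_isClosed_subset (X := Matrix (Fin d) (Fin d) ℝ) hK ?_ ?_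
  · have h : ((Matrix.orthogonalGroup (Fin d) ℝ : Set (Matrix (Fin d) (Fin d) ℝ)))
        = {A | A * star A = 1} := by
      ext A
      exact Matrix.mem_orthogonalGroup_iff (Fin d) ℝ
    rw [h]
    exact isClosed_eq (continuous_id.mul continuous_star) continuous_const
  · intro A hA i _ j _
    simpa using entry_norm_bound_of_unitary hA i j

instance orthogonalGroup_measurableSpace (d : ℕ) :
    MeasurableSpace (Matrix.orthogonalGroup (Fin d) ℝ) := borel _

instance orthogonalGroup_borelSpace (d : ℕ) :
    BorelSpace (Matrix.orthogonalGroup (Fin d) ℝ) := ⟨rfl⟩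

/-- The subspace `θ(L)`, for `θ ∈ O(d)` and `L ∈ G(d,k)`. -/
def Gr.rotate {d k : ℕ} (θ : Matrix.orthogonalGroup (Fin d) ℝ) (L : Gr d k) : Gr d k :=
  ⟨L.1.map (Matrix.toEuclideanLin (θ : Matrix (Fin d) (Fin d) ℝ)), by
    have hinj : Function.Injective
        (Matrix.toEuclideanLin (θ : Matrix (Fin d) (Fin d) ℝ)) := by
      intro x y hxy
      have hθ : star (θ : Matrix (Fin d) (Fin d) ℝ) * (θ : Matrix (Fin d) (Fin d) ℝ) = 1 := (Matrix.mem_orthogonalGroup_iff' (Fin d) ℝ).mp θ.2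
      have h2 := congrArg (fun v => (star (θ : Matrix (Fin d) (Fin d) ℝ)).mulVec v.ofLp) hxy
      simp only [Matrix.toLpLin_apply, Matrix.mulVec_mulVec] at h2
      rw [hθ, Matrix.one_mulVec, Matrix.one_mulVec] at h2
      exact WithLp.ofLp_injective 2 h2
    rw [← (Submodule.equivMapOfInjective _ hinj L.1).finrank_eq, L.2]⟩

/-- `θ ↦ θ(L)` is continuous, so that the push-forward below is genuine. -/
theorem Gr.continuous_rotate {d k : ℕ} (L : Gr d k) : Continuous (fun θ => Gr.rotate θ L) := by
  rw [continuous_induced_rng]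
  have key : ∀ θ : Matrix.orthogonalGroup (Fin d) ℝ,
     (Gr.rotate θ L).1.starProjection =
      Matrix.toEuclideanCLM (n := Fin d) (𝕜 := ℝ) θ.1 ∘L L.1.starProjection ∘L Matrix.toEuclideanCLM (n := Fin d) (𝕜 := ℝ) (star θ.1) := by
    intro θ
    have hs : Matrix.toEuclideanCLM (n := Fin d) (𝕜 := ℝ) (star θ.1) = star (Matrix.toEuclideanCLM (n := Fin d) (𝕜 := ℝ) (θ.1)) := map_star _ _
    have hθ : θ.1 * star θ.1 = 1 := (Matrix.mem_orthogonalGroup_iff (Fin d) ℝ).mp θ.2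
    have h1 : Matrix.toEuclideanCLM (n := Fin d) (𝕜 := ℝ) (θ.1) * Matrix.toEuclideanCLM (n := Fin d) (𝕜 := ℝ) (star θ.1) = 1 := by
      rw [← map_mul, hθ, map_one]
    ext1 x
    apply Submodule.eq_starProjection_of_mem_of_inner_eq_zero
    · exact ⟨_, Submodule.starProjection_apply_mem _ _, rfl⟩
    · rintro _ ⟨w, hw, rfl⟩
      have hx : x = Matrix.toEuclideanCLM (n := Fin d) (𝕜 := ℝ) (θ.1) (Matrix.toEuclideanCLM (n := Fin d) (𝕜 := ℝ) (star θ.1) x) := by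
        have := congrArg (fun T => T x) h1
        exact this.symm
      set y := Matrix.toEuclideanCLM (n := Fin d) (𝕜 := ℝ) (star θ.1) x with hy
      have h2 : Matrix.toEuclideanCLM (n := Fin d) (𝕜 := ℝ) (star θ.1) * Matrix.toEuclideanCLM (n := Fin d) (𝕜 := ℝ) (θ.1) = 1 := by
        rw [← map_mul, show star θ.1 * θ.1 = 1 from (Matrix.mem_orthogonalGroup_iff' (Fin d) ℝ).mp θ.2, map_one]
      change inner ℝ (x - Matrix.toEuclideanCLM (n := Fin d) (𝕜 := ℝ) (θ.1) (L.1.starProjection y)) (Matrix.toEuclideanCLM (n := Fin d) (𝕜 := ℝ) (θ.1) w) = 0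
      rw [hx, ← map_sub, ← ContinuousLinearMap.adjoint_inner_left, ← ContinuousLinearMap.star_eq_adjoint, ← hs]
      have h3 := congrArg (fun T => T (y - L.1.starProjection y)) h2
      simp only [mul_apply_eq_comp, one_apply_eq_self] at h3
      rw [h3]
      exact Submodule.starProjection_inner_eq_zero y w hw
  have hf : ((fun L : Gr d k => L.1.starProjection) ∘ fun θ => Gr.rotate θ L) = _ := funext key
  rw [hf]
  have hc : Continuous (Matrix.toEuclideanCLM (n := Fin d) (𝕜 := ℝ)) :=
    LinearMap.continuous_of_finiteDimensional (Matrix.toEuclideanCLM (n := Fin d) (𝕜 := ℝ)).toAlgEquiv.toLinearMap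
  exact (hc.comp continuous_subtype_val).clm_comp (continuous_const.clm_comp (hc.comp (continuous_subtype_val.star)))

/-- The span of the first `k` coordinate vectors, a base point of `G(d,k)`. -/
def Gr.coord {d k : ℕ} (h : k ≤ d) : Gr d k :=
  ⟨Submodule.span ℝ (Set.range fun i : Fin k =>
      EuclideanSpace.basisFun (Fin d) ℝ (Fin.castLE h i)), by
    have hli := (EuclideanSpace.basisFun (Fin d) ℝ).orthonormal.linearIndependent.comp _
      (Fin.castLE_injective h)
    exact (finrank_span_eq_card hli).trans (Fintype.card_fin k)⟩

/-- The rotation invariant probability measure on `G(d,k)`: the measure of `F` is the normalized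
Haar measure of `{θ ∈ O(d) : θ(L₀) ∈ F}` for a fixed `L₀ ∈ G(d,k)`. -/
def grMeasure {d k : ℕ} (h : k ≤ d) : Measure (Gr d k) :=
  (Measure.haarMeasure (⊤ : TopologicalSpace.PositiveCompacts
    (Matrix.orthogonalGroup (Fin d) ℝ))).map (fun θ => Gr.rotate θ (Gr.coord h))

theorem grMeasure_univ {d k : ℕ} (h : k ≤ d) : grMeasure h univ = 1 := by
  unfold grMeasure
  rw [Measure.map_apply (Gr.continuous_rotate _).measurable MeasurableSet.univ, preimage_univ]
  exact Measure.haarMeasure_self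

/-- The `δ` plate `L_δ(a)`: the `δ` neighborhood of the intersection of `B(a, 1/2)` with the
affine plane `a + L`. -/
def plate {d k : ℕ} (L : Gr d k) (δ : ℝ) (a : EuclideanSpace ℝ (Fin d)) :
    Set (EuclideanSpace ℝ (Fin d)) :=
  Metric.thickening δ (Metric.ball a (1 / 2) ∩ {y | y - a ∈ L.1})

/-- The maximal operator `𝓜^k_δ`: the supremum over all `a` of the average of `f` over the
plate `L_δ(a)`. -/
def plateMax {d k : ℕ} (δ : ℝ) (f : EuclideanSpace ℝ (Fin d) → ℝ≥0∞) (L : Gr d k) : ℝ≥0∞ :=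
  ⨆ a : EuclideanSpace ℝ (Fin d), (volume (plate L δ a))⁻¹ * ∫⁻ y in plate L δ a, f y

/-- The maximal operator `𝓝^k`: the supremum over all `x` of the integral of `f` over the affine
plane `x + L`, with respect to `k`-dimensional Lebesgue measure. -/
def planeMax {d k : ℕ} (f : EuclideanSpace ℝ (Fin d) → ℝ≥0∞) (L : Gr d k) : ℝ≥0∞ :=
  ⨆ x : EuclideanSpace ℝ (Fin d), ∫⁻ y : L.1, f (x + y)

/-- `𝓜^k_δ` satisfies, for all `0 < δ ≤ 1`, an `L^p(ℝᵈ) → L^p(G(d,k))` bound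
`≲ δ^(-s)`, with a constant that depends neither on `δ` nor on `f`. -/
def PlateMaxBound {d k : ℕ} (h : k ≤ d) (p s : ℝ) : Prop :=
  ∃ C : ℝ≥0, ∀ δ : ℝ, 0 < δ → δ ≤ 1 →
    ∀ f : EuclideanSpace ℝ (Fin d) → ℝ, MemLp f (ENNReal.ofReal p) volume →
      eLpNorm (plateMax (k := k) δ (fun y => ‖f y‖ₑ)) (ENNReal.ofReal p) (grMeasure h)
        ≤ C * ENNReal.ofReal (δ ^ (-s)) * eLpNorm f (ENNReal.ofReal p) volume

end

/-! Write d = n + 1 and k = m + 1. A random k-plane is spanned by a random direction θ(e₁) together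
with a random m-plane of its orthogonal complement, a copy of ℝⁿ; this is right invariance of Haar
measure under the stabilizer of e₁ (`lintegral_orthHaar_stabE`). By Fubini, the integral of f over
an affine k-plane is the integral of the X-ray transform `xray f θ` over an affine m-plane of ℝⁿ.
The hypothesis controls m-planes at scale r with loss r^(-α) in p-th powers, and the X-ray transform
gains almost a factor r on the part of f living at scale r. This turns α into α - 1.

Smoothing. Averaged over directions, ‖X h‖₂² equals c ∫ |z|^(-n) Q(z) dz, where Q is the
autocorrelation of h (`lintegral_xray_sq`). Let A_r denote the average over balls of radius r and
take h = A_{r/2} f - A_r f. The averages can be moved onto the kernel, and ∫ ||z - w|^(-n) -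
|z|^(-n)| dz over a bounded set is O(|w|^(1-ε)), so ‖X h‖₂² ≲ r^(1-ε) ‖f‖₂² without any Fourier
analysis. Interpolation with the trivial L^∞ bound gives ‖X h‖_p^p ≲ r^(1-ε) ‖f‖_p^p for p ≥ 2
(`exists_lintegral_xray_avgDiff_rpow_le`).

Decomposition. With r_j = 2^(-j)/8 and v_j = A_{r_{j+1}} f - A_{r_j} f, the averages commute, so
A_{r_{j+1}}² f - A_{r_j}² f = (A_{r_{j+1}} + A_{r_j}) v_j. The outer average that survives makes
m-plane integrals of each piece comparable to plate averages of |X v_j| at scale r_j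
(`exists_planeMax_avgE_le`). The hypothesis and the smoothing estimate then bound the p-th power of
the k-plane maximal function of A_{r_J}² f by ‖f‖_p^p times 1 + Σ_{j<J} r_j^(1-α-2η)
(`PlateMaxBound.exists_lintegral_planeMax_le`).

If α < 1 the sum is bounded for small η, and J → ∞ by Fatou for lower semicontinuous functions; a
general f is handled through lower semicontinuous majorants. If α ≥ 1 the sum is stopped at r_J ~ δ,
where it is O(δ^(-(α-1+ε))); plate averages at scale δ are dominated by plane integrals of A_{r_J}²
f, and bounded support is removed by averaging over localizations to balls. -/

noncomputable section

/-! ### The orthogonal group and its Haar measure. -/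

/-- The orthogonal group acts on `ℝᵈ` by all linear isometries. -/
def orthEquiv (d : ℕ) : Matrix.orthogonalGroup (Fin d) ℝ ≃*
    (EuclideanSpace ℝ (Fin d) ≃ₗᵢ[ℝ] EuclideanSpace ℝ (Fin d)) :=
  (Unitary.mapEquiv { (Matrix.toEuclideanCLM (n := Fin d) (𝕜 := ℝ)).toRingEquiv.toMulEquiv with
    map_star' := fun a => map_star (Matrix.toEuclideanCLM (n := Fin d) (𝕜 := ℝ)) a }).toMulEquiv.trans
    Unitary.linearIsometryEquiv

theorem orthEquiv_apply {d : ℕ} (θ : Matrix.orthogonalGroup (Fin d) ℝ)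
    (x : EuclideanSpace ℝ (Fin d)) :
    orthEquiv d θ x = Matrix.toEuclideanLin (θ : Matrix (Fin d) (Fin d) ℝ) x := rfl

theorem orthEquiv_apply_coord {d : ℕ} (θ : Matrix.orthogonalGroup (Fin d) ℝ)
    (x : EuclideanSpace ℝ (Fin d)) (i : Fin d) :
    orthEquiv d θ x i = ∑ j, (θ : Matrix (Fin d) (Fin d) ℝ) i j * x j := rfl

theorem continuous_orthEquiv (d : ℕ) :
    Continuous fun q : Matrix.orthogonalGroup (Fin d) ℝ × EuclideanSpace ℝ (Fin d) =>
      orthEquiv d q.1 q.2 := by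
  rw [(PiLp.homeomorph 2 (fun _ : Fin d => ℝ)).isInducing.continuous_iff]
  refine continuous_pi fun i => ?_
  change Continuous fun q : Matrix.orthogonalGroup (Fin d) ℝ × EuclideanSpace ℝ (Fin d) =>
    orthEquiv d q.1 q.2 i
  simp only [orthEquiv_apply_coord]
  refine continuous_finsetSum _ fun j _ => Continuous.mul ?_ ?_
  · have h : Continuous fun A : Matrix (Fin d) (Fin d) ℝ => A i j := by fun_prop
    exact h.comp (continuous_subtype_val.comp continuous_fst)
  · fun_prop

theorem Continuous.orthEquiv {X : Type*} [TopologicalSpace X] {d : ℕ}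
    {f : X → Matrix.orthogonalGroup (Fin d) ℝ} {g : X → EuclideanSpace ℝ (Fin d)}
    (hf : Continuous f) (hg : Continuous g) : Continuous fun x => orthEquiv d (f x) (g x) := by
  have h := (continuous_orthEquiv d).comp (hf.prodMk hg)
  exact h

instance orthogonalGroup_secondCountable (d : ℕ) :
    SecondCountableTopology (Matrix.orthogonalGroup (Fin d) ℝ) :=
  haveI : SecondCountableTopology (Matrix (Fin d) (Fin d) ℝ) :=
    inferInstanceAs (SecondCountableTopology (Fin d → Fin d → ℝ))
  TopologicalSpace.Subtype.secondCountableTopology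
    (Matrix.orthogonalGroup (Fin d) ℝ : Set (Matrix (Fin d) (Fin d) ℝ))

/-- The normalized Haar measure of `O(d)`. -/
def orthHaar (d : ℕ) : Measure (Matrix.orthogonalGroup (Fin d) ℝ) :=
  Measure.haarMeasure ⊤

instance (d : ℕ) : (orthHaar d).IsHaarMeasure := by unfold orthHaar; infer_instance

instance (d : ℕ) : IsProbabilityMeasure (orthHaar d) := ⟨Measure.haarMeasure_self⟩

/-- A right translate of Haar measure is again left invariant, hence a multiple of it by uniqueness;
on a compact group comparing total masses shows that the factor is 1. -/
instance (d : ℕ) : (orthHaar d).IsMulRightInvariant := by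
  refine ⟨fun g => ?_⟩
  have h := Measure.haarMeasure_unique ((orthHaar d).map (· * g)) ⊤
  rw [h]
  have : ((orthHaar d).map (· * g)) ((⊤ : TopologicalSpace.PositiveCompacts
      (Matrix.orthogonalGroup (Fin d) ℝ)) : Set (Matrix.orthogonalGroup (Fin d) ℝ)) = 1 := by
    rw [TopologicalSpace.PositiveCompacts.coe_top,
      Measure.map_apply (measurable_mul_const g) MeasurableSet.univ, preimage_univ, measure_univ]
  rw [this, one_smul, orthHaar]

theorem lintegral_orthHaar_mul_right {d : ℕ} (F : Matrix.orthogonalGroup (Fin d) ℝ → ℝ≥0∞)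
    (g : Matrix.orthogonalGroup (Fin d) ℝ) :
    ∫⁻ θ, F (θ * g) ∂orthHaar d = ∫⁻ θ, F θ ∂orthHaar d :=
  lintegral_mul_right_eq_self F g

/-! ### Splitting off the first coordinate. -/

/-- The vector `(t, y)`. -/
def consE {n : ℕ} (t : ℝ) (y : EuclideanSpace ℝ (Fin n)) : EuclideanSpace ℝ (Fin (n + 1)) :=
  WithLp.toLp 2 (Fin.cons t y.ofLp)

@[simp] theorem consE_zero {n : ℕ} (t : ℝ) (y : EuclideanSpace ℝ (Fin n)) :
    consE t y 0 = t := rfl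

@[simp] theorem consE_succ {n : ℕ} (t : ℝ) (y : EuclideanSpace ℝ (Fin n)) (i : Fin n) :
    consE t y i.succ = y i := rfl

/-- The vector with the first coordinate removed. -/
def tailE {n : ℕ} (x : EuclideanSpace ℝ (Fin (n + 1))) : EuclideanSpace ℝ (Fin n) :=
  WithLp.toLp 2 (fun i => x i.succ)

@[simp] theorem tailE_apply {n : ℕ} (x : EuclideanSpace ℝ (Fin (n + 1))) (i : Fin n) :
    tailE x i = x i.succ := rfl

theorem consE_tailE {n : ℕ} (x : EuclideanSpace ℝ (Fin (n + 1))) : consE (x 0) (tailE x) = x := by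
  ext i
  refine Fin.cases ?_ (fun i => ?_) i <;> simp

theorem consE_add {n : ℕ} (s t : ℝ) (x y : EuclideanSpace ℝ (Fin n)) :
    consE (s + t) (x + y) = consE s x + consE t y := by
  ext i
  refine Fin.cases ?_ (fun i => ?_) i <;> simp

theorem norm_consE_sq {n : ℕ} (t : ℝ) (y : EuclideanSpace ℝ (Fin n)) :
    ‖consE t y‖ ^ 2 = t ^ 2 + ‖y‖ ^ 2 := by
  simp [EuclideanSpace.norm_sq_eq, Fin.sum_univ_succ]

theorem norm_le_norm_consE {n : ℕ} (t : ℝ) (y : EuclideanSpace ℝ (Fin n)) :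
    ‖y‖ ≤ ‖consE t y‖ := by
  have := norm_consE_sq t y
  nlinarith [norm_nonneg y, norm_nonneg (consE t y), sq_nonneg t]

theorem abs_le_norm_consE {n : ℕ} (t : ℝ) (y : EuclideanSpace ℝ (Fin n)) :
    |t| ≤ ‖consE t y‖ := by
  have := norm_consE_sq t y
  have h2 : |t| ^ 2 = t ^ 2 := sq_abs t
  nlinarith [abs_nonneg t, norm_nonneg (consE t y), sq_nonneg ‖y‖]

theorem continuous_consE {n : ℕ} :
    Continuous fun q : ℝ × EuclideanSpace ℝ (Fin n) => consE q.1 q.2 := by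
  rw [(PiLp.homeomorph 2 (fun _ : Fin (n + 1) => ℝ)).isInducing.continuous_iff]
  refine continuous_pi fun i => ?_
  change Continuous fun q : ℝ × EuclideanSpace ℝ (Fin n) => consE q.1 q.2 i
  refine Fin.cases ?_ (fun i => ?_) i
  · exact continuous_fst
  · simp only [consE_succ]; fun_prop

theorem Continuous.consE {X : Type*} [TopologicalSpace X] {n : ℕ}
    {f : X → ℝ} {g : X → EuclideanSpace ℝ (Fin n)}
    (hf : Continuous f) (hg : Continuous g) : Continuous fun x => consE (f x) (g x) :=
  continuous_consE.comp (hf.prodMk hg)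

theorem continuous_tailE {n : ℕ} :
    Continuous (tailE : EuclideanSpace ℝ (Fin (n + 1)) → EuclideanSpace ℝ (Fin n)) := by
  rw [(PiLp.homeomorph 2 (fun _ : Fin n => ℝ)).isInducing.continuous_iff]
  refine continuous_pi fun i => ?_
  change Continuous fun q : EuclideanSpace ℝ (Fin (n + 1)) => tailE q i
  simp only [tailE_apply]; fun_prop

theorem measurePreserving_consE (n : ℕ) :
    MeasurePreserving (fun q : ℝ × EuclideanSpace ℝ (Fin n) => consE q.1 q.2)
      (volume.prod volume) volume := by
  have h1 : MeasurePreserving (Prod.map (id : ℝ → ℝ) (@WithLp.ofLp 2 (Fin n → ℝ)))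
      (volume.prod volume) (volume.prod volume) :=
    (MeasurePreserving.id volume).prod (PiLp.volume_preserving_ofLp (Fin n))
  have h2 := (volume_preserving_piFinSuccAbove (fun _ : Fin (n + 1) => ℝ) 0).symm
  have h3 := PiLp.volume_preserving_toLp (Fin (n + 1))
  have h := h3.comp (h2.comp h1)
  have he : (fun q : ℝ × EuclideanSpace ℝ (Fin n) => consE q.1 q.2) = @WithLp.toLp 2 (Fin (n + 1) → ℝ) ∘
      ((MeasurableEquiv.piFinSuccAbove (fun _ : Fin (n + 1) => ℝ) 0).symm ∘
        Prod.map (id : ℝ → ℝ) (@WithLp.ofLp 2 (Fin n → ℝ))) := by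
    funext q
    ext i
    refine Fin.cases ?_ (fun i => ?_) i
    · rfl
    · rfl
  rw [he]
  exact h

theorem lintegral_consE {n : ℕ} {F : EuclideanSpace ℝ (Fin (n + 1)) → ℝ≥0∞} (hF : Measurable F) :
    ∫⁻ x, F x = ∫⁻ y, ∫⁻ t, F (consE t y) := by
  rw [← (measurePreserving_consE n).lintegral_comp hF,
    lintegral_prod_symm]
  exact (hF.comp (measurePreserving_consE n).measurable).aemeasurable

/-! ### Isometric parametrization of planes. -/

/-- The isometric inclusion of `ℝᵏ` in `ℝᵈ` as the span of the first `k` coordinate vectors. -/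
def padE {k d : ℕ} (h : k ≤ d) :
    EuclideanSpace ℝ (Fin k) →ₗᵢ[ℝ] EuclideanSpace ℝ (Fin d) :=
  ((EuclideanSpace.basisFun (Fin k) ℝ).toBasis.constr ℝ
    (fun i : Fin k => EuclideanSpace.basisFun (Fin d) ℝ (Fin.castLE h i))).isometryOfOrthonormal
    (v := (EuclideanSpace.basisFun (Fin k) ℝ).toBasis)
    (by simp)
    (by
      have := (EuclideanSpace.basisFun (Fin d) ℝ).orthonormal.comp _ (Fin.castLE_injective h)
      have he : ∀ v : Fin k → EuclideanSpace ℝ (Fin d),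
          ((EuclideanSpace.basisFun (Fin k) ℝ).toBasis.constr ℝ v) ∘
            (EuclideanSpace.basisFun (Fin k) ℝ).toBasis = v := fun v => by
        funext i
        exact Module.Basis.constr_basis _ _ _ _
      rw [he]
      exact this)

theorem padE_apply {k d : ℕ} (h : k ≤ d) (z : EuclideanSpace ℝ (Fin k)) :
    padE h z = ∑ i, z i • EuclideanSpace.basisFun (Fin d) ℝ (Fin.castLE h i) := by
  change (EuclideanSpace.basisFun (Fin k) ℝ).toBasis.constr ℝ _ z = _
  rw [Module.Basis.constr_apply_fintype]
  rfl

theorem padE_consE {m n : ℕ} (h : m ≤ n) (t : ℝ) (z : EuclideanSpace ℝ (Fin m)) :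
    padE (Nat.succ_le_succ h) (consE t z) = consE t (padE h z) := by
  ext i
  rw [padE_apply, Fin.sum_univ_succ]
  refine Fin.cases ?_ (fun i => ?_) i
  · simp [Fin.succ_ne_zero]
  · simp [padE_apply, Pi.single_apply, Fin.succ_inj, Fin.succ_ne_zero]

theorem range_padE {k d : ℕ} (h : k ≤ d) :
    LinearMap.range (padE h).toLinearMap = (Gr.coord h).1 := by
  change LinearMap.range ((EuclideanSpace.basisFun (Fin k) ℝ).toBasis.constr ℝ _) = _
  rw [Module.Basis.constr_range]
  rfl

/-- The isometric parametrization of `θ(L₀)` by `ℝᵏ`. -/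
def planeE {k d : ℕ} (h : k ≤ d) (θ : Matrix.orthogonalGroup (Fin d) ℝ) :
    EuclideanSpace ℝ (Fin k) →ₗᵢ[ℝ] EuclideanSpace ℝ (Fin d) :=
  (orthEquiv d θ).toLinearIsometry.comp (padE h)

theorem planeE_apply {k d : ℕ} (h : k ≤ d) (θ : Matrix.orthogonalGroup (Fin d) ℝ)
    (z : EuclideanSpace ℝ (Fin k)) : planeE h θ z = orthEquiv d θ (padE h z) := rfl

theorem range_planeE {k d : ℕ} (h : k ≤ d) (θ : Matrix.orthogonalGroup (Fin d) ℝ) :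
    LinearMap.range (planeE h θ).toLinearMap = (Gr.rotate θ (Gr.coord h)).1 := by
  have : (planeE h θ).toLinearMap =
    (Matrix.toEuclideanLin (θ : Matrix (Fin d) (Fin d) ℝ)) ∘ₗ (padE h).toLinearMap := rfl
  rw [this, LinearMap.range_comp, range_padE]
  rfl

theorem continuous_planeE {k d : ℕ} (h : k ≤ d) :
    Continuous fun q : Matrix.orthogonalGroup (Fin d) ℝ × EuclideanSpace ℝ (Fin k) =>
      planeE h q.1 q.2 := by
  have hp : Continuous fun z => padE h z := (padE h).continuous
  have h2 : Continuous fun q : Matrix.orthogonalGroup (Fin d) ℝ × EuclideanSpace ℝ (Fin k) =>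
      padE h q.2 := hp.comp continuous_snd
  exact continuous_fst.orthEquiv h2

theorem lintegral_range_isometry {k d : ℕ}
    (ι : EuclideanSpace ℝ (Fin k) →ₗᵢ[ℝ] EuclideanSpace ℝ (Fin d))
    {L : Submodule ℝ (EuclideanSpace ℝ (Fin d))} (hL : LinearMap.range ι.toLinearMap = L)
    (F : EuclideanSpace ℝ (Fin d) → ℝ≥0∞) :
    ∫⁻ y : L, F y = ∫⁻ z, F (ι z) := by
  subst hL
  have h := (ι.equivRange).measurePreserving
  have := h.lintegral_comp_emb (ι.equivRange.toHomeomorph.measurableEmbedding)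
    (fun y => F y)
  rw [← this]
  rfl

theorem planeMax_rotate {k d : ℕ} (h : k ≤ d) (F : EuclideanSpace ℝ (Fin d) → ℝ≥0∞)
    (θ : Matrix.orthogonalGroup (Fin d) ℝ) :
    planeMax F (Gr.rotate θ (Gr.coord h)) = ⨆ x, ∫⁻ z, F (x + planeE h θ z) := by
  unfold planeMax
  congr 1 with x
  exact lintegral_range_isometry (planeE h θ) (range_planeE h θ) (fun y => F (x + y))

/-! ### A random plane as a random direction and a random plane orthogonal to it. -/

/-- `O(n)` as the stabilizer of the first coordinate vector in `O(n + 1)`. -/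
def stabE {n : ℕ} (σ : Matrix.orthogonalGroup (Fin n) ℝ) :
    Matrix.orthogonalGroup (Fin (n + 1)) ℝ :=
  ⟨Matrix.of (Fin.cons (Fin.cons 1 0) fun i => Fin.cons 0 (σ.1 i)), by
    rw [Matrix.mem_orthogonalGroup_iff]
    have hσ := (Matrix.mem_orthogonalGroup_iff (Fin n) ℝ).mp σ.2
    ext i j
    have := fun i j => congrFun (congrFun hσ i) j
    refine Fin.cases ?_ (fun i => ?_) i <;> refine Fin.cases ?_ (fun j => ?_) j
    · simp [Matrix.mul_apply, Fin.sum_univ_succ]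
    · simp [Matrix.mul_apply, Fin.sum_univ_succ, (Fin.succ_ne_zero _).symm]
    · simp [Matrix.mul_apply, Fin.sum_univ_succ]
    · have := this i j
      simp only [Matrix.mul_apply, Matrix.one_apply] at this
      simpa [Matrix.mul_apply, Fin.sum_univ_succ, Matrix.one_apply] using this⟩

theorem orthEquiv_stabE {n : ℕ} (σ : Matrix.orthogonalGroup (Fin n) ℝ) (t : ℝ)
    (y : EuclideanSpace ℝ (Fin n)) :
    orthEquiv (n + 1) (stabE σ) (consE t y) = consE t (orthEquiv n σ y) := by
  ext i
  rw [orthEquiv_apply_coord, Fin.sum_univ_succ]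
  refine Fin.cases ?_ (fun i => ?_) i
  · simp [stabE]
  · simp [stabE, orthEquiv_apply_coord]

theorem continuous_stabE {n : ℕ} :
    Continuous (stabE : Matrix.orthogonalGroup (Fin n) ℝ → _) := by
  refine Continuous.subtype_mk ?_ _
  refine continuous_matrix fun i j => ?_
  refine Fin.cases ?_ (fun i => ?_) i <;> refine Fin.cases ?_ (fun j => ?_) j
  · simpa using continuous_const
  · simpa using continuous_const
  · simpa using continuous_const
  · have h : Continuous fun A : Matrix (Fin n) (Fin n) ℝ => A i j := by fun_prop
    exact h.comp continuous_subtype_val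

/-- The base plane contains e₁ and `stabE σ` fixes e₁. The k-plane of θ · `stabE σ` is therefore
spanned by θ(e₁) and the θ-image of the m-plane of σ inside the complement of e₁. -/
theorem planeE_mul_stabE {m n : ℕ} (h : m ≤ n) (θ : Matrix.orthogonalGroup (Fin (n + 1)) ℝ)
    (σ : Matrix.orthogonalGroup (Fin n) ℝ) (t : ℝ) (z : EuclideanSpace ℝ (Fin m)) :
    planeE (Nat.succ_le_succ h) (θ * stabE σ) (consE t z) =
      orthEquiv (n + 1) θ (consE t (planeE h σ z)) := by
  rw [planeE_apply, map_mul, padE_consE h, planeE_apply, ← orthEquiv_stabE]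
  rfl

/-- After Tonelli the inner integral over θ is a right translate by `stabE σ`, hence does not depend
on σ. -/
theorem lintegral_orthHaar_stabE {n : ℕ} {F : Matrix.orthogonalGroup (Fin (n + 1)) ℝ → ℝ≥0∞}
    (hF : Measurable F) :
    ∫⁻ θ, F θ ∂orthHaar (n + 1) =
      ∫⁻ θ, ∫⁻ σ, F (θ * stabE σ) ∂orthHaar n ∂orthHaar (n + 1) := by
  rw [lintegral_lintegral_swap]
  · simp only [lintegral_orthHaar_mul_right, lintegral_const, measure_univ, mul_one]
  · have : Continuous fun q : Matrix.orthogonalGroup (Fin (n + 1)) ℝ ×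
        Matrix.orthogonalGroup (Fin n) ℝ => q.1 * stabE q.2 :=
      continuous_fst.mul (continuous_stabE.comp continuous_snd)
    exact (hF.comp this.measurable).aemeasurable

attribute [irreducible] orthEquiv

/-! ### Lower semicontinuity, the source of all measurability below. -/

open Filter Topology in
/-- Fatou's lemma: integrals of lower semicontinuous functions of a parameter are lower
semicontinuous. -/
theorem lowerSemicontinuous_lintegral {X Y : Type*} [TopologicalSpace X] [FirstCountableTopology X]
    [MeasurableSpace Y] {μ : Measure Y} {F : X → Y → ℝ≥0∞} (hm : ∀ x, Measurable (F x))
    (hl : ∀ y, LowerSemicontinuous fun x => F x y) :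
    LowerSemicontinuous fun x => ∫⁻ y, F x y ∂μ := by
  intro x
  refine lowerSemicontinuousAt_iff_le_liminf.mpr ?_
  calc ∫⁻ y, F x y ∂μ ≤ ∫⁻ y, liminf (fun x' => F x' y) (𝓝 x) ∂μ :=
        lintegral_mono fun y => lowerSemicontinuousAt_iff_le_liminf.mp (hl y x)
    _ ≤ _ := lintegral_liminf_le hm

theorem lowerSemicontinuous_const_mul {X : Type*} [TopologicalSpace X] {f : X → ℝ≥0∞}
    (hf : LowerSemicontinuous f) {c : ℝ≥0∞} (hc : c ≠ ∞) :
    LowerSemicontinuous fun x => c * f x :=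
  (ENNReal.continuous_const_mul hc).comp_lowerSemicontinuous hf
    (fun _ _ h => mul_le_mul_right h c)

/-- The restriction of a lower semicontinuous function to an open set is lower semicontinuous. -/
theorem lowerSemicontinuous_indicator_of_isOpen {X : Type*} [TopologicalSpace X] {f : X → ℝ≥0∞}
    (hf : LowerSemicontinuous f) {U : Set X} (hU : IsOpen U) :
    LowerSemicontinuous (U.indicator f) := by
  intro x c hc
  by_cases hx : x ∈ U
  · rw [indicator_of_mem hx] at hc
    filter_upwards [hU.mem_nhds hx, hf x c hc] with y hy hcy
    rwa [indicator_of_mem hy]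
  · rw [indicator_of_notMem hx] at hc
    exact absurd hc not_lt_zero

/-! ### Averages over balls. -/

/-- The uniform probability measure on the ball of radius `r` around `0`. -/
def ballAvg (d : ℕ) (r : ℝ) : Measure (EuclideanSpace ℝ (Fin d)) :=
  (volume (Metric.ball (0 : EuclideanSpace ℝ (Fin d)) r))⁻¹ • volume.restrict (Metric.ball 0 r)

theorem volume_ball_ne_zero {d : ℕ} (x : EuclideanSpace ℝ (Fin d)) {r : ℝ} (hr : 0 < r) :
    volume (Metric.ball x r) ≠ 0 := (Metric.measure_ball_pos volume x hr).ne'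

theorem volume_ball_ne_top {d : ℕ} (x : EuclideanSpace ℝ (Fin d)) (r : ℝ) :
    volume (Metric.ball x r) ≠ ∞ := measure_ball_lt_top.ne

theorem isProbabilityMeasure_ballAvg (d : ℕ) {r : ℝ} (hr : 0 < r) :
    IsProbabilityMeasure (ballAvg d r) := by
  refine ⟨?_⟩
  simp only [ballAvg, Measure.smul_apply, Measure.restrict_apply_univ, smul_eq_mul]
  exact ENNReal.inv_mul_cancel (volume_ball_ne_zero _ hr) (volume_ball_ne_top _ _)

instance (d : ℕ) (r : ℝ) : SFinite (ballAvg d r) := by unfold ballAvg; infer_instance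

theorem ae_ballAvg (d : ℕ) (r : ℝ) : ∀ᵐ z ∂ballAvg d r, ‖z‖ < r := by
  refine Measure.ae_smul_measure ?_ _
  filter_upwards [ae_restrict_mem Metric.isOpen_ball.measurableSet] with z hz
  simpa using hz

theorem lintegral_ballAvg {d : ℕ} (r : ℝ) (F : EuclideanSpace ℝ (Fin d) → ℝ≥0∞) :
    ∫⁻ z, F z ∂ballAvg d r = (volume (Metric.ball (0 : EuclideanSpace ℝ (Fin d)) r))⁻¹ *
      ∫⁻ z in Metric.ball 0 r, F z := by
  rw [ballAvg, lintegral_smul_measure, smul_eq_mul]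

theorem map_orthEquiv_ballAvg {d : ℕ} (r : ℝ) (θ : Matrix.orthogonalGroup (Fin d) ℝ) :
    (ballAvg d r).map (orthEquiv d θ) = ballAvg d r := by
  have h := (orthEquiv d θ).measurePreserving
  have h2 : orthEquiv d θ ⁻¹' Metric.ball 0 r = Metric.ball 0 r := by
    ext x; simp
  rw [ballAvg, Measure.map_smul]
  congr 1
  have := (h.restrict_preimage (s := Metric.ball 0 r) Metric.isOpen_ball.measurableSet).map_eq
  rwa [h2] at this

/-- The average of `F` over the ball of radius `r` around `x`. -/
def avgE {d : ℕ} (r : ℝ) (F : EuclideanSpace ℝ (Fin d) → ℝ≥0∞) (x : EuclideanSpace ℝ (Fin d)) :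
    ℝ≥0∞ := ∫⁻ z, F (x + z) ∂ballAvg d r

theorem avgE_eq {d : ℕ} (r : ℝ) (F : EuclideanSpace ℝ (Fin d) → ℝ≥0∞)
    (x : EuclideanSpace ℝ (Fin d)) :
    avgE r F x = (volume (Metric.ball (0 : EuclideanSpace ℝ (Fin d)) r))⁻¹ *
      ∫⁻ z in Metric.ball x r, F z := by
  rw [avgE, lintegral_ballAvg]
  congr 1
  rw [← lintegral_indicator Metric.isOpen_ball.measurableSet,
    ← lintegral_indicator Metric.isOpen_ball.measurableSet,
    ← lintegral_add_left_eq_self ((Metric.ball x r).indicator F) x]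
  congr 1 with z
  simp only [indicator, Metric.mem_ball, dist_zero_right, dist_self_add_left]

/-- Averages over balls of a measurable function which depends on a parameter in a lower
semicontinuous way. -/
theorem lowerSemicontinuous_avgE_param {X : Type*} [TopologicalSpace X] [FirstCountableTopology X]
    {d : ℕ} {r : ℝ} (hr : 0 < r) {G : X → EuclideanSpace ℝ (Fin d) → ℝ≥0∞}
    (hm : ∀ c, Measurable (G c)) (hl : ∀ z, LowerSemicontinuous fun c => G c z) :
    LowerSemicontinuous fun q : X × EuclideanSpace ℝ (Fin d) => avgE r (G q.1) q.2 := by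
  simp only [avgE_eq, ← lintegral_indicator Metric.isOpen_ball.measurableSet]
  refine lowerSemicontinuous_const_mul ?_ (ENNReal.inv_ne_top.mpr (volume_ball_ne_zero _ hr))
  refine lowerSemicontinuous_lintegral (fun q => (hm q.1).indicator
    Metric.isOpen_ball.measurableSet) fun z => ?_
  -- For a fixed point z, lying in the open ball is an open condition on the centre. This gives
  -- semicontinuity in the centre although the averaged function is only measurable in z.
  have hU : IsOpen {q : X × EuclideanSpace ℝ (Fin d) | dist z q.2 < r} :=
    isOpen_lt (by fun_prop) continuous_const
  exact lowerSemicontinuous_indicator_of_isOpen ((hl z).comp continuous_fst) hU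

theorem lowerSemicontinuous_avgE {d : ℕ} {r : ℝ} (hr : 0 < r)
    {F : EuclideanSpace ℝ (Fin d) → ℝ≥0∞} (hF : Measurable F) :
    LowerSemicontinuous (avgE r F) :=
  (lowerSemicontinuous_avgE_param (X := Unit) hr (G := fun _ => F) (fun _ => hF)
    (fun _ => lowerSemicontinuous_const)).comp (g := fun x => ((), x)) (by fun_prop)

/-- The isometric parametrization moves the rotation into the argument of F, so Fatou applies for
each base point, and suprema preserve lower semicontinuity. The extra parameter will be the centre
of a localizing ball. -/
theorem lowerSemicontinuous_planeMax_param {X : Type*} [TopologicalSpace X]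
    [FirstCountableTopology X] {d k : ℕ} (h : k ≤ d) {F : X × EuclideanSpace ℝ (Fin d) → ℝ≥0∞}
    (hF : LowerSemicontinuous F) :
    LowerSemicontinuous fun q : X × Matrix.orthogonalGroup (Fin d) ℝ =>
      planeMax (fun x => F (q.1, x)) (Gr.rotate q.2 (Gr.coord h)) := by
  simp only [planeMax_rotate]
  refine lowerSemicontinuous_iSup fun x => lowerSemicontinuous_lintegral (fun q => ?_) fun z => ?_
  · have : Continuous fun z => (q.1, x + planeE h q.2 z) := by
      have := (planeE h q.2).continuous
      fun_prop
    exact (hF.comp this).measurable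
  · refine hF.comp (g := fun q : X × Matrix.orthogonalGroup (Fin d) ℝ =>
      (q.1, x + planeE h q.2 z)) ?_
    have h2 : Continuous fun q : X × Matrix.orthogonalGroup (Fin d) ℝ => planeE h q.2 z :=
      (continuous_planeE h).comp (continuous_snd.prodMk continuous_const)
    exact continuous_fst.prodMk (continuous_const.add h2)

theorem lowerSemicontinuous_planeMax_rotate {d k : ℕ} (h : k ≤ d)
    {F : EuclideanSpace ℝ (Fin d) → ℝ≥0∞} (hF : LowerSemicontinuous F) :
    LowerSemicontinuous fun θ : Matrix.orthogonalGroup (Fin d) ℝ =>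
      planeMax F (Gr.rotate θ (Gr.coord h)) :=
  (lowerSemicontinuous_planeMax_param (X := Unit) h (hF.comp continuous_snd)).comp
    (g := fun θ => ((), θ)) (by fun_prop)

/-! ### The Grassmannian as a quotient of the orthogonal group -/

theorem Gr.injective_starProjection (d k : ℕ) :
    Function.Injective fun L : Gr d k => L.1.starProjection := fun _ _ h =>
  Subtype.ext (Submodule.starProjection_inj.mp h)

instance (d k : ℕ) : T2Space (Gr d k) :=
  (Topology.IsEmbedding.mk ⟨rfl⟩ (Gr.injective_starProjection d k)).t2Space

/-- An isometry from the base plane onto L extends to an isometry of the whole space. -/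
theorem Gr.rotate_surjective {d k : ℕ} (h : k ≤ d) :
    Function.Surjective fun θ => Gr.rotate θ (Gr.coord (d := d) h) := by
  intro L
  let e : (Gr.coord (d := d) h).1 ≃ₗᵢ[ℝ] L.1 :=
    (stdOrthonormalBasis ℝ (Gr.coord (d := d) h).1).equiv (stdOrthonormalBasis ℝ L.1)
      (finCongr ((Gr.coord h).2.trans L.2.symm))
  let ψ := (L.1.subtypeₗᵢ.comp e.toLinearIsometry).extend
  refine ⟨(orthEquiv d).symm (ψ.toLinearIsometryEquiv rfl), Subtype.ext ?_⟩
  have hψ : ∀ x, Matrix.toEuclideanLin ((orthEquiv d).symm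
      (ψ.toLinearIsometryEquiv rfl) : Matrix (Fin d) (Fin d) ℝ) x = ψ x := fun x => by
    rw [← orthEquiv_apply, MulEquiv.apply_symm_apply]; rfl
  ext y
  simp only [Gr.rotate, Submodule.mem_map]
  constructor
  · rintro ⟨x, hx, rfl⟩
    rw [hψ]
    have := LinearIsometry.extend_apply (L.1.subtypeₗᵢ.comp e.toLinearIsometry) ⟨x, hx⟩
    exact this ▸ (e ⟨x, hx⟩).2
  · intro hy
    refine ⟨e.symm ⟨y, hy⟩, (e.symm ⟨y, hy⟩).2, ?_⟩
    rw [hψ]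
    refine (LinearIsometry.extend_apply (L.1.subtypeₗᵢ.comp e.toLinearIsometry) _).trans ?_
    simp

/-- A continuous surjection from a compact space to a Hausdorff space is closed, hence a quotient
map. Semicontinuity on the Grassmannian can therefore be checked on the orthogonal group. -/
theorem Gr.isQuotientMap_rotate {d k : ℕ} (h : k ≤ d) :
    Topology.IsQuotientMap fun θ => Gr.rotate θ (Gr.coord (d := d) h) :=
  (Gr.continuous_rotate _).isClosedMap.isQuotientMap (Gr.continuous_rotate _)
    (Gr.rotate_surjective h)

theorem Gr.lowerSemicontinuous_of_rotate {d k : ℕ} (h : k ≤ d) {F : Gr d k → ℝ≥0∞}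
    (hF : LowerSemicontinuous fun θ => F (Gr.rotate θ (Gr.coord h))) : LowerSemicontinuous F := by
  rw [lowerSemicontinuous_iff_isOpen_preimage] at hF ⊢
  exact fun y => (Gr.isQuotientMap_rotate h).isOpen_preimage.mp (hF y)

theorem lintegral_grMeasure {d k : ℕ} (h : k ≤ d) {F : Gr d k → ℝ≥0∞} (hF : Measurable F) :
    ∫⁻ L, F L ∂grMeasure h = ∫⁻ θ, F (Gr.rotate θ (Gr.coord h)) ∂orthHaar d :=
  lintegral_map hF (Gr.continuous_rotate _).measurable

/-- The one-sided form needs no measurability of F. -/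
theorem lintegral_grMeasure_le {d k : ℕ} (h : k ≤ d) (F : Gr d k → ℝ≥0∞) :
    ∫⁻ L, F L ∂grMeasure h ≤ ∫⁻ θ, F (Gr.rotate θ (Gr.coord h)) ∂orthHaar d :=
  lintegral_map_le _ _

/-! ### Plates -/

theorem mem_plate_rotate {d k : ℕ} (h : k ≤ d) (θ : Matrix.orthogonalGroup (Fin d) ℝ) {δ : ℝ}
    {a x : EuclideanSpace ℝ (Fin d)} :
    x ∈ plate (Gr.rotate θ (Gr.coord h)) δ a ↔
      ∃ z : EuclideanSpace ℝ (Fin k), ‖z‖ < 1 / 2 ∧ dist x (a + planeE h θ z) < δ := by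
  simp only [plate, Metric.mem_thickening_iff, mem_inter_iff, Metric.mem_ball, mem_ofPred_eq,
    ← range_planeE h θ]
  constructor
  · rintro ⟨y, ⟨h1, z, hz⟩, h2⟩
    have hy : y = a + planeE h θ z := by
      have : planeE h θ z = y - a := hz
      rw [this]; abel
    refine ⟨z, ?_, hy ▸ h2⟩
    rwa [hy, dist_self_add_left, LinearIsometry.norm_map] at h1
  · rintro ⟨z, h1, h2⟩
    refine ⟨a + planeE h θ z, ⟨?_, z, ?_⟩, h2⟩
    · rwa [dist_self_add_left, LinearIsometry.norm_map]
    · simp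

/-- Every plate is a rigid motion of one fixed plate. This makes the volume independent of θ and a,
and makes membership an open condition on θ. -/
theorem mem_plate_rotate_iff {d k : ℕ} (h : k ≤ d) (θ : Matrix.orthogonalGroup (Fin d) ℝ) {δ : ℝ}
    {a x : EuclideanSpace ℝ (Fin d)} :
    x ∈ plate (Gr.rotate θ (Gr.coord h)) δ a ↔
      orthEquiv d θ⁻¹ (x - a) ∈ plate (Gr.rotate 1 (Gr.coord h)) δ 0 := by
  rw [mem_plate_rotate, mem_plate_rotate]
  refine exists_congr fun z => and_congr_right fun _ => ?_
  have h1 : a + planeE h θ z = a + orthEquiv d θ (padE h z) := rfl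
  have h2 : planeE h 1 z = padE h z := by rw [planeE_apply, map_one]; rfl
  rw [h1, h2, map_inv, zero_add, ← (orthEquiv d θ).dist_map ((orthEquiv d θ)⁻¹ (x - a))]
  have h3 : orthEquiv d θ ((orthEquiv d θ)⁻¹ (x - a)) = x - a :=
    (orthEquiv d θ).apply_symm_apply _
  rw [h3, dist_eq_norm, dist_eq_norm, sub_sub]

theorem isOpen_plate {d k : ℕ} (L : Gr d k) (δ : ℝ) (a : EuclideanSpace ℝ (Fin d)) :
    IsOpen (plate L δ a) := Metric.isOpen_thickening

theorem measurePreserving_orthEquiv_sub {d : ℕ} (θ : Matrix.orthogonalGroup (Fin d) ℝ)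
    (a : EuclideanSpace ℝ (Fin d)) :
    MeasurePreserving (fun x => orthEquiv d θ (x - a)) volume volume := by
  have h1 := (orthEquiv d θ).measurePreserving
  have h2 := measurePreserving_sub_right (volume : Measure (EuclideanSpace ℝ (Fin d))) a
  exact h1.comp h2

theorem plate_rotate_eq_preimage {d k : ℕ} (h : k ≤ d) (θ : Matrix.orthogonalGroup (Fin d) ℝ)
    (δ : ℝ) (a : EuclideanSpace ℝ (Fin d)) :
    plate (Gr.rotate θ (Gr.coord h)) δ a = (fun x => orthEquiv d θ⁻¹ (x - a)) ⁻¹'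
      plate (Gr.rotate 1 (Gr.coord (d := d) h)) δ 0 :=
  Set.ext fun _ => mem_plate_rotate_iff h θ

theorem volume_plate_rotate {d k : ℕ} (h : k ≤ d) (θ : Matrix.orthogonalGroup (Fin d) ℝ) (δ : ℝ)
    (a : EuclideanSpace ℝ (Fin d)) :
    volume (plate (Gr.rotate θ (Gr.coord h)) δ a) =
      volume (plate (Gr.rotate 1 (Gr.coord (d := d) h)) δ 0) := by
  rw [plate_rotate_eq_preimage h θ δ a]
  exact (measurePreserving_orthEquiv_sub θ⁻¹ a).measure_preimage
    (isOpen_plate _ _ _).measurableSet.nullMeasurableSet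

theorem volume_plate_ne_zero {d k : ℕ} (L : Gr d k) {δ : ℝ} (hδ : 0 < δ)
    (a : EuclideanSpace ℝ (Fin d)) : volume (plate L δ a) ≠ 0 := by
  refine ((isOpen_plate L δ a).measure_pos volume ⟨a, ?_⟩).ne'
  rw [plate, Metric.mem_thickening_iff]
  exact ⟨a, ⟨by simp, by simp⟩, by simpa using hδ⟩

/-- The normalizing volume is constant in θ, so only the integral over a moving open set varies, and
that is lower semicontinuous; an uncountable supremum over centres is then harmless. -/
theorem measurable_plateMax {d k : ℕ} (h : k ≤ d) {δ : ℝ} (hδ : 0 < δ)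
    {F : EuclideanSpace ℝ (Fin d) → ℝ≥0∞} (hF : Measurable F) :
    Measurable (plateMax (k := k) δ F) := by
  refine (Gr.lowerSemicontinuous_of_rotate h ?_).measurable
  refine lowerSemicontinuous_iSup fun a => ?_
  have hv := fun θ => volume_plate_rotate h θ δ a
  simp only [hv]
  refine lowerSemicontinuous_const_mul ?_ (ENNReal.inv_ne_top.mpr (volume_plate_ne_zero _ hδ _))
  simp only [← lintegral_indicator (isOpen_plate _ _ _).measurableSet]
  refine lowerSemicontinuous_lintegral
    (fun θ => hF.indicator (isOpen_plate _ _ _).measurableSet) fun x => ?_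
  have hU : IsOpen {θ : Matrix.orthogonalGroup (Fin d) ℝ |
      x ∈ plate (Gr.rotate θ (Gr.coord h)) δ a} := by
    have hU' : {θ : Matrix.orthogonalGroup (Fin d) ℝ |
        x ∈ plate (Gr.rotate θ (Gr.coord h)) δ a} =
        (fun θ => orthEquiv d θ⁻¹ (x - a)) ⁻¹' plate (Gr.rotate 1 (Gr.coord (d := d) h)) δ 0 :=
      Set.ext fun θ => mem_plate_rotate_iff h θ
    rw [hU']
    exact (isOpen_plate _ _ _).preimage (continuous_inv.orthEquiv continuous_const)
  exact lowerSemicontinuous_indicator_of_isOpen (f := fun _ => F x) lowerSemicontinuous_const hU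

/-! ### Comparison of averages at different radii. -/

theorem volume_ball_two_mul {d : ℕ} (x y : EuclideanSpace ℝ (Fin d)) (r : ℝ) :
    volume (Metric.ball x (2 * r)) = 2 ^ d * volume (Metric.ball y r) := by
  rw [Measure.addHaar_ball_mul_of_pos volume x two_pos r, finrank_euclideanSpace_fin,
    ENNReal.ofReal_pow two_pos.le, ENNReal.ofReal_ofNat, Measure.addHaar_ball_center volume y]

theorem ENNReal.inv_le_of_one_le_mul {b c : ℝ≥0∞} (h : 1 ≤ b * c) : b⁻¹ ≤ c :=
  calc b⁻¹ = b⁻¹ * 1 := (mul_one _).symm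
    _ ≤ b⁻¹ * (b * c) := by gcongr
    _ = (b⁻¹ * b) * c := (mul_assoc _ _ _).symm
    _ ≤ 1 * c := by gcongr; exact ENNReal.inv_mul_le_one b
    _ = c := one_mul c

theorem lintegral_ballAvg_le {d : ℕ} {r s : ℝ} (hr : 0 < r) (hsr : s ≤ r)
    (hrs : r ≤ 2 * s) (F : EuclideanSpace ℝ (Fin d) → ℝ≥0∞) :
    ∫⁻ z, F z ∂ballAvg d s ≤ 2 ^ d * ∫⁻ z, F z ∂ballAvg d r := by
  have hs : 0 < s := by linarith
  rw [lintegral_ballAvg, lintegral_ballAvg, ← mul_assoc]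
  refine mul_le_mul' (ENNReal.inv_le_of_one_le_mul ?_)
    (lintegral_mono_set (Metric.ball_subset_ball hsr))
  rw [← mul_assoc, mul_comm (volume _), ← volume_ball_two_mul 0 0 s]
  calc 1 = volume (Metric.ball (0 : EuclideanSpace ℝ (Fin d)) r) *
        (volume (Metric.ball (0 : EuclideanSpace ℝ (Fin d)) r))⁻¹ :=
        (ENNReal.mul_inv_cancel (volume_ball_ne_zero _ hr) (volume_ball_ne_top _ _)).symm
    _ ≤ _ := by gcongr

theorem avgE_mono_left {d : ℕ} {r s : ℝ} (hr : 0 < r) (hsr : s ≤ r)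
    (hrs : r ≤ 2 * s) (F : EuclideanSpace ℝ (Fin d) → ℝ≥0∞) (x : EuclideanSpace ℝ (Fin d)) :
    avgE s F x ≤ 2 ^ d * avgE r F x := lintegral_ballAvg_le hr hsr hrs _

theorem avgE_mono {d : ℕ} {r : ℝ} {F G : EuclideanSpace ℝ (Fin d) → ℝ≥0∞} (h : ∀ x, F x ≤ G x)
    (x : EuclideanSpace ℝ (Fin d)) : avgE r F x ≤ avgE r G x := lintegral_mono fun _ => h _

/-- The average over a ball is dominated by the iterated average over balls of twice the
radius. -/
theorem avgE_half_le_avgE_avgE {d : ℕ} {r : ℝ} (hr : 0 < r)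
    (F : EuclideanSpace ℝ (Fin d) → ℝ≥0∞) (x : EuclideanSpace ℝ (Fin d)) :
    avgE (r / 2) F x ≤ 2 ^ d * 2 ^ d * avgE r (avgE r F) x := by
  have := isProbabilityMeasure_ballAvg d (half_pos hr)
  -- The ball of radius r / 2 around x lies in the ball of radius r around any x + w with ‖w‖ < r /
  -- 2; averaging over such w produces the outer average.
  have h1 : ∀ w : EuclideanSpace ℝ (Fin d), ‖w‖ < r / 2 →
      avgE (r / 2) F x ≤ 2 ^ d * avgE r F (x + w) := by
    intro w hw
    rw [avgE_eq, avgE_eq, ← mul_assoc]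
    have hb : volume (Metric.ball (0 : EuclideanSpace ℝ (Fin d)) r) =
        2 ^ d * volume (Metric.ball (0 : EuclideanSpace ℝ (Fin d)) (r / 2)) := by
      rw [← volume_ball_two_mul 0 0, mul_div_cancel₀ r two_ne_zero]
    rw [hb, ENNReal.mul_inv (Or.inl (by simp)) (Or.inl (by simp)), ← mul_assoc,
      ENNReal.mul_inv_cancel (by simp) (by simp), one_mul]
    gcongr
    intro y hy
    rw [Metric.mem_ball, dist_eq_norm] at hy ⊢
    calc ‖y - (x + w)‖ = ‖(y - x) - w‖ := by rw [sub_sub]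
      _ ≤ ‖y - x‖ + ‖w‖ := norm_sub_le _ _
      _ < r := by linarith
  calc avgE (r / 2) F x = ∫⁻ _, avgE (r / 2) F x ∂ballAvg d (r / 2) := by simp
    _ ≤ ∫⁻ w, 2 ^ d * avgE r F (x + w) ∂ballAvg d (r / 2) := by
      refine lintegral_mono_ae ?_
      filter_upwards [ae_ballAvg d (r / 2)] with w hw using h1 w hw
    _ = 2 ^ d * avgE (r / 2) (avgE r F) x := lintegral_const_mul' _ _ (by simp)
    _ ≤ 2 ^ d * (2 ^ d * avgE r (avgE r F) x) := by
      gcongr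
      exact avgE_mono_left hr (by linarith) (by linarith) _ _
    _ = _ := by rw [mul_assoc]

/-- Over each point of the n-dimensional ball the fibre of the projection has length at most 2r. The
normalizations scale like r^(n+1) and r^n, so the constant 2 V n / V (n + 1) is independent of r. -/
theorem exists_lintegral_tailE_le (n : ℕ) : ∃ C : ℝ≥0, ∀ r : ℝ, 0 < r →
    ∀ F : EuclideanSpace ℝ (Fin n) → ℝ≥0∞, Measurable F →
      ∫⁻ w, F (tailE w) ∂ballAvg (n + 1) r ≤ C * ∫⁻ v, F v ∂ballAvg n r := by
  set V := fun d : ℕ => volume (Metric.ball (0 : EuclideanSpace ℝ (Fin d)) 1) with hV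
  have hV0 : ∀ d, V d ≠ 0 := fun d => volume_ball_ne_zero _ one_pos
  have hVt : ∀ d, V d ≠ ∞ := fun d => volume_ball_ne_top _ _
  have hball : ∀ (d : ℕ) (r : ℝ), 0 < r →
      volume (Metric.ball (0 : EuclideanSpace ℝ (Fin d)) r) = ENNReal.ofReal r ^ d * V d := by
    intro d r hr
    rw [Measure.addHaar_ball_of_pos volume _ hr, finrank_euclideanSpace_fin,
      ENNReal.ofReal_pow hr.le]
  refine ⟨((V (n + 1))⁻¹ * 2 * V n).toNNReal, fun r hr F hF => ?_⟩
  rw [ENNReal.coe_toNNReal (ENNReal.mul_ne_top (ENNReal.mul_ne_top (ENNReal.inv_ne_top.mpr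
    (hV0 _)) (by simp)) (hVt _)), lintegral_ballAvg, lintegral_ballAvg]
  have h1 : ∫⁻ w in Metric.ball (0 : EuclideanSpace ℝ (Fin (n + 1))) r, F (tailE w) ≤
      ENNReal.ofReal (2 * r) * ∫⁻ v in Metric.ball (0 : EuclideanSpace ℝ (Fin n)) r, F v := by
    have hm : Measurable (fun w : EuclideanSpace ℝ (Fin (n + 1)) => F (tailE w)) :=
      hF.comp continuous_tailE.measurable
    rw [← lintegral_indicator Metric.isOpen_ball.measurableSet,
      lintegral_consE (hm.indicator Metric.isOpen_ball.measurableSet),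
      ← lintegral_indicator Metric.isOpen_ball.measurableSet, ← lintegral_const_mul'
        _ _ ENNReal.ofReal_ne_top]
    refine lintegral_mono fun y => ?_
    have h2 : ∀ t, (Metric.ball (0 : EuclideanSpace ℝ (Fin (n + 1))) r).indicator
        (fun w => F (tailE w)) (consE t y) ≤
        (Ioo (-r) r).indicator (fun _ => (Metric.ball 0 r).indicator F y) t := by
      intro t
      by_cases ht : consE t y ∈ Metric.ball (0 : EuclideanSpace ℝ (Fin (n + 1))) r
      · have h3 : ‖consE t y‖ < r := by simpa using ht
        have hy : y ∈ Metric.ball (0 : EuclideanSpace ℝ (Fin n)) r := by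
          simpa using (norm_le_norm_consE t y).trans_lt h3
        have ht' : t ∈ Ioo (-r) r := abs_lt.mp ((abs_le_norm_consE t y).trans_lt h3)
        rw [indicator_of_mem ht, indicator_of_mem ht', indicator_of_mem hy]
        exact le_rfl
      · rw [indicator_of_notMem ht]
        exact zero_le
    refine (lintegral_mono h2).trans ?_
    rw [lintegral_indicator measurableSet_Ioo, lintegral_const, Measure.restrict_apply_univ,
      Real.volume_Ioo, mul_comm]
    exact le_of_eq (by congr 2; ring)
  calc _ ≤ (volume (Metric.ball (0 : EuclideanSpace ℝ (Fin (n + 1))) r))⁻¹ *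
        (ENNReal.ofReal (2 * r) * ∫⁻ v in Metric.ball (0 : EuclideanSpace ℝ (Fin n)) r, F v) := by
        gcongr
    _ = _ := by
      rw [hball _ r hr, hball _ r hr, ENNReal.mul_inv (Or.inl (by simp [hr]))
        (Or.inl (by simp)), ENNReal.mul_inv (Or.inl (by simp [hr])) (Or.inl (by simp)),
        ENNReal.ofReal_mul two_pos.le, ENNReal.ofReal_ofNat]
      have e1 : V n * (V n)⁻¹ = 1 := ENNReal.mul_inv_cancel (hV0 n) (hVt n)
      have e2 : (ENNReal.ofReal r ^ (n + 1))⁻¹ * ENNReal.ofReal r = (ENNReal.ofReal r ^ n)⁻¹ := by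
        rw [pow_succ, ENNReal.mul_inv (Or.inl (by simp [hr])) (Or.inl (by simp)), mul_assoc,
          ENNReal.inv_mul_cancel (by simp [hr]) (by simp), mul_one]
      calc _ = ((ENNReal.ofReal r ^ (n + 1))⁻¹ * ENNReal.ofReal r) * (V (n + 1))⁻¹ * 2 *
            ∫⁻ v in Metric.ball (0 : EuclideanSpace ℝ (Fin n)) r, F v := by ring
        _ = (V n * (V n)⁻¹) * (ENNReal.ofReal r ^ n)⁻¹ * (V (n + 1))⁻¹ * 2 *
            ∫⁻ v in Metric.ball (0 : EuclideanSpace ℝ (Fin n)) r, F v := by rw [e1, e2, one_mul]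
        _ = _ := by ring

/-! ### Integration near an affine plane -/

/-- Tonelli on the set of pairs (x, z) with x within ρ of a + ι z. The volume of the fibre over x is
comparable to ρ^k for x near the plane, so this identity converts integrals over plates into plane
integrals of ball integrals, and back. -/
theorem lintegral_mul_volume_near {k d : ℕ}
    (ι : EuclideanSpace ℝ (Fin k) →ₗᵢ[ℝ] EuclideanSpace ℝ (Fin d)) (a : EuclideanSpace ℝ (Fin d))
    (ρ : ℝ) {S : Set (EuclideanSpace ℝ (Fin k))} (hS : MeasurableSet S)
    {H : EuclideanSpace ℝ (Fin d) → ℝ≥0∞} (hH : Measurable H) :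
    ∫⁻ x, H x * volume {z | z ∈ S ∧ dist x (a + ι z) < ρ} =
      ∫⁻ z in S, ∫⁻ x in Metric.ball (a + ι z) ρ, H x := by
  have hι : Continuous ι := ι.continuous
  have hD : MeasurableSet {q : EuclideanSpace ℝ (Fin d) × EuclideanSpace ℝ (Fin k) |
      dist q.1 (a + ι q.2) < ρ} :=
    (isOpen_lt (by fun_prop) continuous_const).measurableSet
  have hDS : MeasurableSet {q : EuclideanSpace ℝ (Fin d) × EuclideanSpace ℝ (Fin k) |
      q.2 ∈ S ∧ dist q.1 (a + ι q.2) < ρ} := (measurable_snd hS).inter hD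
  calc ∫⁻ x, H x * volume {z | z ∈ S ∧ dist x (a + ι z) < ρ}
      = ∫⁻ x, ∫⁻ z, {q : EuclideanSpace ℝ (Fin d) × EuclideanSpace ℝ (Fin k) |
          q.2 ∈ S ∧ dist q.1 (a + ι q.2) < ρ}.indicator (fun q => H q.1) (x, z) := by
        congr 1 with x
        have hm : MeasurableSet {z | z ∈ S ∧ dist x (a + ι z) < ρ} :=
          (measurable_prodMk_left (x := x)) hDS
        rw [← lintegral_indicator_const hm]
        rfl
    _ = ∫⁻ z, ∫⁻ x, {q : EuclideanSpace ℝ (Fin d) × EuclideanSpace ℝ (Fin k) |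
          q.2 ∈ S ∧ dist q.1 (a + ι q.2) < ρ}.indicator (fun q => H q.1) (x, z) := by
        refine lintegral_lintegral_swap ?_
        exact ((hH.comp measurable_fst).indicator hDS).aemeasurable
    _ = _ := by
        rw [← lintegral_indicator hS]
        congr 1 with z
        by_cases hz : z ∈ S
        · rw [indicator_of_mem hz, ← lintegral_indicator Metric.isOpen_ball.measurableSet]
          congr 1 with x
          simp [indicator, hz]
        · rw [indicator_of_notMem hz]
          simp [indicator, hz]

/-- Two points of the fibre are less than 2ρ apart, so the fibre lies in a ball of radius 2ρ around
any one of its points. -/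
theorem volume_near_le {k d : ℕ}
    (ι : EuclideanSpace ℝ (Fin k) →ₗᵢ[ℝ] EuclideanSpace ℝ (Fin d)) (a x : EuclideanSpace ℝ (Fin d))
    (ρ : ℝ) (S : Set (EuclideanSpace ℝ (Fin k))) :
    volume {z | z ∈ S ∧ dist x (a + ι z) < ρ} ≤
      2 ^ k * volume (Metric.ball (0 : EuclideanSpace ℝ (Fin k)) ρ) := by
  rcases Set.eq_empty_or_nonempty {z | z ∈ S ∧ dist x (a + ι z) < ρ} with h | ⟨z₁, hz₁⟩
  · rw [h]; simp
  · rw [← volume_ball_two_mul z₁ 0 ρ]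
    refine measure_mono fun z hz => ?_
    rw [Metric.mem_ball, ← ι.dist_map, ← dist_add_left a]
    calc dist (a + ι z) (a + ι z₁) ≤ dist x (a + ι z) + dist x (a + ι z₁) :=
          dist_triangle_left _ _ _
      _ < 2 * ρ := by linarith [hz.2, hz₁.2]

/-- If z₁ witnesses that x lies in the plate, all z within δ of z₁ lie in the fibre of radius 2δ, by
the triangle inequality. -/
theorem volume_ball_le_volume_near {k d : ℕ} (h : k ≤ d) (θ : Matrix.orthogonalGroup (Fin d) ℝ)
    {δ : ℝ} {a x : EuclideanSpace ℝ (Fin d)} (hx : x ∈ plate (Gr.rotate θ (Gr.coord h)) δ a) :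
    volume (Metric.ball (0 : EuclideanSpace ℝ (Fin k)) δ) ≤
      volume {z | z ∈ Metric.ball (0 : EuclideanSpace ℝ (Fin k)) (1 / 2 + δ) ∧
        dist x (a + planeE h θ z) < 2 * δ} := by
  obtain ⟨z₁, h1, h2⟩ := (mem_plate_rotate h θ).mp hx
  rw [Measure.addHaar_ball_center volume z₁ δ |>.symm]
  refine measure_mono fun z hz => ⟨?_, ?_⟩
  · rw [Metric.mem_ball] at hz
    rw [mem_ball_zero_iff]
    calc ‖z‖ ≤ ‖z₁‖ + ‖z - z₁‖ := norm_le_norm_add_norm_sub' z z₁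
      _ < 1 / 2 + δ := by rw [← dist_eq_norm]; linarith
  · rw [Metric.mem_ball, ← (planeE h θ).dist_map, ← dist_add_left a] at hz
    calc dist x (a + planeE h θ z) ≤ dist x (a + planeE h θ z₁) +
          dist (a + planeE h θ z) (a + planeE h θ z₁) := dist_triangle_right _ _ _
      _ < 2 * δ := by linarith

/-- The Tonelli identity with H = 1, in which each point of the plate has a fibre at least as large
as a δ-ball. The radius 2 absorbs 1/2 + δ. -/
theorem volume_plate_mul_le {k d : ℕ} (h : k ≤ d) (θ : Matrix.orthogonalGroup (Fin d) ℝ)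
    {δ : ℝ} (hδ : δ ≤ 1) (a : EuclideanSpace ℝ (Fin d)) :
    volume (plate (Gr.rotate θ (Gr.coord h)) δ a) *
        volume (Metric.ball (0 : EuclideanSpace ℝ (Fin k)) δ) ≤
      volume (Metric.ball (0 : EuclideanSpace ℝ (Fin k)) 2) *
        (2 ^ d * volume (Metric.ball (0 : EuclideanSpace ℝ (Fin d)) δ)) := by
  have hb : MeasurableSet (Metric.ball (0 : EuclideanSpace ℝ (Fin k)) (1 / 2 + δ)) :=
    Metric.isOpen_ball.measurableSet
  have hp := (isOpen_plate (Gr.rotate θ (Gr.coord h)) δ a).measurableSet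
  have key := lintegral_mul_volume_near (planeE h θ) a (2 * δ) hb
    (H := fun _ => 1) measurable_const
  simp only [one_mul, lintegral_const, Measure.restrict_apply_univ,
    volume_ball_two_mul _ (0 : EuclideanSpace ℝ (Fin d)) δ] at key
  calc _ = ∫⁻ x in plate (Gr.rotate θ (Gr.coord h)) δ a,
        volume (Metric.ball (0 : EuclideanSpace ℝ (Fin k)) δ) := by
        rw [setLIntegral_const, mul_comm]
    _ ≤ ∫⁻ x in plate (Gr.rotate θ (Gr.coord h)) δ a,
        volume {z | z ∈ Metric.ball (0 : EuclideanSpace ℝ (Fin k)) (1 / 2 + δ) ∧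
        dist x (a + planeE h θ z) < 2 * δ} :=
        setLIntegral_mono' hp fun x hx => volume_ball_le_volume_near h θ hx
    _ ≤ _ := setLIntegral_le_lintegral _ _
    _ = _ := key
    _ ≤ _ := by
      rw [mul_comm]
      gcongr
      linarith

/-- The Tonelli identity with H the indicator of the plate: each δ-ball centred on the half-ball of
the plane lies in the plate, while fibres are no larger than a ball of radius 2δ. -/
theorem le_volume_plate_mul {k d : ℕ} (h : k ≤ d) (θ : Matrix.orthogonalGroup (Fin d) ℝ)
    (δ : ℝ) (a : EuclideanSpace ℝ (Fin d)) :
    volume (Metric.ball (0 : EuclideanSpace ℝ (Fin k)) (1 / 2)) *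
        volume (Metric.ball (0 : EuclideanSpace ℝ (Fin d)) δ) ≤
      volume (plate (Gr.rotate θ (Gr.coord h)) δ a) *
        (2 ^ k * volume (Metric.ball (0 : EuclideanSpace ℝ (Fin k)) δ)) := by
  have hb : MeasurableSet (Metric.ball (0 : EuclideanSpace ℝ (Fin k)) (1 / 2)) :=
    Metric.isOpen_ball.measurableSet
  have hp := (isOpen_plate (Gr.rotate θ (Gr.coord h)) δ a).measurableSet
  have key := lintegral_mul_volume_near (planeE h θ) a δ hb
    (H := (plate (Gr.rotate θ (Gr.coord h)) δ a).indicator 1) (measurable_one.indicator hp)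
  have h1 : ∫⁻ z in Metric.ball (0 : EuclideanSpace ℝ (Fin k)) (1 / 2),
      ∫⁻ x in Metric.ball (a + planeE h θ z) δ,
        (plate (Gr.rotate θ (Gr.coord h)) δ a).indicator (1 : EuclideanSpace ℝ (Fin d) → ℝ≥0∞) x =
      volume (Metric.ball (0 : EuclideanSpace ℝ (Fin k)) (1 / 2)) *
        volume (Metric.ball (0 : EuclideanSpace ℝ (Fin d)) δ) := by
    rw [mul_comm, ← setLIntegral_const]
    refine setLIntegral_congr_fun hb fun z hz => ?_
    rw [lintegral_indicator_one hp, Measure.restrict_apply hp,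
      ← Measure.addHaar_ball_center volume (a + planeE h θ z) δ]
    congr 1
    refine inter_eq_right.mpr fun x hx => ?_
    exact (mem_plate_rotate h θ).mpr ⟨z, by simpa using hz, hx⟩
  rw [← h1, ← key]
  calc _ ≤ ∫⁻ x, (plate (Gr.rotate θ (Gr.coord h)) δ a).indicator (1 : EuclideanSpace ℝ (Fin d) → ℝ≥0∞) x *
        (2 ^ k * volume (Metric.ball (0 : EuclideanSpace ℝ (Fin k)) δ)) := by
        refine lintegral_mono fun x => ?_
        gcongr
        exact volume_near_le _ _ _ _ _
    _ = _ := by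
      rw [lintegral_mul_const _ (measurable_one.indicator hp), lintegral_indicator_one hp]

/-- Averages over plates are dominated by integrals over a plane of averages over balls. -/
theorem plate_average_le {k d : ℕ} (h : k ≤ d) (θ : Matrix.orthogonalGroup (Fin d) ℝ)
    {δ : ℝ} (hδ : 0 < δ) (a : EuclideanSpace ℝ (Fin d))
    {F : EuclideanSpace ℝ (Fin d) → ℝ≥0∞} (hF : Measurable F) :
    (volume (plate (Gr.rotate θ (Gr.coord h)) δ a))⁻¹ *
        ∫⁻ y in plate (Gr.rotate θ (Gr.coord h)) δ a, F y ≤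
      (volume (Metric.ball (0 : EuclideanSpace ℝ (Fin k)) (1 / 2)))⁻¹ * (2 ^ k * 2 ^ d) *
        ∫⁻ z, avgE (2 * δ) F (a + planeE h θ z) := by
  set P := plate (Gr.rotate θ (Gr.coord h)) δ a with hP
  have hp : MeasurableSet P := (isOpen_plate _ δ a).measurableSet
  set Bk := volume (Metric.ball (0 : EuclideanSpace ℝ (Fin k)) δ) with hBk
  set Bd := volume (Metric.ball (0 : EuclideanSpace ℝ (Fin d)) δ) with hBd
  set Bh := volume (Metric.ball (0 : EuclideanSpace ℝ (Fin k)) (1 / 2)) with hBh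
  have hBk0 : Bk ≠ 0 := volume_ball_ne_zero _ hδ
  have hBkt : Bk ≠ ∞ := volume_ball_ne_top _ _
  have hBd0 : Bd ≠ 0 := volume_ball_ne_zero _ hδ
  have hBdt : Bd ≠ ∞ := volume_ball_ne_top _ _
  have hBh0 : Bh ≠ 0 := volume_ball_ne_zero _ (by norm_num)
  have hBht : Bh ≠ ∞ := volume_ball_ne_top _ _
  set I := ∫⁻ z, avgE (2 * δ) F (a + planeE h θ z) with hI
  have key := lintegral_mul_volume_near (planeE h θ) a (2 * δ) MeasurableSet.univ hF
  -- The factor Bk is replaced by the larger fibre volume on the plate; the Tonelli identity over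
  -- the whole plane then yields ball integrals of radius 2δ, with volume 2^d Bd.
  have h1 : Bk * ∫⁻ y in P, F y ≤ 2 ^ d * Bd * I := by
    calc Bk * ∫⁻ y in P, F y = ∫⁻ y in P, F y * Bk := by
          rw [lintegral_mul_const _ hF, mul_comm]
      _ ≤ ∫⁻ y in P, F y * volume {z | z ∈ (univ : Set (EuclideanSpace ℝ (Fin k))) ∧
            dist y (a + planeE h θ z) < 2 * δ} := by
          refine setLIntegral_mono' hp fun x hx => ?_
          gcongr
          refine (volume_ball_le_volume_near h θ hx).trans (measure_mono fun z hz => ⟨trivial, hz.2⟩)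
      _ ≤ _ := setLIntegral_le_lintegral _ _
      _ = _ := key
      _ = _ := by
        rw [Measure.restrict_univ, hI, ← lintegral_const_mul' _ _ (ENNReal.mul_ne_top (by simp) hBdt)]
        congr 1 with z
        rw [avgE_eq, hBd, ← volume_ball_two_mul 0 0 δ, ← mul_assoc,
          ENNReal.mul_inv_cancel (volume_ball_ne_zero _ (by linarith)) (volume_ball_ne_top _ _),
          one_mul]
  have h2 : (volume P)⁻¹ ≤ Bh⁻¹ * Bd⁻¹ * (2 ^ k * Bk) := by
    have h3 : Bh * Bd ≤ volume P * (2 ^ k * Bk) := le_volume_plate_mul h θ δ a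
    rw [← ENNReal.mul_inv (Or.inl hBh0) (Or.inl hBht)]
    refine ENNReal.inv_le_of_one_le_mul ?_
    calc 1 = (Bh * Bd)⁻¹ * (Bh * Bd) := (ENNReal.inv_mul_cancel
          (mul_ne_zero hBh0 hBd0) (ENNReal.mul_ne_top hBht hBdt)).symm
      _ ≤ (Bh * Bd)⁻¹ * (volume P * (2 ^ k * Bk)) := by gcongr
      _ = _ := by ring
  calc (volume P)⁻¹ * ∫⁻ y in P, F y ≤ Bh⁻¹ * Bd⁻¹ * (2 ^ k * Bk) * ∫⁻ y in P, F y := by gcongr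
    _ = Bh⁻¹ * Bd⁻¹ * 2 ^ k * (Bk * ∫⁻ y in P, F y) := by ring
    _ ≤ Bh⁻¹ * Bd⁻¹ * 2 ^ k * (2 ^ d * Bd * I) := by gcongr
    _ = (Bd⁻¹ * Bd) * (Bh⁻¹ * (2 ^ k * 2 ^ d) * I) := by ring
    _ = _ := by rw [ENNReal.inv_mul_cancel hBd0 hBdt, one_mul]

/-- Integrals over a small piece of an affine plane of averages over balls are dominated by
averages over plates. -/
theorem lintegral_ball_plane_le {m n : ℕ} (h : m ≤ n) {r : ℝ} (hr : 0 < r) (hr1 : r ≤ 1)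
    (σ : Matrix.orthogonalGroup (Fin n) ℝ) (a : EuclideanSpace ℝ (Fin n))
    (z₀ : EuclideanSpace ℝ (Fin m)) {G : EuclideanSpace ℝ (Fin n) → ℝ≥0∞} (hG : Measurable G) :
    ∫⁻ z in Metric.ball z₀ (1 / 2), avgE r G (a + planeE h σ z) ≤
      2 ^ m * 2 ^ n * volume (Metric.ball (0 : EuclideanSpace ℝ (Fin m)) 2) *
        plateMax r G (Gr.rotate σ (Gr.coord h)) := by
  set P := plate (Gr.rotate σ (Gr.coord h)) r (a + planeE h σ z₀) with hP
  have hp : MeasurableSet P := (isOpen_plate _ r _).measurableSet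
  set Bm := volume (Metric.ball (0 : EuclideanSpace ℝ (Fin m)) r) with hBm
  set Bn := volume (Metric.ball (0 : EuclideanSpace ℝ (Fin n)) r) with hBn
  set B2 := volume (Metric.ball (0 : EuclideanSpace ℝ (Fin m)) 2) with hB2
  have hBn0 : Bn ≠ 0 := volume_ball_ne_zero _ hr
  have hBnt : Bn ≠ ∞ := volume_ball_ne_top _ _
  have hBmt : Bm ≠ ∞ := volume_ball_ne_top _ _
  have hP0 : volume P ≠ 0 := volume_plate_ne_zero _ hr _
  have hvP : volume P * Bm ≤ B2 * (2 ^ n * Bn) := volume_plate_mul_le h σ hr1 _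
  have hPt : volume P ≠ ∞ := by
    intro hz
    rw [hz, ENNReal.top_mul (volume_ball_ne_zero _ hr), top_le_iff] at hvP
    exact ENNReal.mul_ne_top (volume_ball_ne_top _ _) (ENNReal.mul_ne_top (by simp) hBnt) hvP
  have key := lintegral_mul_volume_near (planeE h σ) a r
    (S := Metric.ball z₀ (1 / 2)) Metric.isOpen_ball.measurableSet hG
  -- A point with nonempty fibre over the half-ball around z₀ lies in the plate P centred at the
  -- image of z₀.
  have h1 : ∀ x, G x * volume {z | z ∈ Metric.ball z₀ (1 / 2) ∧ dist x (a + planeE h σ z) < r} ≤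
      P.indicator (fun x => G x * (2 ^ m * Bm)) x := by
    intro x
    by_cases hx : x ∈ P
    · rw [indicator_of_mem hx]
      gcongr
      exact volume_near_le _ _ _ _ _
    · have : {z | z ∈ Metric.ball z₀ (1 / 2) ∧ dist x (a + planeE h σ z) < r} = ∅ := by
        refine Set.eq_empty_iff_forall_notMem.mpr fun z hz => hx ?_
        refine (mem_plate_rotate h σ).mpr ⟨z - z₀, by simpa [dist_eq_norm] using hz.1, ?_⟩
        have e : a + planeE h σ z₀ + planeE h σ (z - z₀) = a + planeE h σ z := by
          rw [map_sub]; abel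
        rw [e]; exact hz.2
      rw [this, measure_empty, mul_zero]
      exact zero_le
  calc ∫⁻ z in Metric.ball z₀ (1 / 2), avgE r G (a + planeE h σ z)
      = Bn⁻¹ * ∫⁻ z in Metric.ball z₀ (1 / 2), ∫⁻ x in Metric.ball (a + planeE h σ z) r, G x := by
        simp only [avgE_eq]
        rw [lintegral_const_mul' _ _ (ENNReal.inv_ne_top.mpr hBn0)]
    _ = Bn⁻¹ * ∫⁻ x, G x *
          volume {z | z ∈ Metric.ball z₀ (1 / 2) ∧ dist x (a + planeE h σ z) < r} := by rw [key]
    _ ≤ Bn⁻¹ * ∫⁻ x, P.indicator (fun x => G x * (2 ^ m * Bm)) x := by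
        gcongr with x
        exact h1 x
    _ = Bn⁻¹ * ((volume P * (volume P)⁻¹) * ((∫⁻ x in P, G x) * (2 ^ m * Bm))) := by
        rw [lintegral_indicator hp, lintegral_mul_const _ hG, ENNReal.mul_inv_cancel hP0 hPt,
          one_mul]
    _ = (volume P * Bm) * (Bn⁻¹ * 2 ^ m * ((volume P)⁻¹ * ∫⁻ x in P, G x)) := by ring
    _ ≤ B2 * (2 ^ n * Bn) * (Bn⁻¹ * 2 ^ m * plateMax r G (Gr.rotate σ (Gr.coord h))) := by
        gcongr
        exact le_iSup (fun b => (volume (plate (Gr.rotate σ (Gr.coord h)) r b))⁻¹ *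
          ∫⁻ x in plate (Gr.rotate σ (Gr.coord h)) r b, G x) _
    _ = (Bn⁻¹ * Bn) * (2 ^ m * 2 ^ n * B2 * plateMax r G (Gr.rotate σ (Gr.coord h))) := by ring
    _ = _ := by rw [ENNReal.inv_mul_cancel hBn0 hBnt, one_mul]

/-- Integrals over affine planes of averages over balls of a function with bounded support are
dominated by averages over plates. -/
theorem exists_lintegral_plane_le {m n : ℕ} (h : m ≤ n) (R : ℝ) : ∃ C : ℝ≥0, ∀ r : ℝ, 0 < r →
    r ≤ 1 → ∀ G : EuclideanSpace ℝ (Fin n) → ℝ≥0∞, Measurable G → (∀ y, R < ‖y‖ → G y = 0) →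
    ∀ (σ : Matrix.orthogonalGroup (Fin n) ℝ) (a : EuclideanSpace ℝ (Fin n)),
      ∫⁻ z, avgE r G (a + planeE h σ z) ≤ C * plateMax r G (Gr.rotate σ (Gr.coord h)) := by
  -- Averages at radius r ≤ 1 vanish outside radius R + 1. Balls of radius 1/4 are used because the
  -- trace of the plane on each of them lies within 1/2 of any of its points, so a single plate
  -- covers it.
  obtain ⟨T, -, hTf, hT⟩ := finite_cover_balls_of_compact
    (isCompact_closedBall (0 : EuclideanSpace ℝ (Fin n)) (R + 1)) (e := 1 / 4) (by norm_num)
  set K : ℝ≥0∞ := 2 ^ m * 2 ^ n * volume (Metric.ball (0 : EuclideanSpace ℝ (Fin m)) 2) with hK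
  have hKt : K ≠ ∞ := ENNReal.mul_ne_top (by finiteness) (volume_ball_ne_top _ _)
  refine ⟨hTf.toFinset.card * K.toNNReal, fun r hr hr1 G hG hsupp σ a => ?_⟩
  have hι : Continuous (planeE h σ) := (planeE h σ).continuous
  have hmeas : Measurable fun z => avgE r G (a + planeE h σ z) :=
    (lowerSemicontinuous_avgE hr hG).measurable.comp (by fun_prop)
  have hS : ∀ c, MeasurableSet {z | a + planeE h σ z ∈ Metric.ball c (1 / 4)} := fun c =>
    (Metric.isOpen_ball.preimage (by fun_prop : Continuous fun z => a + planeE h σ z)).measurableSet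
  have h1 : ∀ z, avgE r G (a + planeE h σ z) ≤ ∑ c ∈ hTf.toFinset,
      {z | a + planeE h σ z ∈ Metric.ball c (1 / 4)}.indicator
        (fun z => avgE r G (a + planeE h σ z)) z := by
    intro z
    by_cases hz : a + planeE h σ z ∈ Metric.closedBall (0 : EuclideanSpace ℝ (Fin n)) (R + 1)
    · obtain ⟨c, hc, hzc⟩ := mem_iUnion₂.mp (hT hz)
      refine le_trans ?_ (Finset.single_le_sum (fun _ _ => zero_le)
        (hTf.mem_toFinset.mpr hc))
      rw [indicator_of_mem (by exact hzc)]
    · have : avgE r G (a + planeE h σ z) = 0 := by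
        rw [avgE, lintegral_eq_zero_of_ae_eq_zero]
        filter_upwards [ae_ballAvg n r] with v hv
        refine hsupp _ ?_
        have h3 : R + 1 < ‖a + planeE h σ z‖ := by simpa using hz
        have h4 := norm_le_norm_add_norm_sub' (a + planeE h σ z) (a + planeE h σ z + v)
        have h5 : ‖a + planeE h σ z - (a + planeE h σ z + v)‖ = ‖v‖ := by
          rw [← norm_neg]; congr 1; abel
        linarith
      rw [this]; exact zero_le
  refine (lintegral_mono h1).trans ?_
  rw [lintegral_finsetSum _ fun c _ => hmeas.indicator (hS c)]
  have h2 : ∀ c ∈ hTf.toFinset, ∫⁻ z, {z | a + planeE h σ z ∈ Metric.ball c (1 / 4)}.indicator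
        (fun z => avgE r G (a + planeE h σ z)) z ≤
        K * plateMax r G (Gr.rotate σ (Gr.coord h)) := by
    intro c _
    rw [lintegral_indicator (hS c)]
    rcases Set.eq_empty_or_nonempty {z | a + planeE h σ z ∈ Metric.ball c (1 / 4)} with he | ⟨z₀, hz₀⟩
    · rw [he]; simp
    · refine le_trans (lintegral_mono_set fun z hz => ?_) (lintegral_ball_plane_le h hr hr1 σ a z₀ hG)
      rw [Metric.mem_ball, ← (planeE h σ).dist_map, ← dist_add_left a]
      calc dist (a + planeE h σ z) (a + planeE h σ z₀) ≤ dist (a + planeE h σ z) c +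
            dist (a + planeE h σ z₀) c := dist_triangle_right _ _ _
        _ < 1 / 2 := by
          have h3 : dist (a + planeE h σ z) c < 1 / 4 := hz
          have h4 : dist (a + planeE h σ z₀) c < 1 / 4 := hz₀
          linarith
  refine (Finset.sum_le_sum h2).trans ?_
  rw [Finset.sum_const, nsmul_eq_mul, ENNReal.coe_mul, ENNReal.coe_toNNReal hKt, ENNReal.coe_natCast]
  exact (mul_assoc _ _ _).ge

/-! ### Polar coordinates and the measure swept out by a random line. -/

theorem lintegral_fun_norm (n : ℕ) {H : ℝ → ℝ≥0∞} (hH : Measurable H) :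
    ∫⁻ z : EuclideanSpace ℝ (Fin (n + 1)), H ‖z‖ =
      (volume : Measure (EuclideanSpace ℝ (Fin (n + 1)))).toSphere univ *
        ∫⁻ r in Ioi (0 : ℝ), ENNReal.ofReal (r ^ n) * H r := by
  have hfin : Module.finrank ℝ (EuclideanSpace ℝ (Fin (n + 1))) - 1 = n := by simp
  have h1 := (volume : Measure (EuclideanSpace ℝ (Fin (n + 1)))).measurePreserving_homeomorphUnitSphereProd
  rw [hfin] at h1
  have hm : Measurable fun q : Metric.sphere (0 : EuclideanSpace ℝ (Fin (n + 1))) 1 × Ioi (0 : ℝ) =>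
      H q.2 := hH.comp (measurable_subtype_coe.comp measurable_snd)
  have h2 := h1.lintegral_comp hm
  calc ∫⁻ z : EuclideanSpace ℝ (Fin (n + 1)), H ‖z‖
      = ∫⁻ z in ({0}ᶜ : Set (EuclideanSpace ℝ (Fin (n + 1)))), H ‖z‖ := by
        rw [restrict_compl_singleton]
    _ = ∫⁻ z : ({0}ᶜ : Set (EuclideanSpace ℝ (Fin (n + 1)))), H ‖z.1‖ ∂(volume.comap Subtype.val) :=
        (lintegral_subtype_comap (measurableSet_singleton _).compl _).symm
    _ = _ := by
        simp only [homeomorphUnitSphereProd_apply_snd_coe] at h2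
        rw [h2, lintegral_prod _ hm.aemeasurable]
        simp only
        rw [lintegral_const, mul_comm]
        congr 1
        have hm2 : Measurable fun y : Ioi (0 : ℝ) => H y := hH.comp measurable_subtype_coe
        rw [Measure.volumeIoiPow, lintegral_withDensity_eq_lintegral_mul _ (by fun_prop) hm2,
          ← lintegral_subtype_comap measurableSet_Ioi]
        rfl

/-- The reflection in the hyperplane orthogonal to x - y exchanges the two vectors, and right
invariance absorbs it. -/
theorem lintegral_orthHaar_eq_of_norm_eq {d : ℕ} (F : EuclideanSpace ℝ (Fin d) → ℝ≥0∞)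
    {x y : EuclideanSpace ℝ (Fin d)} (h : ‖x‖ = ‖y‖) :
    ∫⁻ θ, F (orthEquiv d θ x) ∂orthHaar d = ∫⁻ θ, F (orthEquiv d θ y) ∂orthHaar d := by
  obtain ⟨g, hg⟩ : ∃ g : Matrix.orthogonalGroup (Fin d) ℝ, orthEquiv d g x = y := by
    refine ⟨(orthEquiv d).symm (Submodule.reflection (Submodule.span ℝ {x - y})ᗮ), ?_⟩
    rw [MulEquiv.apply_symm_apply]
    exact Submodule.reflection_sub h
  have hmul : ∀ θ, orthEquiv d θ y = orthEquiv d (θ * g) x := fun θ => by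
    rw [map_mul, ← hg]; rfl
  simp only [hmul]
  exact (lintegral_orthHaar_mul_right (fun θ => F (orthEquiv d θ x)) g).symm

theorem lintegral_eq_lintegral_orthHaar {d : ℕ} {F : EuclideanSpace ℝ (Fin d) → ℝ≥0∞}
    (hF : Measurable F) : ∫⁻ x, F x = ∫⁻ x, ∫⁻ θ, F (orthEquiv d θ x) ∂orthHaar d := by
  rw [lintegral_lintegral_swap]
  · have h : ∀ θ, ∫⁻ x, F (orthEquiv d θ x) = ∫⁻ x, F x := fun θ =>
      (orthEquiv d θ).measurePreserving.lintegral_comp hF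
    simp [h]
  · have : Continuous fun q : EuclideanSpace ℝ (Fin d) × Matrix.orthogonalGroup (Fin d) ℝ =>
        orthEquiv d q.2 q.1 := continuous_snd.orthEquiv continuous_fst
    exact (hF.comp this.measurable).aemeasurable

theorem norm_consE_zero {n : ℕ} (t : ℝ) : ‖(consE t 0 : EuclideanSpace ℝ (Fin (n + 1)))‖ = |t| := by
  have := norm_consE_sq t (0 : EuclideanSpace ℝ (Fin n))
  rw [norm_zero, zero_pow two_ne_zero, add_zero, ← sq_abs t] at this
  exact (sq_eq_sq₀ (norm_nonneg _) (abs_nonneg t)).mp this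

/-- The image of Haar measure times Lebesgue measure under `(θ, u) ↦ u θ(e₁)`. -/
def lineMeasure (n : ℕ) : Measure (EuclideanSpace ℝ (Fin (n + 1))) :=
  ((orthHaar (n + 1)).prod volume).map fun q => orthEquiv (n + 1) q.1 (consE q.2 0)

theorem continuous_lineMap (n : ℕ) :
    Continuous fun q : Matrix.orthogonalGroup (Fin (n + 1)) ℝ × ℝ =>
      orthEquiv (n + 1) q.1 (consE q.2 0) :=
  continuous_fst.orthEquiv (continuous_snd.consE continuous_const)

theorem lintegral_lineMeasure {n : ℕ} {F : EuclideanSpace ℝ (Fin (n + 1)) → ℝ≥0∞}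
    (hF : Measurable F) :
    ∫⁻ z, F z ∂lineMeasure n =
      2 * ∫⁻ r in Ioi (0 : ℝ), ∫⁻ θ, F (orthEquiv (n + 1) θ (consE r 0)) ∂orthHaar (n + 1) := by
  have hm : Measurable fun q : Matrix.orthogonalGroup (Fin (n + 1)) ℝ × ℝ =>
      F (orthEquiv (n + 1) q.1 (consE q.2 0)) := hF.comp (continuous_lineMap n).measurable
  rw [lineMeasure, lintegral_map hF (continuous_lineMap n).measurable,
    lintegral_prod_symm _ hm.aemeasurable]
  set H : ℝ → ℝ≥0∞ := fun u => ∫⁻ θ, F (orthEquiv (n + 1) θ (consE u 0)) ∂orthHaar (n + 1) with hH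
  have hneg : ∀ u, H (-u) = H u := fun u =>
    lintegral_orthHaar_eq_of_norm_eq F (by simp [norm_consE_zero])
  change ∫⁻ u, H u = 2 * ∫⁻ u in Ioi 0, H u
  rw [← lintegral_add_compl H (measurableSet_Ioi (a := (0 : ℝ))), compl_Ioi, two_mul]
  congr 1
  have := (Measure.measurePreserving_neg (volume : Measure ℝ)).setLIntegral_comp_preimage_emb
    (MeasurableEquiv.neg ℝ).measurableEmbedding H (Ioi 0)
  simp only [hneg] at this
  rw [← this, neg_preimage, neg_Ioi, neg_zero, restrict_Iio_eq_restrict_Iic]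

/-- Both measures are rotation invariant, so F may be replaced by its rotational average, a radial
function. The polar Jacobian r^n cancels the density, and c is 2 divided by the area of the unit
sphere, the 2 counting the two halves of a line. -/
theorem exists_lineMeasure_eq (n : ℕ) : ∃ c : ℝ≥0, lineMeasure n =
    volume.withDensity fun z : EuclideanSpace ℝ (Fin (n + 1)) =>
      ENNReal.ofReal (c * (‖z‖ ^ n)⁻¹) := by
  set S := (volume : Measure (EuclideanSpace ℝ (Fin (n + 1)))).toSphere univ with hS
  have hS0 : S ≠ 0 := by
    rw [hS, Measure.toSphere_apply_univ]
    exact mul_ne_zero (by simp) (volume_ball_ne_zero _ one_pos)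
  have hSt : S ≠ ∞ := measure_ne_top _ _
  set c : ℝ≥0 := (2 * S⁻¹).toNNReal with hc
  have hcS : (c : ℝ≥0∞) = 2 * S⁻¹ :=
    ENNReal.coe_toNNReal (ENNReal.mul_ne_top (by simp) (ENNReal.inv_ne_top.mpr hS0))
  refine ⟨c, Measure.ext_of_lintegral _ fun F hF => ?_⟩
  set H : EuclideanSpace ℝ (Fin (n + 1)) → ℝ≥0∞ := fun z =>
    ∫⁻ θ, F (orthEquiv (n + 1) θ z) ∂orthHaar (n + 1) with hH
  have hHm : Measurable H := by
    refine Measurable.lintegral_prod_right' (f := fun q : EuclideanSpace ℝ (Fin (n + 1)) ×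
      Matrix.orthogonalGroup (Fin (n + 1)) ℝ => F (orthEquiv (n + 1) q.2 q.1)) ?_
    exact hF.comp (continuous_snd.orthEquiv continuous_fst).measurable
  have hHn : ∀ z, H z = H (consE ‖z‖ 0) := fun z =>
    lintegral_orthHaar_eq_of_norm_eq F (by rw [norm_consE_zero, abs_of_nonneg (norm_nonneg z)])
  have hcons : Continuous fun t : ℝ => (consE t 0 : EuclideanSpace ℝ (Fin (n + 1))) :=
    continuous_id.consE continuous_const
  have hdm : Measurable fun z : EuclideanSpace ℝ (Fin (n + 1)) =>
      ENNReal.ofReal (c * (‖z‖ ^ n)⁻¹) := by fun_prop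
  rw [lintegral_lineMeasure hF, lintegral_withDensity_eq_lintegral_mul _ hdm hF,
    lintegral_eq_lintegral_orthHaar (hdm.mul hF)]
  simp only [Pi.mul_apply, LinearIsometryEquiv.norm_map]
  have h1 : ∀ z : EuclideanSpace ℝ (Fin (n + 1)),
      ∫⁻ θ, ENNReal.ofReal (c * (‖z‖ ^ n)⁻¹) * F (orthEquiv (n + 1) θ z) ∂orthHaar (n + 1) =
        ENNReal.ofReal (c * (‖z‖ ^ n)⁻¹) * H (consE ‖z‖ 0) := fun z => by
    rw [lintegral_const_mul' _ _ ENNReal.ofReal_ne_top, ← hHn]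
  simp only [h1]
  rw [lintegral_fun_norm n (H := fun r => ENNReal.ofReal (c * (r ^ n)⁻¹) * H (consE r 0))
    (by
      refine Measurable.mul (by fun_prop) (hHm.comp hcons.measurable)), ← hS]
  have h2 : ∀ r ∈ Ioi (0 : ℝ), ENNReal.ofReal (r ^ n) * (ENNReal.ofReal (c * (r ^ n)⁻¹) *
      H (consE r 0)) = c * H (consE r 0) := fun r hr => by
    have hr : 0 < r := hr
    rw [← mul_assoc, ← ENNReal.ofReal_mul (by positivity)]
    have : r ^ n * (c * (r ^ n)⁻¹) = c := by field_simp
    rw [this, ENNReal.ofReal_coe_nnreal]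
  rw [setLIntegral_congr_fun measurableSet_Ioi h2, lintegral_const_mul' _ _ (by simp), hcS,
    ← mul_assoc, mul_comm S, mul_assoc 2, ENNReal.inv_mul_cancel hS0 hSt, mul_one]

/-! ### Differences of the kernel -/

/-- With a ≤ b and x = a / b, Bernoulli gives 1 - x^n ≤ n (1 - x) ≤ n (1 - x)^(1-ε), and 1 - x ≤ (b
- a) / a. Giving up ε keeps the exponent above -(n+1), so that the right side is locally integrable
when a and b are norms in ℝ^(n+1). -/
theorem abs_inv_pow_sub_inv_pow_le {n : ℕ} (hn : 1 ≤ n) {ε : ℝ} (hε : 0 < ε) (hε1 : ε < 1)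
    {a b : ℝ} (ha : 0 ≤ a) (hb : 0 ≤ b) :
    |(a ^ n)⁻¹ - (b ^ n)⁻¹| ≤
      n * |a - b| ^ (1 - ε) * (a ^ (ε - (n + 1)) + b ^ (ε - (n + 1))) := by
  wlog hab : a ≤ b generalizing a b
  · rw [abs_sub_comm, abs_sub_comm a, add_comm (a ^ _)]
    exact this hb ha (le_of_not_ge hab)
  have hn0 : (1 : ℝ) ≤ n := by exact_mod_cast hn
  rcases hb.eq_or_lt with rfl | hb
  · have : a = 0 := le_antisymm hab ha
    subst this
    simp only [sub_self, abs_zero]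
    positivity
  have hexp : ∀ x : ℝ, 0 < x → x ^ (1 - ε) * x ^ (ε - (n + 1)) = (x ^ n)⁻¹ := fun x hx => by
    rw [← Real.rpow_add hx, show 1 - ε + (ε - (n + 1)) = -(n : ℝ) by ring, Real.rpow_neg hx.le,
      Real.rpow_natCast]
  -- At a = 0 both the inverse and the negative power take the default value 0, and the claim
  -- reduces to b^(-n) ≤ n b^(-n).
  rcases ha.eq_or_lt with rfl | ha
  · have h0 : (0 : ℝ) ^ (ε - (n + 1)) = 0 := Real.zero_rpow (by linarith)
    rw [zero_pow (by lia), inv_zero, zero_sub, abs_neg, zero_sub, abs_neg, abs_of_pos hb, h0,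
      zero_add, mul_assoc, hexp b hb, abs_of_pos (by positivity)]
    exact le_mul_of_one_le_left (by positivity) hn0
  · set x := a / b with hx
    have hx0 : 0 < x := by positivity
    have hx1 : x ≤ 1 := (div_le_one hb).mpr hab
    have hbern : 1 - x ^ n ≤ n * (1 - x) := by
      have := one_add_mul_le_pow (a := x - 1) (by linarith) n
      rw [add_sub_cancel] at this
      linarith
    have hpow : (1 - x) ≤ (1 - x) ^ (1 - ε) :=
      Real.self_le_rpow_of_le_one (by linarith) (by linarith) (by linarith)
    have h1x : (1 - x) = (b - a) / b := by rw [hx]; field_simp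
    have h2 : (1 - x) ^ (1 - ε) ≤ (b - a) ^ (1 - ε) * (a ^ (1 - ε))⁻¹ := by
      rw [h1x, Real.div_rpow (by linarith) hb.le, div_eq_mul_inv]
      have : a ^ (1 - ε) ≤ b ^ (1 - ε) := Real.rpow_le_rpow ha.le hab (by linarith)
      have h3 : 0 ≤ (b - a) ^ (1 - ε) := Real.rpow_nonneg (by linarith) _
      gcongr
    have hinv : (b ^ n)⁻¹ = (a ^ n)⁻¹ * x ^ n := by
      rw [hx, div_pow]; field_simp
    have hle : (b ^ n)⁻¹ ≤ (a ^ n)⁻¹ := by gcongr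
    rw [abs_of_nonneg (by linarith), abs_sub_comm, abs_of_nonneg (by linarith)]
    have ha2 : (a ^ n)⁻¹ * (a ^ (1 - ε))⁻¹ = a ^ (ε - (n + 1)) := by
      rw [← Real.rpow_natCast, ← Real.rpow_neg ha.le, ← Real.rpow_neg ha.le, ← Real.rpow_add ha]
      congr 1; ring
    have h5 : 0 ≤ (b - a) ^ (1 - ε) := Real.rpow_nonneg (by linarith) _
    calc (a ^ n)⁻¹ - (b ^ n)⁻¹ = (a ^ n)⁻¹ * (1 - x ^ n) := by rw [hinv]; ring
      _ ≤ (a ^ n)⁻¹ * (n * ((b - a) ^ (1 - ε) * (a ^ (1 - ε))⁻¹)) := by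
        gcongr
        refine hbern.trans ?_
        gcongr
        exact hpow.trans h2
      _ = n * (b - a) ^ (1 - ε) * ((a ^ n)⁻¹ * (a ^ (1 - ε))⁻¹) := by ring
      _ = n * (b - a) ^ (1 - ε) * a ^ (ε - (n + 1)) := by rw [ha2]
      _ ≤ _ := by
        gcongr
        have : 0 ≤ b ^ (ε - (n + 1)) := by positivity
        linarith

theorem integrableOn_norm_rpow (n : ℕ) {ε : ℝ} (hε : 0 < ε) (ρ : ℝ) :
    IntegrableOn (fun z : EuclideanSpace ℝ (Fin (n + 1)) => ‖z‖ ^ (ε - (n + 1)))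
      (Metric.ball 0 ρ) := by
  rw [integrableOn_fun_norm_addHaar volume (f := fun y => y ^ (ε - (n + 1)))]
  have hfin : Module.finrank ℝ (EuclideanSpace ℝ (Fin (n + 1))) - 1 = n := by simp
  rw [hfin]
  have h1 : IntegrableOn (fun y : ℝ => y ^ (ε - 1)) (Ioo 0 ρ) := by
    rcases le_or_gt ρ 0 with h | h
    · rw [Ioo_eq_empty (not_lt.mpr h)]; exact integrableOn_empty
    · exact (intervalIntegral.integrableOn_Ioo_rpow_iff h).mpr (by linarith)
  refine h1.congr_fun (fun y hy => ?_) measurableSet_Ioo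
  have hy0 : 0 < y := hy.1
  simp only [smul_eq_mul]
  rw [← Real.rpow_natCast, ← Real.rpow_add hy0]
  congr 1; ring

/-- The pointwise bound is integrated with a = ‖z - w‖ and b = ‖z‖. Translation by ‖w‖ ≤ 1 keeps the
ball inside radius ρ + 1, so one integral D serves both terms. -/
theorem exists_integral_kernel_sub_le {n : ℕ} (hn : 1 ≤ n) {ε : ℝ} (hε : 0 < ε) (hε1 : ε < 1)
    (ρ : ℝ) : ∃ C : ℝ, 0 ≤ C ∧ ∀ w : EuclideanSpace ℝ (Fin (n + 1)), ‖w‖ ≤ 1 →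
      IntegrableOn (fun z => (‖z - w‖ ^ n)⁻¹ - (‖z‖ ^ n)⁻¹) (Metric.ball 0 ρ) ∧
      ∫ z in Metric.ball 0 ρ, |(‖z - w‖ ^ n)⁻¹ - (‖z‖ ^ n)⁻¹| ≤ C * ‖w‖ ^ (1 - ε) := by
  set g : EuclideanSpace ℝ (Fin (n + 1)) → ℝ := fun z => ‖z‖ ^ (ε - (n + 1)) with hg
  set D := ∫ z in Metric.ball (0 : EuclideanSpace ℝ (Fin (n + 1))) (ρ + 1), g z with hD
  have hgi := integrableOn_norm_rpow n hε (ρ + 1)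
  have hg0 : ∀ z, 0 ≤ g z := fun z => by positivity
  have hD0 : 0 ≤ D := setIntegral_nonneg Metric.isOpen_ball.measurableSet fun z _ => hg0 z
  refine ⟨n * (D + D), by positivity, fun w hw => ?_⟩
  have hb : MeasurableSet (Metric.ball (0 : EuclideanSpace ℝ (Fin (n + 1))) ρ) :=
    Metric.isOpen_ball.measurableSet
  have hsub : Metric.ball (0 : EuclideanSpace ℝ (Fin (n + 1))) ρ ⊆ Metric.ball 0 (ρ + 1) :=
    Metric.ball_subset_ball (by linarith)
  have hpre : Metric.ball (0 : EuclideanSpace ℝ (Fin (n + 1))) ρ ⊆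
      (fun z => z - w) ⁻¹' Metric.ball 0 (ρ + 1) := fun z hz => by
    rw [mem_preimage, mem_ball_zero_iff]
    rw [mem_ball_zero_iff] at hz
    linarith [norm_sub_le z w]
  have hmp := measurePreserving_sub_right (volume : Measure (EuclideanSpace ℝ (Fin (n + 1)))) w
  have hme : MeasurableEmbedding fun z : EuclideanSpace ℝ (Fin (n + 1)) => z - w :=
    (MeasurableEquiv.subRight w).measurableEmbedding
  have hgi2 : IntegrableOn (fun z => g (z - w)) ((fun z => z - w) ⁻¹' Metric.ball 0 (ρ + 1)) :=
    (hmp.integrableOn_comp_preimage hme).mpr hgi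
  have hgD2 : ∫ z in (fun z => z - w) ⁻¹' Metric.ball 0 (ρ + 1), g (z - w) = D :=
    hmp.setIntegral_preimage_emb hme g _
  have hint : IntegrableOn (fun z => n * ‖w‖ ^ (1 - ε) * (g (z - w) + g z)) (Metric.ball 0 ρ) :=
    ((hgi2.mono_set hpre).add (hgi.mono_set hsub)).const_mul _
  have hpt : ∀ z, |(‖z - w‖ ^ n)⁻¹ - (‖z‖ ^ n)⁻¹| ≤ n * ‖w‖ ^ (1 - ε) * (g (z - w) + g z) := by
    intro z
    refine (abs_inv_pow_sub_inv_pow_le hn hε hε1 (norm_nonneg _) (norm_nonneg _)).trans ?_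
    have h1 : |‖z - w‖ - ‖z‖| ≤ ‖w‖ := by
      refine (abs_norm_sub_norm_le _ _).trans (le_of_eq ?_)
      rw [sub_sub_cancel_left, norm_neg]
    have h2 : |‖z - w‖ - ‖z‖| ^ (1 - ε) ≤ ‖w‖ ^ (1 - ε) :=
      Real.rpow_le_rpow (abs_nonneg _) h1 (by linarith)
    have h3 : 0 ≤ g (z - w) + g z := add_nonneg (hg0 _) (hg0 _)
    gcongr
  have hI : IntegrableOn (fun z => (‖z - w‖ ^ n)⁻¹ - (‖z‖ ^ n)⁻¹) (Metric.ball 0 ρ) := by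
    refine Integrable.mono' hint ?_ (Filter.Eventually.of_forall fun z => hpt z)
    exact (by fun_prop : Measurable fun z : EuclideanSpace ℝ (Fin (n + 1)) =>
      (‖z - w‖ ^ n)⁻¹ - (‖z‖ ^ n)⁻¹).aestronglyMeasurable
  refine ⟨hI, ?_⟩
  calc ∫ z in Metric.ball 0 ρ, |(‖z - w‖ ^ n)⁻¹ - (‖z‖ ^ n)⁻¹|
      ≤ ∫ z in Metric.ball 0 ρ, n * ‖w‖ ^ (1 - ε) * (g (z - w) + g z) :=
        integral_mono hI.abs hint hpt
    _ = n * ‖w‖ ^ (1 - ε) * ((∫ z in Metric.ball 0 ρ, g (z - w)) + ∫ z in Metric.ball 0 ρ, g z) := by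
        rw [integral_const_mul, integral_add (hgi2.mono_set hpre) (hgi.mono_set hsub)]
    _ ≤ n * ‖w‖ ^ (1 - ε) * (D + D) := by
        gcongr
        · rw [← hgD2]
          exact setIntegral_mono_set hgi2 (Filter.Eventually.of_forall fun z => hg0 _)
            hpre.eventuallyLE
        · exact setIntegral_mono_set hgi (Filter.Eventually.of_forall fun z => hg0 _)
            hsub.eventuallyLE
    _ = _ := by ring

/-! ### Signed averages and the X-ray transform. -/

theorem integrable_of_bounded_of_support {α : Type*} [MeasurableSpace α] {μ : Measure α}
    {F : α → ℝ} (hF : Measurable F) {B : ℝ} (hB : ∀ x, |F x| ≤ B) {S : Set α} (hS : μ S ≠ ∞)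
    (h0 : ∀ x, x ∉ S → F x = 0) : Integrable F μ := by
  refine (integrableOn_iff_integrable_of_support_subset (s := S) fun x hx => ?_).mp ?_
  · by_contra hxS; exact hx (h0 x hxS)
  · exact Measure.integrableOn_of_bounded hS hF.aestronglyMeasurable
      (Filter.Eventually.of_forall fun x => by simpa using hB x)

/-- The (Bochner) average of `f` over the ball of radius `r` around `x`. -/
def avgR {d : ℕ} (r : ℝ) (f : EuclideanSpace ℝ (Fin d) → ℝ) (x : EuclideanSpace ℝ (Fin d)) : ℝ :=
  ∫ z, f (x + z) ∂ballAvg d r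

/-- Integrals of `h` over the lines in direction `θ(e₁)`. -/
def xray {n : ℕ} (h : EuclideanSpace ℝ (Fin (n + 1)) → ℝ)
    (θ : Matrix.orthogonalGroup (Fin (n + 1)) ℝ) (y : EuclideanSpace ℝ (Fin n)) : ℝ :=
  ∫ t, h (orthEquiv (n + 1) θ (consE t y))

theorem measurable_avgR {d : ℕ} (r : ℝ) {f : EuclideanSpace ℝ (Fin d) → ℝ} (hf : Measurable f) :
    Measurable (avgR r f) := by
  have h : StronglyMeasurable fun q : EuclideanSpace ℝ (Fin d) × EuclideanSpace ℝ (Fin d) =>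
      f (q.1 + q.2) := (hf.comp measurable_add).stronglyMeasurable
  exact (h.integral_prod_right' (ν := ballAvg d r)).measurable

theorem integrable_ballAvg {d : ℕ} {r : ℝ} (hr : 0 < r) {f : EuclideanSpace ℝ (Fin d) → ℝ}
    (hf : Measurable f) {B : ℝ} (hB : ∀ x, |f x| ≤ B) : Integrable f (ballAvg d r) := by
  have := isProbabilityMeasure_ballAvg d hr
  exact integrable_of_bounded_of_support hf hB (S := univ) (measure_ne_top _ _) (by simp)

theorem integrable_ballAvg_add {d : ℕ} {r : ℝ} (hr : 0 < r) {f : EuclideanSpace ℝ (Fin d) → ℝ}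
    (hf : Measurable f) {B : ℝ} (hB : ∀ x, |f x| ≤ B) (x : EuclideanSpace ℝ (Fin d)) :
    Integrable (fun z => f (x + z)) (ballAvg d r) :=
  integrable_ballAvg hr (by fun_prop) fun _ => hB _

theorem abs_avgR_le {d : ℕ} {r : ℝ} (hr : 0 < r) {f : EuclideanSpace ℝ (Fin d) → ℝ}
    {B : ℝ} (hB : ∀ x, |f x| ≤ B) (x : EuclideanSpace ℝ (Fin d)) : |avgR r f x| ≤ B := by
  have := isProbabilityMeasure_ballAvg d hr
  have h := norm_integral_le_of_norm_le_const (μ := ballAvg d r) (f := fun z => f (x + z))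
    (C := B) (Filter.Eventually.of_forall fun z => by simpa using hB (x + z))
  simpa [avgR] using h

theorem avgR_eq_zero {d : ℕ} {r R : ℝ} {f : EuclideanSpace ℝ (Fin d) → ℝ}
    (h0 : ∀ x, R < ‖x‖ → f x = 0) {x : EuclideanSpace ℝ (Fin d)} (hx : R + r < ‖x‖) :
    avgR r f x = 0 := by
  refine integral_eq_zero_of_ae ?_
  filter_upwards [ae_ballAvg d r] with z hz
  refine h0 _ ?_
  have h4 := norm_le_norm_add_norm_sub' x (x + z)
  have h5 : ‖x - (x + z)‖ = ‖z‖ := by rw [sub_add_cancel_left, norm_neg]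
  linarith

theorem measurable_xray {n : ℕ} {h : EuclideanSpace ℝ (Fin (n + 1)) → ℝ} (hh : Measurable h) :
    Measurable fun q : Matrix.orthogonalGroup (Fin (n + 1)) ℝ × EuclideanSpace ℝ (Fin n) =>
      xray h q.1 q.2 := by
  have hc : Continuous fun q : (Matrix.orthogonalGroup (Fin (n + 1)) ℝ ×
      EuclideanSpace ℝ (Fin n)) × ℝ => orthEquiv (n + 1) q.1.1 (consE q.2 q.1.2) :=
    (continuous_fst.comp continuous_fst).orthEquiv
      (continuous_snd.consE (continuous_snd.comp continuous_fst))
  have hm : StronglyMeasurable fun q : (Matrix.orthogonalGroup (Fin (n + 1)) ℝ ×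
      EuclideanSpace ℝ (Fin n)) × ℝ => h (orthEquiv (n + 1) q.1.1 (consE q.2 q.1.2)) :=
    (hh.comp hc.measurable).stronglyMeasurable
  exact (hm.integral_prod_right' (ν := (volume : Measure ℝ))).measurable

theorem measurable_orthEquiv_comp {d : ℕ} {h : EuclideanSpace ℝ (Fin d) → ℝ} (hh : Measurable h)
    (θ : Matrix.orthogonalGroup (Fin d) ℝ) : Measurable fun x => h (orthEquiv d θ x) :=
  hh.comp (orthEquiv d θ).continuous.measurable

theorem eq_zero_orthEquiv_consE {n : ℕ} {h : EuclideanSpace ℝ (Fin (n + 1)) → ℝ} {R : ℝ}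
    (h0 : ∀ x, R < ‖x‖ → h x = 0) (θ : Matrix.orthogonalGroup (Fin (n + 1)) ℝ) {t : ℝ}
    {y : EuclideanSpace ℝ (Fin n)} (hty : t ∉ Icc (-R) R ∨ R < ‖y‖) :
    h (orthEquiv (n + 1) θ (consE t y)) = 0 := by
  refine h0 _ ?_
  rw [LinearIsometryEquiv.norm_map]
  rcases hty with ht | hy
  · refine lt_of_lt_of_le ?_ (abs_le_norm_consE t y)
    by_contra hc
    exact ht (abs_le.mp (not_lt.mp hc))
  · exact hy.trans_le (norm_le_norm_consE t y)

theorem integrable_line {n : ℕ} {h : EuclideanSpace ℝ (Fin (n + 1)) → ℝ} (hh : Measurable h)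
    {B R : ℝ} (hB : ∀ x, |h x| ≤ B) (h0 : ∀ x, R < ‖x‖ → h x = 0)
    (θ : Matrix.orthogonalGroup (Fin (n + 1)) ℝ) (y : EuclideanSpace ℝ (Fin n)) :
    Integrable fun t => h (orthEquiv (n + 1) θ (consE t y)) := by
  have hc : Continuous fun t : ℝ => consE t y := continuous_id.consE continuous_const
  exact integrable_of_bounded_of_support
    ((measurable_orthEquiv_comp hh θ).comp hc.measurable) (fun _ => hB _)
    (S := Icc (-R) R) (by simp) fun t ht => eq_zero_orthEquiv_consE h0 θ (Or.inl ht)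

theorem abs_xray_le {n : ℕ} {h : EuclideanSpace ℝ (Fin (n + 1)) → ℝ}
    {B R : ℝ} (hR : 0 ≤ R) (hB : ∀ x, |h x| ≤ B) (h0 : ∀ x, R < ‖x‖ → h x = 0)
    (θ : Matrix.orthogonalGroup (Fin (n + 1)) ℝ) (y : EuclideanSpace ℝ (Fin n)) :
    |xray h θ y| ≤ B * (2 * R) := by
  have h1 : xray h θ y = ∫ t in Icc (-R) R, h (orthEquiv (n + 1) θ (consE t y)) :=
    (setIntegral_eq_integral_of_forall_compl_eq_zero fun t ht =>
      eq_zero_orthEquiv_consE h0 θ (Or.inl ht)).symm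
  have h2 := norm_setIntegral_le_of_norm_le_const (μ := (volume : Measure ℝ))
    (s := Icc (-R) R) (f := fun t => h (orthEquiv (n + 1) θ (consE t y))) (C := B) (by simp)
    fun t _ => hB _
  rw [← h1, measureReal_def, Real.volume_Icc, ENNReal.toReal_ofReal (by linarith)] at h2
  rw [← Real.norm_eq_abs]
  linarith

theorem xray_eq_zero {n : ℕ} {h : EuclideanSpace ℝ (Fin (n + 1)) → ℝ}
    {R : ℝ} (h0 : ∀ x, R < ‖x‖ → h x = 0)
    (θ : Matrix.orthogonalGroup (Fin (n + 1)) ℝ) {y : EuclideanSpace ℝ (Fin n)} (hy : R < ‖y‖) :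
    xray h θ y = 0 := by
  refine integral_eq_zero_of_ae (Filter.Eventually.of_forall fun t => ?_)
  exact eq_zero_orthEquiv_consE h0 θ (Or.inr hy)

theorem volume_closedBall_ne_top {d : ℕ} (R : ℝ) :
    volume (Metric.closedBall (0 : EuclideanSpace ℝ (Fin d)) R) ≠ ∞ :=
  measure_closedBall_lt_top.ne

/-- The square of a line integral is a double integral of h(s) h(s + u) along that line. Integrating
over s and over all parallel lines fills the space and leaves the autocorrelation of h, restricted
to the line through 0 in direction θ(e₁). -/
theorem integral_xray_sq {n : ℕ} {h : EuclideanSpace ℝ (Fin (n + 1)) → ℝ} (hh : Measurable h)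
    {B R : ℝ} (hB : ∀ x, |h x| ≤ B) (h0 : ∀ x, R < ‖x‖ → h x = 0)
    (θ : Matrix.orthogonalGroup (Fin (n + 1)) ℝ) :
    ∫ y, xray h θ y ^ 2 = ∫ u, ∫ x, h x * h (x + orthEquiv (n + 1) θ (consE u 0)) := by
  set h' : EuclideanSpace ℝ (Fin (n + 1)) → ℝ := fun x => h (orthEquiv (n + 1) θ x) with hh'
  have hm' : Measurable h' := measurable_orthEquiv_comp hh θ
  have h0' : ∀ x, R < ‖x‖ → h' x = 0 := fun x hx => h0 _ (by rwa [LinearIsometryEquiv.norm_map])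
  have hce : Continuous fun u : ℝ => (consE u 0 : EuclideanSpace ℝ (Fin (n + 1))) :=
    continuous_id.consE continuous_const
  set G : EuclideanSpace ℝ (Fin (n + 1)) × ℝ → ℝ := fun q => h' q.1 * h' (q.1 + consE q.2 0) with hG
  have hGm : Measurable G := by
    refine (hm'.comp measurable_fst).mul (hm'.comp ?_)
    exact (continuous_fst.add (hce.comp continuous_snd)).measurable
  have hGi : Integrable G (volume.prod volume) := by
    refine integrable_of_bounded_of_support hGm (B := B * B)
      (S := Metric.closedBall 0 R ×ˢ Icc (-(2 * R)) (2 * R)) ?_ ?_ ?_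
    · intro q
      rw [hG, abs_mul]
      exact mul_le_mul (hB _) (hB _) (abs_nonneg _) ((abs_nonneg _).trans (hB 0))
    · rw [Measure.prod_prod]
      exact ENNReal.mul_ne_top (volume_closedBall_ne_top R) (by simp)
    · intro q hq
      by_cases h1 : R < ‖q.1‖
      · simp [hG, h0' _ h1]
      · have h2 : R < ‖q.1 + consE q.2 0‖ := by
          by_contra h3
          refine hq ⟨by simpa using h1, abs_le.mp ?_⟩
          rw [← norm_consE_zero (n := n)]
          have h4 := norm_sub_le (q.1 + consE q.2 0) q.1
          rw [add_sub_cancel_left] at h4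
          linarith
        simp [hG, h0' _ h2]
  have hline : ∀ y, xray h θ y ^ 2 = ∫ s, ∫ u, G (consE s y, u) := by
    intro y
    have h1 : ∀ s, ∫ u, G (consE s y, u) = h' (consE s y) * xray h θ y := by
      intro s
      have h2 : ∀ u, G (consE s y, u) = h' (consE s y) * h' (consE (s + u) y) := fun u => by
        simp only [hG]
        rw [← consE_add, add_zero]
      simp only [h2]
      rw [integral_const_mul, integral_add_left_eq_self (fun u => h' (consE u y)) s]
      rfl
    simp only [h1]
    rw [integral_mul_const, pow_two]
    rfl
  have hΨ : Integrable (fun x => ∫ u, G (x, u)) volume := hGi.integral_prod_left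
  have hmp := measurePreserving_consE n
  have hemb : MeasurableEmbedding fun q : ℝ × EuclideanSpace ℝ (Fin n) => consE q.1 q.2 := by
    refine MeasurableEmbedding.of_measurable_inverse (g := fun x => (x 0, tailE x))
      continuous_consE.measurable ?_ ?_ ?_
    · have : range (fun q : ℝ × EuclideanSpace ℝ (Fin n) => consE q.1 q.2) = univ :=
        range_eq_univ.mpr fun x => ⟨(x 0, tailE x), consE_tailE x⟩
      rw [this]; exact MeasurableSet.univ
    · exact (Continuous.prodMk (by fun_prop) continuous_tailE).measurable
    · intro q; rfl
  calc ∫ y, xray h θ y ^ 2 = ∫ y, ∫ s, ∫ u, G (consE s y, u) := by simp only [hline]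
    _ = ∫ q : ℝ × EuclideanSpace ℝ (Fin n), (∫ u, G (consE q.1 q.2, u)) ∂(volume.prod volume) := by
      rw [integral_prod_symm]
      exact (hmp.integrable_comp_emb hemb (g := fun x => ∫ u, G (x, u))).mpr hΨ
    _ = ∫ x, ∫ u, G (x, u) := hmp.integral_comp hemb (fun x => ∫ u, G (x, u))
    _ = ∫ u, ∫ x, G (x, u) := integral_integral_swap hGi
    _ = _ := by
      congr 1 with u
      have := (orthEquiv (n + 1) θ).measurePreserving.integral_comp
        (orthEquiv (n + 1) θ).toHomeomorph.measurableEmbedding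
        (fun x => h x * h (x + orthEquiv (n + 1) θ (consE u 0)))
      rw [← this]
      congr 1 with x
      simp only [hG, hh', map_add]

theorem integrable_inv_norm_pow_mul {n : ℕ} {F : EuclideanSpace ℝ (Fin (n + 1)) → ℝ}
    (hF : Measurable F) {B ρ : ℝ} (hB : ∀ x, |F x| ≤ B) (h0 : ∀ x, ρ ≤ ‖x‖ → F x = 0) :
    Integrable fun z => (‖z‖ ^ n)⁻¹ * F z := by
  -- Taking ε = 1 there makes the exponent equal to -n.
  have h1 := integrableOn_norm_rpow n one_pos ρ
  have h2 : ∀ z : EuclideanSpace ℝ (Fin (n + 1)), ‖z‖ ^ ((1 : ℝ) - (n + 1)) = (‖z‖ ^ n)⁻¹ := by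
    intro z
    rw [show (1 : ℝ) - (n + 1) = -(n : ℝ) by ring, Real.rpow_neg (norm_nonneg _), Real.rpow_natCast]
  simp only [h2] at h1
  refine (integrableOn_iff_integrable_of_support_subset (s := Metric.ball 0 ρ)
    fun x hx => ?_).mp ?_
  · by_contra hxS
    exact hx (by simp [h0 x (by simpa using hxS)])
  · exact Integrable.mul_bdd (c := B) h1 hF.aestronglyMeasurable
      (Filter.Eventually.of_forall fun x => by simpa using hB x)

/-- The averaging shift is transferred from P to the kernel, where it is controlled by the
integrated kernel difference with ‖w‖ < r. Hence only the supremum and the support of P enter, and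
no smoothness. -/
theorem exists_abs_integral_kernel_avgR_sub_le {n : ℕ} (hn : 1 ≤ n) {ε : ℝ} (hε : 0 < ε)
    (hε1 : ε < 1) (ρ : ℝ) : ∃ C : ℝ, 0 ≤ C ∧ ∀ r : ℝ, 0 < r → r ≤ 1 →
      ∀ (P : EuclideanSpace ℝ (Fin (n + 1)) → ℝ) (M : ℝ), Measurable P → (∀ z, |P z| ≤ M) →
      (∀ z, ρ ≤ ‖z‖ → P z = 0) →
        |(∫ z, (‖z‖ ^ n)⁻¹ * avgR r P z) - ∫ z, (‖z‖ ^ n)⁻¹ * P z| ≤ M * (C * r ^ (1 - ε)) := by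
  obtain ⟨C, hC, hk⟩ := exists_integral_kernel_sub_le hn hε hε1 ρ
  refine ⟨C, hC, fun r hr hr1 P M hP hM h0 => ?_⟩
  have := isProbabilityMeasure_ballAvg (n + 1) hr
  have hM0 : 0 ≤ M := (abs_nonneg _).trans (hM 0)
  have hkm : Measurable fun z : EuclideanSpace ℝ (Fin (n + 1)) => (‖z‖ ^ n)⁻¹ := by fun_prop
  have hI0 : Integrable fun z => (‖z‖ ^ n)⁻¹ * P z := integrable_inv_norm_pow_mul hP hM h0
  have hprod : Integrable (fun q : EuclideanSpace ℝ (Fin (n + 1)) × EuclideanSpace ℝ (Fin (n + 1)) =>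
      (‖q.1‖ ^ n)⁻¹ * P (q.1 + q.2)) (volume.prod (ballAvg (n + 1) r)) := by
    have hb : Integrable (fun z : EuclideanSpace ℝ (Fin (n + 1)) => (‖z‖ ^ n)⁻¹ *
        (Metric.ball (0 : EuclideanSpace ℝ (Fin (n + 1))) (ρ + 1)).indicator (fun _ => M) z) := by
      refine integrable_inv_norm_pow_mul (B := M) (ρ := ρ + 1)
        (measurable_const.indicator Metric.isOpen_ball.measurableSet) (fun x => ?_) fun x hx => ?_
      · by_cases hx : x ∈ Metric.ball (0 : EuclideanSpace ℝ (Fin (n + 1))) (ρ + 1) <;>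
          simp [hx, abs_of_nonneg hM0, hM0]
      · exact indicator_of_notMem (by simpa using hx) _
    have hb2 := hb.comp_fst (ballAvg (n + 1) r)
    refine Integrable.mono' hb2 ?_ ?_
    · exact ((hkm.comp measurable_fst).mul (hP.comp measurable_add)).aestronglyMeasurable
    · have hae : ∀ᵐ q ∂((volume : Measure (EuclideanSpace ℝ (Fin (n + 1)))).prod
          (ballAvg (n + 1) r)), ‖q.2‖ < r :=
        Measure.quasiMeasurePreserving_snd.ae (ae_ballAvg (n + 1) r)
      filter_upwards [hae] with q hq
      rw [norm_mul, Real.norm_eq_abs, Real.norm_eq_abs, abs_of_nonneg (by positivity)]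
      by_cases hx : q.1 ∈ Metric.ball (0 : EuclideanSpace ℝ (Fin (n + 1))) (ρ + 1)
      · rw [indicator_of_mem hx]
        gcongr
        exact hM _
      · rw [h0, abs_zero, mul_zero, indicator_of_notMem hx, mul_zero]
        have h3 : ρ + 1 ≤ ‖q.1‖ := by simpa using hx
        have h4 := norm_sub_le (q.1 + q.2) q.2
        rw [add_sub_cancel_right] at h4
        linarith
  have hshift : ∀ w : EuclideanSpace ℝ (Fin (n + 1)),
      ∫ z, (‖z‖ ^ n)⁻¹ * P (z + w) = ∫ z, (‖z - w‖ ^ n)⁻¹ * P z := fun w => by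
    rw [← integral_add_right_eq_self (fun z => (‖z - w‖ ^ n)⁻¹ * P z) w]
    simp
  have h1 : ∫ z, (‖z‖ ^ n)⁻¹ * avgR r P z =
      ∫ w, (∫ z, (‖z - w‖ ^ n)⁻¹ * P z) ∂ballAvg (n + 1) r := by
    simp only [← hshift]
    rw [← integral_integral_swap hprod]
    congr 1 with z
    rw [avgR, integral_const_mul]
  have h2 : ∫ z, (‖z‖ ^ n)⁻¹ * P z = ∫ _w, (∫ z, (‖z‖ ^ n)⁻¹ * P z) ∂ballAvg (n + 1) r := by simp
  have h3 : Integrable (fun w => ∫ z, (‖z - w‖ ^ n)⁻¹ * P z) (ballAvg (n + 1) r) := by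
    simp only [← hshift]
    exact hprod.integral_prod_right
  rw [h1, h2, ← integral_sub h3 (integrable_const _)]
  have h4 : ∀ᵐ w ∂ballAvg (n + 1) r, ‖(∫ z, (‖z - w‖ ^ n)⁻¹ * P z) - ∫ z, (‖z‖ ^ n)⁻¹ * P z‖ ≤
      M * (C * r ^ (1 - ε)) := by
    filter_upwards [ae_ballAvg (n + 1) r] with w hw
    obtain ⟨hki, hkb⟩ := hk w (by linarith)
    have hkiP : Integrable fun z => ((‖z - w‖ ^ n)⁻¹ - (‖z‖ ^ n)⁻¹) * P z := by
      refine (integrableOn_iff_integrable_of_support_subset (s := Metric.ball 0 ρ)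
        fun x hx => ?_).mp ?_
      · by_contra hxS
        exact hx (by simp [h0 x (by simpa using hxS)])
      · exact Integrable.mul_bdd (c := M) hki hP.aestronglyMeasurable
          (Filter.Eventually.of_forall fun x => by simpa using hM x)
    have hkw : Integrable fun z => (‖z - w‖ ^ n)⁻¹ * P z := by
      refine (hkiP.add hI0).congr (Filter.Eventually.of_forall fun z => ?_)
      simp only [Pi.add_apply]; ring
    rw [← integral_sub hkw hI0]
    calc ‖∫ z, (‖z - w‖ ^ n)⁻¹ * P z - (‖z‖ ^ n)⁻¹ * P z‖
        = ‖∫ z in Metric.ball 0 ρ, (‖z - w‖ ^ n)⁻¹ * P z - (‖z‖ ^ n)⁻¹ * P z‖ := by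
          rw [setIntegral_eq_integral_of_forall_compl_eq_zero fun z hz => ?_]
          rw [h0 z (by simpa using hz)]; ring
      _ ≤ ∫ z in Metric.ball 0 ρ, M * |(‖z - w‖ ^ n)⁻¹ - (‖z‖ ^ n)⁻¹| := by
          refine norm_integral_le_of_norm_le (hki.abs.const_mul M)
            (Filter.Eventually.of_forall fun z => ?_)
          rw [← sub_mul, norm_mul, Real.norm_eq_abs, Real.norm_eq_abs, mul_comm]
          gcongr
          exact hM z
      _ = M * ∫ z in Metric.ball 0 ρ, |(‖z - w‖ ^ n)⁻¹ - (‖z‖ ^ n)⁻¹| := integral_const_mul _ _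
      _ ≤ M * (C * ‖w‖ ^ (1 - ε)) := by gcongr
      _ ≤ M * (C * r ^ (1 - ε)) := by gcongr
  have h5 := norm_integral_le_of_norm_le_const h4
  simpa using h5

theorem enorm_sq_eq_ofReal (x : ℝ) : ‖x‖ₑ ^ 2 = ENNReal.ofReal (x ^ 2) := by
  rw [Real.enorm_eq_ofReal_abs, ← ENNReal.ofReal_pow (abs_nonneg x), sq_abs]

theorem integrable_mul_of_bounded {d : ℕ} {f g : EuclideanSpace ℝ (Fin d) → ℝ}
    (hf : Measurable f) (hg : Measurable g) {B B' R : ℝ} (hB : ∀ x, |f x| ≤ B)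
    (hB' : ∀ x, |g x| ≤ B') (h0 : ∀ x, R < ‖x‖ → g x = 0) : Integrable fun x => f x * g x := by
  refine integrable_of_bounded_of_support (hf.mul hg) (B := B * B')
    (S := Metric.closedBall 0 R) (fun x => ?_) (volume_closedBall_ne_top R) fun x hx => ?_
  · rw [abs_mul]
    exact mul_le_mul (hB _) (hB' _) (abs_nonneg _) ((abs_nonneg _).trans (hB 0))
  · rw [h0 x (by simpa using hx), mul_zero]

theorem abs_integral_mul_le {d : ℕ} {f g : EuclideanSpace ℝ (Fin d) → ℝ} {B B' R : ℝ}
    (hB : ∀ x, |f x| ≤ B) (hB' : ∀ x, |g x| ≤ B') (h0 : ∀ x, R < ‖x‖ → g x = 0) :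
    |∫ x, f x * g x| ≤
      B * B' * volume.real (Metric.closedBall (0 : EuclideanSpace ℝ (Fin d)) R) := by
  have h1 : ∫ x, f x * g x = ∫ x in Metric.closedBall 0 R, f x * g x :=
    (setIntegral_eq_integral_of_forall_compl_eq_zero fun x hx => by
      rw [h0 x (by simpa using hx), mul_zero]).symm
  rw [h1, ← Real.norm_eq_abs]
  refine norm_setIntegral_le_of_norm_le_const (volume_closedBall_ne_top R).lt_top fun x _ => ?_
  rw [norm_mul]
  exact mul_le_mul (hB _) (hB' _) (abs_nonneg _) ((abs_nonneg _).trans (hB 0))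

theorem measurable_integral_mul_shift {d : ℕ} {f g : EuclideanSpace ℝ (Fin d) → ℝ}
    (hf : Measurable f) (hg : Measurable g) : Measurable fun z => ∫ x, f x * g (x + z) := by
  have h : StronglyMeasurable fun q : EuclideanSpace ℝ (Fin d) × EuclideanSpace ℝ (Fin d) =>
      f q.2 * g (q.2 + q.1) :=
    ((hf.comp measurable_snd).mul
      (hg.comp (measurable_snd.add measurable_fst))).stronglyMeasurable
  exact (h.integral_prod_right' (ν := volume)).measurable

theorem integral_mul_shift_eq_zero {d : ℕ} {f g : EuclideanSpace ℝ (Fin d) → ℝ} {R R' : ℝ}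
    (h0 : ∀ x, R < ‖x‖ → f x = 0) (h0' : ∀ x, R' < ‖x‖ → g x = 0) {z : EuclideanSpace ℝ (Fin d)}
    (hz : R + R' < ‖z‖) : ∫ x, f x * g (x + z) = 0 := by
  refine integral_eq_zero_of_ae (Filter.Eventually.of_forall fun x => ?_)
  by_cases hx : R < ‖x‖
  · simp [h0 x hx]
  · have h1 := norm_sub_le (x + z) x
    rw [add_sub_cancel_left] at h1
    simp [h0' (x + z) (by linarith)]

/-- The square of the `L²` norm of the X-ray transform in terms of the autocorrelation. -/
theorem lintegral_xray_sq {n : ℕ} {c : ℝ≥0} (hc : lineMeasure n =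
    volume.withDensity fun z : EuclideanSpace ℝ (Fin (n + 1)) =>
      ENNReal.ofReal (c * (‖z‖ ^ n)⁻¹))
    {h : EuclideanSpace ℝ (Fin (n + 1)) → ℝ} (hh : Measurable h)
    {B R : ℝ} (hR : 0 ≤ R) (hB : ∀ x, |h x| ≤ B) (h0 : ∀ x, R < ‖x‖ → h x = 0) :
    ∫⁻ θ, ∫⁻ y, ‖xray h θ y‖ₑ ^ 2 ∂volume ∂orthHaar (n + 1) =
      ENNReal.ofReal (c * ∫ z, (‖z‖ ^ n)⁻¹ * ∫ x, h x * h (x + z)) := by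
  set Q : EuclideanSpace ℝ (Fin (n + 1)) → ℝ := fun z => ∫ x, h x * h (x + z) with hQ
  have hQm : Measurable Q := measurable_integral_mul_shift hh hh
  have hQB : ∀ z, |Q z| ≤ B * B *
      volume.real (Metric.closedBall (0 : EuclideanSpace ℝ (Fin (n + 1))) R) := fun z => by
    have h1 := abs_integral_mul_le (f := fun x => h (x + z)) (fun x => hB _) hB h0
    simpa only [mul_comm (h (_ + z))] using h1
  have hQ0 : ∀ z, R + R < ‖z‖ → Q z = 0 := fun z hz => integral_mul_shift_eq_zero h0 h0 hz
  have hxm := measurable_xray hh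
  have hinner : ∀ θ, ∫⁻ y, ‖xray h θ y‖ₑ ^ 2 =
      ENNReal.ofReal (∫ u, Q (orthEquiv (n + 1) θ (consE u 0))) := by
    intro θ
    have hxθ : Measurable (xray h θ) := hxm.comp measurable_prodMk_left
    simp only [enorm_sq_eq_ofReal]
    rw [← integral_xray_sq hh hB h0 θ, ofReal_integral_eq_lintegral_ofReal]
    · refine integrable_of_bounded_of_support (hxθ.pow_const 2) (B := (B * (2 * R)) ^ 2)
        (S := Metric.closedBall 0 R) (fun y => ?_) (volume_closedBall_ne_top R) fun y hy => ?_
      · rw [abs_pow]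
        exact pow_le_pow_left₀ (abs_nonneg _) (abs_xray_le hR hB h0 θ y) 2
      · rw [xray_eq_zero h0 θ (by simpa using hy), zero_pow two_ne_zero]
    · exact Filter.Eventually.of_forall fun y => sq_nonneg _
  have hpi : Integrable (fun q : Matrix.orthogonalGroup (Fin (n + 1)) ℝ × ℝ =>
      Q (orthEquiv (n + 1) q.1 (consE q.2 0))) ((orthHaar (n + 1)).prod volume) := by
    refine integrable_of_bounded_of_support (hQm.comp (continuous_lineMap n).measurable)
      (fun _ => hQB _) (S := univ ×ˢ Icc (-(R + R)) (R + R)) ?_ fun q hq => ?_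
    · rw [Measure.prod_prod]
      exact ENNReal.mul_ne_top (measure_ne_top _ _) (by simp)
    · refine hQ0 _ ?_
      rw [LinearIsometryEquiv.norm_map, norm_consE_zero]
      by_contra hc
      exact hq ⟨trivial, abs_le.mp (not_lt.mp hc)⟩
  simp only [hinner]
  rw [← ofReal_integral_eq_lintegral_ofReal hpi.integral_prod_left
    (Filter.Eventually.of_forall fun θ => by
      have h1 : 0 ≤ ∫ y, xray h θ y ^ 2 := integral_nonneg fun y => sq_nonneg _
      rw [integral_xray_sq hh hB h0 θ] at h1
      exact h1), ← integral_prod _ hpi]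
  congr 1
  calc ∫ q, Q (orthEquiv (n + 1) q.1 (consE q.2 0)) ∂((orthHaar (n + 1)).prod volume)
      = ∫ z, Q z ∂lineMeasure n :=
        (integral_map (continuous_lineMap n).measurable.aemeasurable
          hQm.aestronglyMeasurable).symm
    _ = ∫ z, c * ((‖z‖ ^ n)⁻¹ * Q z) := by
        rw [hc, integral_withDensity_eq_integral_toReal_smul (by fun_prop)
          (Filter.Eventually.of_forall fun _ => ENNReal.ofReal_lt_top)]
        congr 1 with z
        rw [ENNReal.toReal_ofReal (by positivity), smul_eq_mul, mul_assoc]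
    _ = _ := integral_const_mul _ _

theorem integral_avgR_mul {d : ℕ} {r : ℝ} (hr : 0 < r) {f g : EuclideanSpace ℝ (Fin d) → ℝ}
    (hf : Measurable f) (hg : Measurable g) {B B' R : ℝ} (hB : ∀ x, |f x| ≤ B)
    (hB' : ∀ x, |g x| ≤ B') (h0 : ∀ x, R < ‖x‖ → g x = 0) :
    ∫ x, avgR r f x * g x = ∫ w, (∫ x, f (x + w) * g x) ∂ballAvg d r := by
  have := isProbabilityMeasure_ballAvg d hr
  rw [← integral_integral_swap]
  · congr 1 with x
    rw [avgR, integral_mul_const]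
  · refine integrable_of_bounded_of_support (B := B * B')
      ((hf.comp measurable_add).mul (hg.comp measurable_fst))
      (S := Metric.closedBall 0 R ×ˢ univ) (fun q => ?_) ?_ fun q hq => ?_
    · rw [Function.uncurry, abs_mul]
      exact mul_le_mul (hB _) (hB' _) (abs_nonneg _) ((abs_nonneg _).trans (hB 0))
    · rw [Measure.prod_prod]
      exact ENNReal.mul_ne_top (volume_closedBall_ne_top R) (measure_ne_top _ _)
    · have : R < ‖q.1‖ := by simpa using hq
      simp [Function.uncurry, h0 _ this]

theorem avgR_shift {d : ℕ} (r : ℝ) (f : EuclideanSpace ℝ (Fin d) → ℝ)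
    (x z : EuclideanSpace ℝ (Fin d)) : avgR r (fun x => f (x + z)) x = avgR r f (x + z) := by
  simp only [avgR, add_right_comm]

/-- Pointwise 2ab ≤ a² + b² together with translation invariance. It bounds correlations in supremum
by the L² norm, exactly what the kernel estimate needs. -/
theorem abs_integral_shift_mul_shift_le {d : ℕ} {f : EuclideanSpace ℝ (Fin d) → ℝ}
    (hf : Measurable f) {B R : ℝ} (hB : ∀ x, |f x| ≤ B) (h0 : ∀ x, R < ‖x‖ → f x = 0)
    (w z : EuclideanSpace ℝ (Fin d)) : |∫ x, f (x + w) * f (x + z)| ≤ ∫ x, f x ^ 2 := by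
  have hi : Integrable fun x => f x ^ 2 := by
    simpa only [pow_two] using integrable_mul_of_bounded hf hf hB hB h0
  have hw := hi.comp_add_right w
  have hz := hi.comp_add_right z
  have h1 : ∫ x, f x ^ 2 = ∫ x, (f (x + w) ^ 2 + f (x + z) ^ 2) / 2 := by
    rw [integral_div, integral_add hw hz, integral_add_right_eq_self (fun x => f x ^ 2) w,
      integral_add_right_eq_self (fun x => f x ^ 2) z]
    ring
  rw [h1, ← Real.norm_eq_abs]
  refine norm_integral_le_of_norm_le ((hw.add hz).div_const 2)
    (Filter.Eventually.of_forall fun x => ?_)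
  rw [Real.norm_eq_abs, abs_mul, ← sq_abs (f (x + w)), ← sq_abs (f (x + z))]
  nlinarith [sq_nonneg (|f (x + w)| - |f (x + z)|)]

/-! ### Smoothing by the X-ray transform in L². -/

/-- The difference of the averages over balls of radii `r / 2` and `r`. -/
def avgDiff {d : ℕ} (r : ℝ) (f : EuclideanSpace ℝ (Fin d) → ℝ) (x : EuclideanSpace ℝ (Fin d)) :
    ℝ := avgR (r / 2) f x - avgR r f x

theorem measurable_avgDiff {d : ℕ} (r : ℝ) {f : EuclideanSpace ℝ (Fin d) → ℝ}
    (hf : Measurable f) : Measurable (avgDiff r f) :=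
  (measurable_avgR _ hf).sub (measurable_avgR _ hf)

theorem abs_avgDiff_le {d : ℕ} {r : ℝ} (hr : 0 < r) {f : EuclideanSpace ℝ (Fin d) → ℝ}
    {B : ℝ} (hB : ∀ x, |f x| ≤ B) (x : EuclideanSpace ℝ (Fin d)) :
    |avgDiff r f x| ≤ 2 * B := by
  have h1 := abs_avgR_le (half_pos hr) hB x
  have h2 := abs_avgR_le hr hB x
  have h3 := abs_sub (avgR (r / 2) f x) (avgR r f x)
  unfold avgDiff
  linarith

theorem avgDiff_eq_zero {d : ℕ} {r R : ℝ} (hr : 0 < r) {f : EuclideanSpace ℝ (Fin d) → ℝ}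
    (h0 : ∀ x, R < ‖x‖ → f x = 0) {x : EuclideanSpace ℝ (Fin d)} (hx : R + r < ‖x‖) :
    avgDiff r f x = 0 := by
  rw [avgDiff, avgR_eq_zero h0 hx, avgR_eq_zero h0 (by linarith), sub_zero]

/-- The `L²` smoothing estimate for the X-ray transform. -/
theorem exists_lintegral_xray_avgDiff_sq_le {n : ℕ} (hn : 1 ≤ n) {ε : ℝ} (hε : 0 < ε)
    (hε1 : ε < 1) {R : ℝ} (hR : 0 ≤ R) : ∃ C : ℝ≥0, ∀ r : ℝ, 0 < r → r ≤ 1 →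
      ∀ (f : EuclideanSpace ℝ (Fin (n + 1)) → ℝ) (B : ℝ), Measurable f → (∀ x, |f x| ≤ B) →
      (∀ x, R < ‖x‖ → f x = 0) →
        ∫⁻ θ, ∫⁻ y, ‖xray (avgDiff r f) θ y‖ₑ ^ 2 ∂volume ∂orthHaar (n + 1) ≤
          C * ENNReal.ofReal (r ^ (1 - ε)) * ∫⁻ x, ‖f x‖ₑ ^ 2 := by
  obtain ⟨c, hc⟩ := exists_lineMeasure_eq n
  obtain ⟨K, hK, hker⟩ := exists_abs_integral_kernel_avgR_sub_le hn hε hε1 (2 * R + 2)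
  -- The 4 is the factor 2 in |P| ≤ 2S times the two averages compared with P.
  refine ⟨c * (4 * K.toNNReal), fun r hr hr1 f B hf hB h0 => ?_⟩
  set h := avgDiff r f with hh
  have hhm : Measurable h := measurable_avgDiff r hf
  have hhB : ∀ x, |h x| ≤ 2 * B := abs_avgDiff_le hr hB
  have hh0 : ∀ x, R + 1 < ‖x‖ → h x = 0 := fun x hx => avgDiff_eq_zero hr h0 (by linarith)
  rw [lintegral_xray_sq hc hhm (by linarith) hhB hh0]
  set S := ∫ x, f x ^ 2 with hS
  have hfi : Integrable fun x => f x ^ 2 := by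
    simpa only [pow_two] using integrable_mul_of_bounded hf hf hB hB h0
  have hSf : ∫⁻ x, ‖f x‖ₑ ^ 2 = ENNReal.ofReal S := by
    simp only [enorm_sq_eq_ofReal]
    rw [ofReal_integral_eq_lintegral_ofReal hfi (Filter.Eventually.of_forall fun x => sq_nonneg _)]
  -- Only one factor of the autocorrelation of h keeps its cancellation inside P; the other is
  -- replaced by f, and its averages are recovered as averages of P.
  set P : EuclideanSpace ℝ (Fin (n + 1)) → ℝ := fun z => ∫ x, h x * f (x + z) with hP
  have hPm : Measurable P := measurable_integral_mul_shift hhm hf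
  have hP0 : ∀ z, 2 * R + 2 ≤ ‖z‖ → P z = 0 := fun z hz =>
    integral_mul_shift_eq_zero hh0 h0 (by linarith)
  have hshift0 : ∀ z x : EuclideanSpace ℝ (Fin (n + 1)), R + ‖z‖ < ‖x‖ → f (x + z) = 0 :=
    fun z x hx => h0 _ (by
      have h1 := norm_sub_le (x + z) z
      rw [add_sub_cancel_right] at h1
      linarith)
  have hPs : ∀ s, 0 < s → ∀ z, |∫ x, avgR s f x * f (x + z)| ≤ S := by
    intro s hs z
    have := isProbabilityMeasure_ballAvg (n + 1) hs
    rw [integral_avgR_mul hs hf (by fun_prop : Measurable fun x => f (x + z)) hB (fun x => hB _)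
      (hshift0 z), ← Real.norm_eq_abs]
    have := norm_integral_le_of_norm_le_const (μ := ballAvg (n + 1) s)
      (f := fun w => ∫ x, f (x + w) * f (x + z)) (C := S)
      (Filter.Eventually.of_forall fun w => abs_integral_shift_mul_shift_le hf hB h0 w z)
    simpa using this
  have hPM : ∀ z, |P z| ≤ 2 * S := by
    intro z
    have h1 : P z = (∫ x, avgR (r / 2) f x * f (x + z)) - ∫ x, avgR r f x * f (x + z) := by
      have hi : ∀ s, 0 < s → Integrable fun x => avgR s f x * f (x + z) := fun s hs =>
        integrable_mul_of_bounded (measurable_avgR s hf) (by fun_prop) (abs_avgR_le hs hB)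
          (fun x => hB _) (hshift0 z)
      rw [← integral_sub (hi _ (half_pos hr)) (hi r hr)]
      simp only [hP, hh, avgDiff, sub_mul]
    rw [h1]
    have h2 := hPs (r / 2) (half_pos hr) z
    have h3 := hPs r hr z
    have h4 := abs_sub (∫ x, avgR (r / 2) f x * f (x + z)) (∫ x, avgR r f x * f (x + z))
    linarith
  have hQP : ∀ s, 0 < s → ∀ z, ∫ x, h x * avgR s f (x + z) = avgR s P z := by
    intro s hs z
    simp only [mul_comm (h _)]
    have h1 := integral_avgR_mul hs (by fun_prop : Measurable fun x => f (x + z)) hhm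
      (fun x => hB _) hhB hh0
    simp only [avgR_shift] at h1
    rw [h1, avgR]
    congr 1 with w
    simp only [hP, mul_comm (h _), ← add_assoc, add_right_comm _ z w]
  have hQ : ∀ z, ∫ x, h x * h (x + z) = avgR (r / 2) P z - avgR r P z := by
    intro z
    have hi : ∀ s, 0 < s → Integrable fun x => h x * avgR s f (x + z) := fun s hs => by
      simp only [mul_comm (h _)]
      exact integrable_mul_of_bounded ((measurable_avgR s hf).comp (measurable_add_const z)) hhm
        (fun x => abs_avgR_le hs hB _) hhB hh0
    rw [← hQP _ (half_pos hr), ← hQP r hr, ← integral_sub (hi _ (half_pos hr)) (hi r hr)]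
    simp only [hh, avgDiff, mul_sub]
  have hQi : ∀ s, 0 < s → s ≤ 1 → Integrable fun z => (‖z‖ ^ n)⁻¹ * avgR s P z := by
    intro s hs hs1
    refine integrable_inv_norm_pow_mul (measurable_avgR s hPm) (abs_avgR_le hs hPM)
      (ρ := 2 * R + 4) fun x hx => ?_
    exact avgR_eq_zero (R := 2 * R + 2) (fun z hz => hP0 z hz.le) (by linarith)
  -- Both averages of P are compared with the same integral ∫ |z|^(-n) P, which cancels in the
  -- difference.
  have hkey : ∫ z, (‖z‖ ^ n)⁻¹ * ∫ x, h x * h (x + z) ≤ 4 * K * r ^ (1 - ε) * S := by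
    simp only [hQ, mul_sub]
    rw [integral_sub (hQi _ (half_pos hr) (by linarith)) (hQi r hr hr1)]
    have h1 := abs_le.mp (hker (r / 2) (half_pos hr) (by linarith) P (2 * S) hPm hPM hP0)
    have h2 := abs_le.mp (hker r hr hr1 P (2 * S) hPm hPM hP0)
    have hS0 : 0 ≤ S := integral_nonneg fun x => sq_nonneg _
    have h3 : (r / 2) ^ (1 - ε) ≤ r ^ (1 - ε) :=
      Real.rpow_le_rpow (half_pos hr).le (by linarith) (by linarith)
    have h4 : 2 * S * (K * (r / 2) ^ (1 - ε)) ≤ 2 * S * (K * r ^ (1 - ε)) := by gcongr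
    linarith [h1.2, h2.1]
  rw [hSf]
  calc ENNReal.ofReal (c * ∫ z, (‖z‖ ^ n)⁻¹ * ∫ x, h x * h (x + z))
      ≤ ENNReal.ofReal (c * (4 * K * r ^ (1 - ε) * S)) := by gcongr
    _ = _ := by
      have h5 : 0 ≤ r ^ (1 - ε) := Real.rpow_nonneg hr.le _
      rw [ENNReal.ofReal_mul c.coe_nonneg, ENNReal.ofReal_mul (by positivity),
        ENNReal.ofReal_mul (by positivity), ENNReal.ofReal_mul (by norm_num),
        ENNReal.coe_mul, ENNReal.coe_mul, ENNReal.ofReal_ofNat, ENNReal.ofReal_coe_nnreal]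
      change _ = (c : ℝ≥0∞) * (4 * ENNReal.ofReal K) * _ * _
      ring

/-! ### Interpolation between L² and L^∞. -/

theorem lintegral_Ioo_rpow {q b : ℝ} (hq : 0 < q) (hb : 0 ≤ b) :
    ∫⁻ t in Ioo 0 b, ENNReal.ofReal (t ^ (q - 1)) = ENNReal.ofReal (b ^ q / q) := by
  have hi : IntervalIntegrable (fun t : ℝ => t ^ (q - 1)) volume 0 b :=
    intervalIntegral.intervalIntegrable_rpow' (by linarith)
  rw [Measure.restrict_congr_set Ioo_ae_eq_Ioc, ← ofReal_integral_eq_lintegral_ofReal hi.1 ?_,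
    ← intervalIntegral.integral_of_le hb, integral_rpow (Or.inl (by linarith))]
  · rw [sub_add_cancel, Real.zero_rpow hq.ne', sub_zero]
  · filter_upwards [ae_restrict_mem measurableSet_Ioc] with t ht
    exact Real.rpow_nonneg ht.1.le _

theorem measure_lt_le_of_lintegral_sq {Y : Type*} [MeasurableSpace Y] {ν : Measure Y}
    {G : Y → ℝ} (hG : Measurable G) {s : ℝ} (hs : 0 < s) :
    ν {y | s < G y} ≤ ENNReal.ofReal (s⁻¹ ^ 2) * ∫⁻ y, ENNReal.ofReal (G y ^ 2) ∂ν := by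
  have h1 : ENNReal.ofReal (s ^ 2) * ν {y | s < G y} ≤ ∫⁻ y, ENNReal.ofReal (G y ^ 2) ∂ν := by
    refine le_trans ?_ (mul_meas_ge_le_lintegral (hG.pow_const 2).ennreal_ofReal
      (ENNReal.ofReal (s ^ 2)))
    gcongr with y
    intro hy
    exact ENNReal.ofReal_le_ofReal (pow_le_pow_left₀ hs.le (le_of_lt hy) 2)
  calc ν {y | s < G y} = ENNReal.ofReal (s⁻¹ ^ 2) * (ENNReal.ofReal (s ^ 2) * ν {y | s < G y}) := by
        rw [← mul_assoc, ← ENNReal.ofReal_mul (by positivity), ← mul_pow,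
          inv_mul_cancel₀ hs.ne', one_pow, ENNReal.ofReal_one, one_mul]
    _ ≤ _ := by gcongr

/-- A version of the Marcinkiewicz interpolation theorem, between `L²` and `L^∞`. -/
theorem lintegral_rpow_le_of_truncation {X Y : Type*} [MeasurableSpace X] [MeasurableSpace Y]
    {μ : Measure X} [SFinite μ] {ν : Measure Y} {p A : ℝ} (hp : 2 < p) (hA : 0 < A) {K : ℝ≥0∞}
    (hK : K ≠ ∞) {f : X → ℝ} (hf : Measurable f) (hf0 : ∀ x, 0 ≤ f x) {G : Y → ℝ}
    (hG : Measurable G) (hG0 : ∀ y, 0 ≤ G y)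
    (h : ∀ l : ℝ, 0 < l → ∃ G' : Y → ℝ, Measurable G' ∧ (∀ y, G y ≤ A * l + G' y) ∧
      ∫⁻ y, ENNReal.ofReal (G' y ^ 2) ∂ν ≤
        K * ∫⁻ x, {x | l < f x}.indicator (fun x => ENNReal.ofReal (f x ^ 2)) x ∂μ) :
    ∫⁻ y, ENNReal.ofReal (G y ^ p) ∂ν ≤
      ENNReal.ofReal (p * (4 * ((2 * A) ^ (p - 2) / (p - 2)))) * K *
        ∫⁻ x, ENNReal.ofReal (f x ^ p) ∂μ := by
  have hp2 : 0 < p - 2 := by linarith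
  rw [lintegral_rpow_eq_lintegral_meas_lt_mul ν (Filter.Eventually.of_forall hG0) hG.aemeasurable
    (by linarith)]
  have hDm : MeasurableSet {q : ℝ × X | q.1 / (2 * A) < f q.2} :=
    measurableSet_lt (by fun_prop) (hf.comp measurable_snd)
  set W : ℝ → X → ℝ≥0∞ := fun t x => {x | t / (2 * A) < f x}.indicator
    (fun x => ENNReal.ofReal (f x ^ 2)) x with hW
  have hWm : Measurable (Function.uncurry W) := by
    have : Function.uncurry W = {q : ℝ × X | q.1 / (2 * A) < f q.2}.indicator
        (fun q => ENNReal.ofReal (f q.2 ^ 2)) := rfl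
    rw [this]
    exact (((hf.comp measurable_snd).pow_const 2).ennreal_ofReal).indicator hDm
  have hlevel : ∀ t ∈ Ioi (0 : ℝ), ν {y | t < G y} * ENNReal.ofReal (t ^ (p - 1)) ≤
      4 * K * ∫⁻ x, ENNReal.ofReal (t ^ (p - 2 - 1)) * W t x ∂μ := by
    intro t ht
    have ht : 0 < t := ht
    -- At height l = t / (2A) the bounded part contributes at most t / 2, so G > t forces G' > t /
    -- 2, to which Chebyshev applies.
    obtain ⟨G', hG', hle, hint⟩ := h (t / (2 * A)) (by positivity)
    have hsub : {y | t < G y} ⊆ {y | t / 2 < G' y} := fun y hy => by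
      have h1 : t < G y := hy
      have h2 := hle y
      have h3 : A * (t / (2 * A)) = t / 2 := by field_simp
      change t / 2 < G' y
      linarith
    have hcheb := (measure_mono hsub).trans (measure_lt_le_of_lintegral_sq (ν := ν) hG'
      (half_pos ht))
    have hWt : Measurable (W t) := hWm.comp measurable_prodMk_left
    have hpow : ENNReal.ofReal ((t / 2)⁻¹ ^ 2) * ENNReal.ofReal (t ^ (p - 1)) =
        4 * ENNReal.ofReal (t ^ (p - 2 - 1)) := by
      rw [← ENNReal.ofReal_mul (by positivity), ← ENNReal.ofReal_ofNat 4,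
        ← ENNReal.ofReal_mul (by norm_num)]
      congr 1
      rw [show p - 2 - 1 = (p - 1) - 2 by ring, Real.rpow_sub ht (p - 1), Real.rpow_two]
      field_simp
      norm_num
    calc ν {y | t < G y} * ENNReal.ofReal (t ^ (p - 1))
        ≤ ENNReal.ofReal ((t / 2)⁻¹ ^ 2) * (K * ∫⁻ x, W t x ∂μ) *
          ENNReal.ofReal (t ^ (p - 1)) := by
          gcongr
          refine hcheb.trans ?_
          gcongr
      _ = (ENNReal.ofReal ((t / 2)⁻¹ ^ 2) * ENNReal.ofReal (t ^ (p - 1))) * K *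
          ∫⁻ x, W t x ∂μ := by ring
      _ = 4 * K * (ENNReal.ofReal (t ^ (p - 2 - 1)) * ∫⁻ x, W t x ∂μ) := by rw [hpow]; ring
      _ = _ := by rw [lintegral_const_mul _ hWt]
  -- For fixed x the truncation restricts t to (0, 2A f(x)), where t^(p-3) is integrable because p >
  -- 2; its integral supplies the missing power f(x)^(p-2).
  have hswap : ∫⁻ t in Ioi (0 : ℝ), ∫⁻ x, ENNReal.ofReal (t ^ (p - 2 - 1)) * W t x ∂μ =
      ENNReal.ofReal ((2 * A) ^ (p - 2) / (p - 2)) * ∫⁻ x, ENNReal.ofReal (f x ^ p) ∂μ := by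
    rw [lintegral_lintegral_swap]
    · rw [← lintegral_const_mul' _ _ ENNReal.ofReal_ne_top]
      congr 1 with x
      have h1 : ∀ t ∈ Ioi (0 : ℝ), ENNReal.ofReal (t ^ (p - 2 - 1)) * W t x =
          (Ioo 0 (2 * A * f x)).indicator (fun t => ENNReal.ofReal (t ^ (p - 2 - 1))) t *
            ENNReal.ofReal (f x ^ 2) := by
        intro t ht
        by_cases hx : t / (2 * A) < f x
        · have h2 : t ∈ Ioo 0 (2 * A * f x) := ⟨ht, by
            rw [div_lt_iff₀ (by positivity)] at hx; linarith⟩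
          rw [indicator_of_mem h2, hW]
          simp [hx]
        · have h2 : t ∉ Ioo 0 (2 * A * f x) := fun h3 => hx (by
            rw [div_lt_iff₀ (by positivity)]; linarith [h3.2])
          rw [indicator_of_notMem h2, hW]
          simp [hx]
      rw [setLIntegral_congr_fun measurableSet_Ioi h1, lintegral_mul_const' _ _
        ENNReal.ofReal_ne_top, setLIntegral_indicator measurableSet_Ioo,
        (inter_eq_left.mpr fun t ht => ht.1 : Ioo 0 (2 * A * f x) ∩ Ioi 0 = Ioo 0 (2 * A * f x)),
        lintegral_Ioo_rpow hp2 (mul_nonneg (by positivity) (hf0 x)),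
        ← ENNReal.ofReal_mul (by have := hf0 x; positivity),
        ← ENNReal.ofReal_mul (by positivity)]
      congr 1
      rw [Real.mul_rpow (by positivity) (hf0 x)]
      have h3 : f x ^ p = f x ^ (p - 2) * f x ^ 2 := by
        rcases (hf0 x).eq_or_lt with h0 | h0
        · rw [← h0, Real.zero_rpow (by linarith), zero_pow two_ne_zero, mul_zero]
        · rw [← Real.rpow_two, ← Real.rpow_add h0, sub_add_cancel]
      rw [h3]
      ring
    · refine Measurable.aemeasurable ?_
      exact Measurable.mul (by fun_prop) hWm
  calc ENNReal.ofReal p * ∫⁻ t in Ioi 0, ν {y | t < G y} * ENNReal.ofReal (t ^ (p - 1))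
      ≤ ENNReal.ofReal p * ∫⁻ t in Ioi (0 : ℝ),
          4 * K * ∫⁻ x, ENNReal.ofReal (t ^ (p - 2 - 1)) * W t x ∂μ := by
        exact mul_le_mul_right (setLIntegral_mono' measurableSet_Ioi hlevel) _
    _ = _ := by
        rw [lintegral_const_mul' _ _ (ENNReal.mul_ne_top (by simp) hK), hswap,
          ENNReal.ofReal_mul (by linarith), ENNReal.ofReal_mul (by norm_num), ENNReal.ofReal_ofNat]
        ring

theorem avgDiff_add {d : ℕ} {r : ℝ} (hr : 0 < r) {f g : EuclideanSpace ℝ (Fin d) → ℝ}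
    (hf : Measurable f) (hg : Measurable g) {B B' : ℝ} (hB : ∀ x, |f x| ≤ B)
    (hB' : ∀ x, |g x| ≤ B') (x : EuclideanSpace ℝ (Fin d)) :
    avgDiff r (fun x => f x + g x) x = avgDiff r f x + avgDiff r g x := by
  have h : ∀ s, 0 < s → avgR s (fun x => f x + g x) x = avgR s f x + avgR s g x := fun s hs =>
    integral_add (integrable_ballAvg_add hs hf hB x) (integrable_ballAvg_add hs hg hB' x)
  rw [avgDiff, h r hr, h _ (half_pos hr), avgDiff, avgDiff]
  ring

theorem xray_add {n : ℕ} {f g : EuclideanSpace ℝ (Fin (n + 1)) → ℝ}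
    (hf : Measurable f) (hg : Measurable g) {B B' R : ℝ} (hB : ∀ x, |f x| ≤ B)
    (hB' : ∀ x, |g x| ≤ B') (h0 : ∀ x, R < ‖x‖ → f x = 0) (h0' : ∀ x, R < ‖x‖ → g x = 0)
    (θ : Matrix.orthogonalGroup (Fin (n + 1)) ℝ) (y : EuclideanSpace ℝ (Fin n)) :
    xray (fun x => f x + g x) θ y = xray f θ y + xray g θ y :=
  integral_add (integrable_line hf hB h0 θ y) (integrable_line hg hB' h0' θ y)

theorem lintegral_orthHaar_prod {n : ℕ} {F : Matrix.orthogonalGroup (Fin (n + 1)) ℝ ×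
    EuclideanSpace ℝ (Fin n) → ℝ≥0∞} (hF : Measurable F) :
    ∫⁻ θ, ∫⁻ y, F (θ, y) ∂volume ∂orthHaar (n + 1) = ∫⁻ q, F q ∂(orthHaar (n + 1)).prod volume :=
  (lintegral_prod F hF.aemeasurable).symm

/-- The `Lᵖ` smoothing estimate for the X-ray transform, `2 ≤ p < ∞`. -/
theorem exists_lintegral_xray_avgDiff_rpow_le {n : ℕ} (hn : 1 ≤ n) {p : ℝ} (hp : 2 ≤ p) {ε : ℝ}
    (hε : 0 < ε) (hε1 : ε < 1) {R : ℝ} (hR : 0 ≤ R) : ∃ C : ℝ≥0, ∀ r : ℝ, 0 < r → r ≤ 1 →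
      ∀ (f : EuclideanSpace ℝ (Fin (n + 1)) → ℝ) (B : ℝ), Measurable f → (∀ x, 0 ≤ f x) →
      (∀ x, f x ≤ B) → (∀ x, R < ‖x‖ → f x = 0) →
        ∫⁻ θ, ∫⁻ y, ‖xray (avgDiff r f) θ y‖ₑ ^ p ∂volume ∂orthHaar (n + 1) ≤
          C * ENNReal.ofReal (r ^ (1 - ε)) * ∫⁻ x, ‖f x‖ₑ ^ p := by
  obtain ⟨C, hC⟩ := exists_lintegral_xray_avgDiff_sq_le hn hε hε1 hR
  rcases hp.eq_or_lt with rfl | hp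
  · refine ⟨C, fun r hr hr1 f B hf hf0 hfB h0 => ?_⟩
    simpa only [ENNReal.rpow_two] using hC r hr hr1 f B hf
      (fun x => (abs_of_nonneg (hf0 x)).trans_le (hfB x)) h0
  -- A difference of two averages at most doubles the supremum, and a line meets the ball of radius
  -- R + 1 in length at most 2 (R + 1).
  set A : ℝ := 2 * (2 * (R + 1)) with hA
  refine ⟨(p * (4 * ((2 * A) ^ (p - 2) / (p - 2)))).toNNReal * C,
    fun r hr hr1 f B hf hf0 hfB h0 => ?_⟩
  have hfB' : ∀ x, |f x| ≤ B := fun x => (abs_of_nonneg (hf0 x)).trans_le (hfB x)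
  have hB0 : 0 ≤ B := (hf0 0).trans (hfB 0)
  have hxm : ∀ g : EuclideanSpace ℝ (Fin (n + 1)) → ℝ, Measurable g →
      Measurable fun q : Matrix.orthogonalGroup (Fin (n + 1)) ℝ × EuclideanSpace ℝ (Fin n) =>
        |xray (avgDiff r g) q.1 q.2| := fun g hg =>
    (measurable_xray (measurable_avgDiff r hg)).abs
  have henorm : ∀ x : ℝ, ‖x‖ₑ ^ p = ENNReal.ofReal (|x| ^ p) := fun x => by
    rw [Real.enorm_eq_ofReal_abs, ENNReal.ofReal_rpow_of_nonneg (abs_nonneg _) (by linarith)]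
  have hfp : ∫⁻ x, ‖f x‖ₑ ^ p = ∫⁻ x, ENNReal.ofReal (f x ^ p) := by
    congr 1 with x
    rw [henorm, abs_of_nonneg (hf0 x)]
  rw [lintegral_orthHaar_prod (F := fun q => ‖xray (avgDiff r f) q.1 q.2‖ₑ ^ p)
    ((measurable_xray (measurable_avgDiff r hf)).enorm.pow_const p), hfp]
  simp only [henorm]
  refine (lintegral_rpow_le_of_truncation (μ := volume) (A := A)
    (K := C * ENNReal.ofReal (r ^ (1 - ε))) hp (by positivity) (by finiteness) hf hf0
    (hxm f hf) (fun _ => abs_nonneg _) fun l hl => ?_).trans (le_of_eq ?_)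
  · set f₁ := {x | f x ≤ l}.indicator f with hf₁
    set f₂ := {x | l < f x}.indicator f with hf₂
    have hm₁ : Measurable f₁ := hf.indicator (measurableSet_le hf measurable_const)
    have hm₂ : Measurable f₂ := hf.indicator (measurableSet_lt measurable_const hf)
    have hB₁ : ∀ x, |f₁ x| ≤ l := fun x => by
      by_cases hx : f x ≤ l <;> simp [hf₁, hx, abs_of_nonneg (hf0 x), hl.le]
    have hB₂ : ∀ x, |f₂ x| ≤ B := fun x => by
      by_cases hx : l < f x <;> simp [hf₂, hx, hfB' x, hB0]
    have h0₁ : ∀ x, R < ‖x‖ → f₁ x = 0 := fun x hx => by simp [hf₁, indicator, h0 x hx]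
    have h0₂ : ∀ x, R < ‖x‖ → f₂ x = 0 := fun x hx => by simp [hf₂, indicator, h0 x hx]
    have hsum : f = fun x => f₁ x + f₂ x := by
      funext x
      by_cases hx : f x ≤ l
      · simp [hf₁, hf₂, hx, not_lt.mpr hx]
      · simp [hf₁, hf₂, hx, not_le.mp hx]
    have hd₁ : ∀ x, R + 1 < ‖x‖ → avgDiff r f₁ x = 0 := fun x hx =>
      avgDiff_eq_zero hr h0₁ (by linarith)
    have hd₂ : ∀ x, R + 1 < ‖x‖ → avgDiff r f₂ x = 0 := fun x hx =>
      avgDiff_eq_zero hr h0₂ (by linarith)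
    refine ⟨_, hxm f₂ hm₂, fun q => ?_, ?_⟩
    · have h1 : avgDiff r f = fun x => avgDiff r f₁ x + avgDiff r f₂ x := by
        funext x
        conv_lhs => rw [hsum]
        exact avgDiff_add hr hm₁ hm₂ hB₁ hB₂ x
      rw [h1, xray_add (measurable_avgDiff r hm₁) (measurable_avgDiff r hm₂)
        (abs_avgDiff_le hr hB₁) (abs_avgDiff_le hr hB₂) hd₁ hd₂]
      refine (abs_add_le _ _).trans ?_
      gcongr
      refine (abs_xray_le (by linarith) (abs_avgDiff_le hr hB₁) hd₁ q.1 q.2).trans (le_of_eq ?_)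
      rw [hA]; ring
    · have h1 := hC r hr hr1 f₂ B hm₂ hB₂ h0₂
      rw [lintegral_orthHaar_prod (F := fun q => ‖xray (avgDiff r f₂) q.1 q.2‖ₑ ^ 2)
        ((measurable_xray (measurable_avgDiff r hm₂)).enorm.pow_const 2)] at h1
      simp only [enorm_sq_eq_ofReal] at h1
      simp only [sq_abs]
      refine h1.trans (le_of_eq ?_)
      congr 2 with x
      by_cases hx : l < f x <;> simp [hf₂, hx]
  · rw [ENNReal.coe_mul]
    change _ = ENNReal.ofReal _ * (C : ℝ≥0∞) * _ * _
    ring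

/-! ### Dyadic decomposition of plane integrals. -/

/-- The radii `2⁻ʲ / 8`. -/
def dyadicRadius (j : ℕ) : ℝ := (1 / 2) ^ j / 8

theorem dyadicRadius_pos (j : ℕ) : 0 < dyadicRadius j := by unfold dyadicRadius; positivity

theorem dyadicRadius_le_one (j : ℕ) : dyadicRadius j ≤ 1 := by
  have : (1 / 2 : ℝ) ^ j ≤ 1 := pow_le_one₀ (by norm_num) (by norm_num)
  unfold dyadicRadius; linarith

theorem dyadicRadius_succ (j : ℕ) : dyadicRadius (j + 1) = dyadicRadius j / 2 := by
  unfold dyadicRadius; ring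

theorem avgR_comm {d : ℕ} {r s : ℝ} (hr : 0 < r) (hs : 0 < s) {f : EuclideanSpace ℝ (Fin d) → ℝ}
    (hf : Measurable f) {B : ℝ} (hB : ∀ x, |f x| ≤ B) (x : EuclideanSpace ℝ (Fin d)) :
    avgR r (avgR s f) x = avgR s (avgR r f) x := by
  have := isProbabilityMeasure_ballAvg d hr
  have := isProbabilityMeasure_ballAvg d hs
  have hi : Integrable (fun q : EuclideanSpace ℝ (Fin d) × EuclideanSpace ℝ (Fin d) =>
      f (x + q.1 + q.2)) ((ballAvg d r).prod (ballAvg d s)) :=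
    integrable_of_bounded_of_support (by fun_prop) (fun _ => hB _) (S := univ)
      (measure_ne_top _ _) (by simp)
  have h := integral_integral_swap (f := fun z w => f (x + z + w)) hi
  calc avgR r (avgR s f) x = ∫ z, (∫ w, f (x + z + w) ∂ballAvg d s) ∂ballAvg d r := rfl
    _ = ∫ w, (∫ z, f (x + z + w) ∂ballAvg d r) ∂ballAvg d s := h
    _ = _ := by simp only [avgR, add_right_comm x]

theorem avgR_sub {d : ℕ} {r : ℝ} (hr : 0 < r) {f g : EuclideanSpace ℝ (Fin d) → ℝ}
    (hf : Measurable f) (hg : Measurable g) {B B' : ℝ} (hB : ∀ x, |f x| ≤ B)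
    (hB' : ∀ x, |g x| ≤ B') (x : EuclideanSpace ℝ (Fin d)) :
    avgR r (fun x => f x - g x) x = avgR r f x - avgR r g x :=
  integral_sub (integrable_ballAvg_add hr hf hB x) (integrable_ballAvg_add hr hg hB' x)

/-- A difference of squares of commuting operators. Iterated averages are used, rather than single
ones, so that each increment retains an outer average. -/
theorem avgR_avgR_half_sub {d : ℕ} {r : ℝ} (hr : 0 < r) {f : EuclideanSpace ℝ (Fin d) → ℝ}
    (hf : Measurable f) {B : ℝ} (hB : ∀ x, |f x| ≤ B) (x : EuclideanSpace ℝ (Fin d)) :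
    avgR (r / 2) (avgR (r / 2) f) x = avgR r (avgR r f) x +
      (avgR (r / 2) (avgDiff r f) x + avgR r (avgDiff r f) x) := by
  have hs := half_pos hr
  have h : ∀ t, 0 < t → avgR t (avgDiff r f) x = avgR t (avgR (r / 2) f) x - avgR t (avgR r f) x :=
    fun t ht => avgR_sub ht (measurable_avgR _ hf) (measurable_avgR _ hf) (abs_avgR_le hs hB)
      (abs_avgR_le hr hB) x
  rw [h _ hs, h r hr, avgR_comm hr hs hf hB]
  ring

theorem avgR_orthEquiv {d : ℕ} (r : ℝ) (f : EuclideanSpace ℝ (Fin d) → ℝ)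
    (θ : Matrix.orthogonalGroup (Fin d) ℝ) (x : EuclideanSpace ℝ (Fin d)) :
    avgR r f (orthEquiv d θ x) = ∫ w, f (orthEquiv d θ (x + w)) ∂ballAvg d r := by
  rw [avgR]
  conv_lhs => rw [← map_orthEquiv_ballAvg r θ]
  have he : MeasurableEmbedding (orthEquiv d θ) :=
    (orthEquiv d θ).toHomeomorph.measurableEmbedding
  rw [he.integral_map]
  simp only [map_add]

/-- Ball averages commute with rotations, and the component of the shift along the line disappears
in the line integral. Only the projected shift acts on the X-ray transform. -/
theorem xray_avgR {n : ℕ} {r : ℝ} (hr : 0 < r) {h : EuclideanSpace ℝ (Fin (n + 1)) → ℝ}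
    (hh : Measurable h) {B R : ℝ} (hB : ∀ x, |h x| ≤ B) (h0 : ∀ x, R < ‖x‖ → h x = 0)
    (θ : Matrix.orthogonalGroup (Fin (n + 1)) ℝ) (y : EuclideanSpace ℝ (Fin n)) :
    xray (avgR r h) θ y = ∫ w, xray h θ (y + tailE w) ∂ballAvg (n + 1) r := by
  have := isProbabilityMeasure_ballAvg (n + 1) hr
  have hcons : ∀ (t : ℝ) (w : EuclideanSpace ℝ (Fin (n + 1))),
      consE t y + w = consE (t + w 0) (y + tailE w) := fun t w => by
    rw [consE_add, consE_tailE]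
  have hc : Continuous fun q : ℝ × EuclideanSpace ℝ (Fin (n + 1)) =>
      orthEquiv (n + 1) θ (consE q.1 y + q.2) :=
    continuous_const.orthEquiv ((continuous_fst.consE continuous_const).add continuous_snd)
  have hi : Integrable (fun q : ℝ × EuclideanSpace ℝ (Fin (n + 1)) =>
      h (orthEquiv (n + 1) θ (consE q.1 y + q.2))) (volume.prod (ballAvg (n + 1) r)) := by
    have h1 : Integrable (fun q : ℝ × EuclideanSpace ℝ (Fin (n + 1)) =>
        (Icc (-(R + r)) (R + r)).indicator (fun _ => B) q.1)
        (volume.prod (ballAvg (n + 1) r)) := by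
      refine Integrable.comp_fst (f := (Icc (-(R + r)) (R + r)).indicator (fun _ => B)) ?_ _
      exact (integrable_indicator_iff measurableSet_Icc).mpr
        (integrableOn_const (by simp) (by simp))
    refine Integrable.mono' h1 (hh.comp hc.measurable).aestronglyMeasurable ?_
    have hae : ∀ᵐ q ∂((volume : Measure ℝ).prod (ballAvg (n + 1) r)), ‖q.2‖ < r :=
      Measure.quasiMeasurePreserving_snd.ae (ae_ballAvg (n + 1) r)
    filter_upwards [hae] with q hq
    by_cases ht : q.1 ∈ Icc (-(R + r)) (R + r)
    · rw [indicator_of_mem ht]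
      exact hB _
    · rw [indicator_of_notMem ht, h0, norm_zero]
      rw [LinearIsometryEquiv.norm_map]
      have h3 : R + r < |q.1| := not_le.mp fun hc => ht (abs_le.mp hc)
      have h4 := abs_le_norm_consE q.1 y
      have h5 := norm_sub_le (consE q.1 y + q.2) q.2
      rw [add_sub_cancel_right] at h5
      linarith
  calc xray (avgR r h) θ y
      = ∫ t, ∫ w, h (orthEquiv (n + 1) θ (consE t y + w)) ∂ballAvg (n + 1) r := by
        simp only [xray, avgR_orthEquiv]
    _ = ∫ w, (∫ t, h (orthEquiv (n + 1) θ (consE t y + w))) ∂ballAvg (n + 1) r :=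
        integral_integral_swap hi
    _ = _ := by
        congr 1 with w
        simp only [hcons]
        exact integral_add_right_eq_self
          (fun t => h (orthEquiv (n + 1) θ (consE t (y + tailE w)))) (w 0)

theorem enorm_xray_avgR_le {n : ℕ} {C : ℝ≥0} (hC : ∀ r : ℝ, 0 < r →
    ∀ F : EuclideanSpace ℝ (Fin n) → ℝ≥0∞, Measurable F →
      ∫⁻ w, F (tailE w) ∂ballAvg (n + 1) r ≤ C * ∫⁻ v, F v ∂ballAvg n r)
    {r : ℝ} (hr : 0 < r) {h : EuclideanSpace ℝ (Fin (n + 1)) → ℝ}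
    (hh : Measurable h) {B R : ℝ} (hB : ∀ x, |h x| ≤ B) (h0 : ∀ x, R < ‖x‖ → h x = 0)
    (θ : Matrix.orthogonalGroup (Fin (n + 1)) ℝ) (y : EuclideanSpace ℝ (Fin n)) :
    ‖xray (avgR r h) θ y‖ₑ ≤ C * avgE r (fun y => ‖xray h θ y‖ₑ) y := by
  rw [xray_avgR hr hh hB h0]
  refine (enorm_integral_le_lintegral_enorm _).trans ?_
  have hm : Measurable (xray h θ) := (measurable_xray hh).comp measurable_prodMk_left
  exact hC r hr (fun v => ‖xray h θ (y + v)‖ₑ) (by fun_prop)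

theorem avgE_ofReal {d : ℕ} {r : ℝ} (hr : 0 < r) {f : EuclideanSpace ℝ (Fin d) → ℝ}
    (hf : Measurable f) (hf0 : ∀ x, 0 ≤ f x) {B : ℝ} (hB : ∀ x, |f x| ≤ B) :
    avgE r (fun x => ENNReal.ofReal (f x)) = fun x => ENNReal.ofReal (avgR r f x) := by
  funext x
  rw [avgR, ofReal_integral_eq_lintegral_ofReal (integrable_ballAvg_add hr hf hB x)
    (Filter.Eventually.of_forall fun _ => hf0 _)]
  rfl

theorem avgR_nonneg {d : ℕ} (r : ℝ) {f : EuclideanSpace ℝ (Fin d) → ℝ}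
    (hf0 : ∀ x, 0 ≤ f x) (x : EuclideanSpace ℝ (Fin d)) : 0 ≤ avgR r f x :=
  integral_nonneg fun _ => hf0 _

/-- Integrals over planes in terms of the X-ray transform. -/
theorem planeMax_ofReal_mul_stabE_le {m n : ℕ} (h : m ≤ n) {u : EuclideanSpace ℝ (Fin (n + 1)) → ℝ}
    (hu : Measurable u) (hu0 : ∀ x, 0 ≤ u x) {B R : ℝ} (hB : ∀ x, |u x| ≤ B)
    (h0 : ∀ x, R < ‖x‖ → u x = 0) (θ : Matrix.orthogonalGroup (Fin (n + 1)) ℝ)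
    (σ : Matrix.orthogonalGroup (Fin n) ℝ) {K : ℝ≥0∞}
    (hK : ∀ a, ∫⁻ z, ENNReal.ofReal (xray u θ (a + planeE h σ z)) ≤ K) :
    planeMax (fun x => ENNReal.ofReal (u x))
      (Gr.rotate (θ * stabE σ) (Gr.coord (Nat.succ_le_succ h))) ≤ K := by
  rw [planeMax_rotate]
  refine iSup_le fun x => ?_
  obtain ⟨x', rfl⟩ := (orthEquiv (n + 1) θ).surjective x
  have hι := (planeE (Nat.succ_le_succ h) (θ * stabE σ)).continuous
  rw [lintegral_consE (by fun_prop)]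
  refine le_trans (le_of_eq ?_) (hK (tailE x'))
  congr 1 with z
  rw [xray, ofReal_integral_eq_lintegral_ofReal (integrable_line hu hB h0 θ _)
    (Filter.Eventually.of_forall fun _ => hu0 _),
    ← lintegral_add_left_eq_self (μ := (volume : Measure ℝ))
      (fun t => ENNReal.ofReal (u (orthEquiv (n + 1) θ (consE t _)))) (x' 0)]
  congr 1 with t
  rw [planeE_mul_stabE, ← map_add, consE_add, consE_tailE]

/-- The iterated averages telescope. Each increment carries an average at scale r_j, so its m-plane
integral is bounded by a plate average of `xray (avgDiff (dyadicRadius j) f) θ`; the term at the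
fixed coarsest scale costs only the L¹ norm. -/
theorem exists_planeMax_avgE_le {m n : ℕ} (h : m ≤ n) {R : ℝ} (hR : 0 ≤ R) : ∃ C : ℝ≥0,
    ∀ (f : EuclideanSpace ℝ (Fin (n + 1)) → ℝ) (B : ℝ), Measurable f → (∀ x, 0 ≤ f x) →
      (∀ x, f x ≤ B) → (∀ x, R < ‖x‖ → f x = 0) →
      ∀ (J : ℕ) (θ : Matrix.orthogonalGroup (Fin (n + 1)) ℝ)
        (σ : Matrix.orthogonalGroup (Fin n) ℝ),
        planeMax (avgE (dyadicRadius J) (avgE (dyadicRadius J) fun x => ENNReal.ofReal (f x)))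
          (Gr.rotate (θ * stabE σ) (Gr.coord (Nat.succ_le_succ h))) ≤
        C * ((∫⁻ x, ENNReal.ofReal (f x)) + ∑ j ∈ Finset.range J,
          plateMax (dyadicRadius j) (fun y => ‖xray (avgDiff (dyadicRadius j) f) θ y‖ₑ)
            (Gr.rotate σ (Gr.coord h))) := by
  obtain ⟨C₁, hC₁⟩ := exists_lintegral_tailE_le n
  obtain ⟨C₂, hC₂⟩ := exists_lintegral_plane_le h (R + 1)
  set V := volume.real (Metric.ball (0 : EuclideanSpace ℝ (Fin (n + 1))) (dyadicRadius 0)) with hV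
  have hV0 : 0 < V := ENNReal.toReal_pos (volume_ball_ne_zero _ (dyadicRadius_pos 0))
    (volume_ball_ne_top _ _)
  set D₀ : ℝ≥0∞ := ENNReal.ofReal (V⁻¹ * (2 * (R + 2))) *
    (2 ^ m * volume (Metric.ball (0 : EuclideanSpace ℝ (Fin m)) (R + 3))) with hD₀
  have hD₀t : D₀ ≠ ∞ := ENNReal.mul_ne_top (by simp)
    (ENNReal.mul_ne_top (by simp) (volume_ball_ne_top _ _))
  refine ⟨D₀.toNNReal + C₁ * (2 ^ n + 1) * C₂, fun f B hf hf0 hfB h0 J θ σ => ?_⟩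
  have hB : ∀ x, |f x| ≤ B := fun x => (abs_of_nonneg (hf0 x)).trans_le (hfB x)
  set u : ℕ → EuclideanSpace ℝ (Fin (n + 1)) → ℝ := fun j =>
    avgR (dyadicRadius j) (avgR (dyadicRadius j) f) with hu
  set v : ℕ → EuclideanSpace ℝ (Fin (n + 1)) → ℝ := fun j =>
    avgDiff (dyadicRadius j) f with hv
  have hr := dyadicRadius_pos
  have hr1 := dyadicRadius_le_one
  have haB : ∀ j x, |avgR (dyadicRadius j) f x| ≤ B := fun j => abs_avgR_le (hr j) hB
  have ham : ∀ j, Measurable (avgR (dyadicRadius j) f) := fun j => measurable_avgR _ hf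
  have ha0 : ∀ j x, R + 1 < ‖x‖ → avgR (dyadicRadius j) f x = 0 := fun j x hx =>
    avgR_eq_zero h0 (by linarith [hr1 j])
  have hum : ∀ j, Measurable (u j) := fun j => measurable_avgR _ (ham j)
  have huB : ∀ j x, |u j x| ≤ B := fun j => abs_avgR_le (hr j) (haB j)
  have hunn : ∀ j x, 0 ≤ u j x := fun j => avgR_nonneg _ (avgR_nonneg _ hf0)
  have hu0 : ∀ j x, R + 2 < ‖x‖ → u j x = 0 := fun j x hx =>
    avgR_eq_zero (ha0 j) (by linarith [hr1 j])
  have hvm : ∀ j, Measurable (v j) := fun j => measurable_avgDiff _ hf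
  have hvB : ∀ j x, |v j x| ≤ 2 * B := fun j => abs_avgDiff_le (hr j) hB
  have hv0 : ∀ j x, R + 1 < ‖x‖ → v j x = 0 := fun j x hx =>
    avgDiff_eq_zero (hr j) h0 (by linarith [hr1 j])
  have hE : avgE (dyadicRadius J) (avgE (dyadicRadius J) fun x => ENNReal.ofReal (f x)) =
      fun x => ENNReal.ofReal (u J x) := by
    rw [avgE_ofReal (hr J) hf hf0 hB, avgE_ofReal (hr J) (ham J) (avgR_nonneg _ hf0) (haB J)]
  rw [hE]
  refine planeMax_ofReal_mul_stabE_le h (hum J) (hunn J) (huB J) (hu0 J) θ σ fun a => ?_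
  set G : ℕ → EuclideanSpace ℝ (Fin n) → ℝ≥0∞ := fun j y => ‖xray (v j) θ y‖ₑ with hG
  have hxm : ∀ g : EuclideanSpace ℝ (Fin (n + 1)) → ℝ, Measurable g → Measurable (xray g θ) :=
    fun g hg => (measurable_xray hg).comp measurable_prodMk_left
  have hGm : ∀ j, Measurable (G j) := fun j => (hxm _ (hvm j)).enorm
  have hG0 : ∀ j y, R + 1 < ‖y‖ → G j y = 0 := fun j y hy => by
    simp only [hG, xray_eq_zero (hv0 j) θ hy, enorm_zero]
  -- The constant 2^n + 1 collects the averages at radii r_{j+1} and r_j, the former bounded by 2^n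
  -- times the latter.
  have hstep : ∀ j y, ENNReal.ofReal (xray (u (j + 1)) θ y) ≤ ENNReal.ofReal (xray (u j) θ y) +
      C₁ * (2 ^ n + 1) * avgE (dyadicRadius j) (G j) y := by
    intro j y
    have e : u (j + 1) = fun x => u j x + (avgR (dyadicRadius (j + 1)) (v j) x +
        avgR (dyadicRadius j) (v j) x) := by
      funext x
      simp only [hu, hv, dyadicRadius_succ]
      exact avgR_avgR_half_sub (hr j) hf hB x
    have hm1 : ∀ i, Measurable (avgR (dyadicRadius i) (v j)) := fun i => measurable_avgR _ (hvm j)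
    have hB1 : ∀ i x, |avgR (dyadicRadius i) (v j) x| ≤ 2 * B := fun i =>
      abs_avgR_le (hr i) (hvB j)
    have h01 : ∀ i x, R + 2 < ‖x‖ → avgR (dyadicRadius i) (v j) x = 0 := fun i x hx =>
      avgR_eq_zero (hv0 j) (by linarith [hr1 i])
    have hx1 : xray (u (j + 1)) θ y = xray (u j) θ y + (xray (avgR (dyadicRadius (j + 1)) (v j)) θ y +
        xray (avgR (dyadicRadius j) (v j)) θ y) := by
      have hms : Measurable fun x => avgR (dyadicRadius (j + 1)) (v j) x +
          avgR (dyadicRadius j) (v j) x := (hm1 _).add (hm1 _)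
      have hBs : ∀ x, |avgR (dyadicRadius (j + 1)) (v j) x + avgR (dyadicRadius j) (v j) x| ≤
          2 * B + 2 * B := fun x => (abs_add_le _ _).trans (add_le_add (hB1 _ x) (hB1 _ x))
      have h0s : ∀ x, R + 2 < ‖x‖ →
          avgR (dyadicRadius (j + 1)) (v j) x + avgR (dyadicRadius j) (v j) x = 0 :=
        fun x hx => by rw [h01 _ x hx, h01 _ x hx, add_zero]
      rw [e, xray_add (hum j) hms (huB j) hBs (hu0 j) h0s,
        xray_add (hm1 _) (hm1 _) (hB1 _) (hB1 _) (h01 _) (h01 _)]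
    rw [hx1]
    refine ENNReal.ofReal_add_le.trans ?_
    gcongr
    calc ENNReal.ofReal (xray (avgR (dyadicRadius (j + 1)) (v j)) θ y +
          xray (avgR (dyadicRadius j) (v j)) θ y)
        ≤ ENNReal.ofReal (xray (avgR (dyadicRadius (j + 1)) (v j)) θ y) +
          ENNReal.ofReal (xray (avgR (dyadicRadius j) (v j)) θ y) := ENNReal.ofReal_add_le
      _ ≤ ‖xray (avgR (dyadicRadius (j + 1)) (v j)) θ y‖ₑ +
          ‖xray (avgR (dyadicRadius j) (v j)) θ y‖ₑ := by
          gcongr <;> exact Real.ofReal_le_enorm _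
      _ ≤ C₁ * avgE (dyadicRadius (j + 1)) (G j) y + C₁ * avgE (dyadicRadius j) (G j) y := by
          gcongr <;> exact enorm_xray_avgR_le hC₁ (hr _) (hvm j) (hvB j) (hv0 j) θ y
      _ ≤ C₁ * (2 ^ n * avgE (dyadicRadius j) (G j) y) + C₁ * avgE (dyadicRadius j) (G j) y := by
          gcongr
          exact avgE_mono_left (hr j) (by rw [dyadicRadius_succ]; linarith [hr j])
            (by rw [dyadicRadius_succ]; linarith [hr j]) _ _
      _ = _ := by ring
  have htel : ∀ j y, ENNReal.ofReal (xray (u j) θ y) ≤ ENNReal.ofReal (xray (u 0) θ y) +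
      ∑ i ∈ Finset.range j, C₁ * (2 ^ n + 1) * avgE (dyadicRadius i) (G i) y := by
    intro j y
    induction j with
    | zero => simp
    | succ j ih =>
      rw [Finset.sum_range_succ, ← add_assoc]
      exact (hstep j y).trans (by gcongr)
  have hι : Continuous (planeE h σ) := (planeE h σ).continuous
  have havgm : ∀ j, Measurable fun z => avgE (dyadicRadius j) (G j) (a + planeE h σ z) := fun j =>
    (lowerSemicontinuous_avgE (hr j) (hGm j)).measurable.comp (by fun_prop)
  have hfi : Integrable f := by
    refine integrable_of_bounded_of_support hf hB (S := Metric.closedBall 0 R)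
      (volume_closedBall_ne_top R) fun x hx => h0 x (by simpa using hx)
  set I := ∫ x, f x with hI
  have hI0 : 0 ≤ I := integral_nonneg hf0
  have hIf : ∫⁻ x, ENNReal.ofReal (f x) = ENNReal.ofReal I :=
    (ofReal_integral_eq_lintegral_ofReal hfi (Filter.Eventually.of_forall hf0)).symm
  have ha1 : ∀ x, |avgR (dyadicRadius 0) f x| ≤ V⁻¹ * I := by
    intro x
    rw [abs_of_nonneg (avgR_nonneg _ hf0 x), avgR, ballAvg, integral_smul_measure,
      ENNReal.toReal_inv, smul_eq_mul]
    refine mul_le_mul_of_nonneg_left ?_ (inv_nonneg.mpr ENNReal.toReal_nonneg)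
    rw [hI, ← integral_add_left_eq_self f x]
    exact setIntegral_le_integral (hfi.comp_add_left x) (Filter.Eventually.of_forall fun _ => hf0 _)
  -- At j = 0 the radius is 1/8, so u 0 is bounded by a constant times the L¹ norm. It vanishes
  -- beyond R + 2, which bounds both the length of each line segment and the relevant part of the
  -- m-plane.
  have hbase : ∫⁻ z, ENNReal.ofReal (xray (u 0) θ (a + planeE h σ z)) ≤ D₀ * ENNReal.ofReal I := by
    have h1 : ∀ z, ENNReal.ofReal (xray (u 0) θ (a + planeE h σ z)) ≤
        {z | z ∈ (univ : Set (EuclideanSpace ℝ (Fin m))) ∧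
          dist 0 (a + planeE h σ z) < R + 3}.indicator
          (fun _ => ENNReal.ofReal (V⁻¹ * (2 * (R + 2)) * I)) z := by
      intro z
      by_cases hz : dist 0 (a + planeE h σ z) < R + 3
      · rw [indicator_of_mem (by exact ⟨trivial, hz⟩)]
        refine ENNReal.ofReal_le_ofReal ((le_abs_self _).trans ?_)
        refine (abs_xray_le (by linarith) (abs_avgR_le (hr 0) ha1) (hu0 0) θ _).trans
          (le_of_eq (by ring))
      · rw [xray_eq_zero (hu0 0) θ, ENNReal.ofReal_zero]
        · exact zero_le
        · rw [dist_zero_left, not_lt] at hz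
          linarith
    refine (lintegral_mono h1).trans ((lintegral_indicator_const_le _ _).trans ?_)
    rw [hD₀, ENNReal.ofReal_mul (by positivity), mul_right_comm]
    gcongr
    exact volume_near_le _ _ _ _ _
  calc ∫⁻ z, ENNReal.ofReal (xray (u J) θ (a + planeE h σ z))
      ≤ ∫⁻ z, (ENNReal.ofReal (xray (u 0) θ (a + planeE h σ z)) + ∑ i ∈ Finset.range J,
          C₁ * (2 ^ n + 1) * avgE (dyadicRadius i) (G i) (a + planeE h σ z)) :=
        lintegral_mono fun z => htel J _
    _ = (∫⁻ z, ENNReal.ofReal (xray (u 0) θ (a + planeE h σ z))) + ∑ i ∈ Finset.range J,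
          C₁ * (2 ^ n + 1) * ∫⁻ z, avgE (dyadicRadius i) (G i) (a + planeE h σ z) := by
        have hm0 : Measurable fun z => ENNReal.ofReal (xray (u 0) θ (a + planeE h σ z)) :=
          ((hxm _ (hum 0)).comp (by fun_prop)).ennreal_ofReal
        rw [lintegral_add_left hm0, lintegral_finsetSum _ fun i _ => (havgm i).const_mul _]
        congr 1
        exact Finset.sum_congr rfl fun i _ => lintegral_const_mul _ (havgm i)
    _ ≤ D₀ * ENNReal.ofReal I + ∑ i ∈ Finset.range J, C₁ * (2 ^ n + 1) *
          (C₂ * plateMax (dyadicRadius i) (G i) (Gr.rotate σ (Gr.coord h))) := by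
        gcongr with i
        exact hC₂ _ (hr i) (hr1 i) _ (hGm i) (hG0 i) σ a
    _ = D₀ * ENNReal.ofReal I + C₁ * (2 ^ n + 1) * C₂ * ∑ i ∈ Finset.range J,
          plateMax (dyadicRadius i) (G i) (Gr.rotate σ (Gr.coord h)) := by
        rw [Finset.mul_sum]
        simp only [mul_assoc]
    _ ≤ (D₀ + C₁ * (2 ^ n + 1) * C₂) * ENNReal.ofReal I + (D₀ + C₁ * (2 ^ n + 1) * C₂) *
          ∑ i ∈ Finset.range J, plateMax (dyadicRadius i) (G i) (Gr.rotate σ (Gr.coord h)) := by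
        gcongr
        · exact le_self_add
        · exact le_add_self
    _ = _ := by
        rw [← mul_add, hIf]
        push_cast
        rw [ENNReal.coe_toNNReal hD₀t]

theorem exists_sum_dyadicRadius_rpow_le {γ : ℝ} (hγ : 0 < γ) : ∃ C : ℝ≥0, ∀ J : ℕ,
    ∑ j ∈ Finset.range J, ENNReal.ofReal (dyadicRadius j ^ γ) ≤ C := by
  set q : ℝ := (1 / 2) ^ γ with hq
  have hq0 : 0 ≤ q := by positivity
  have hq1 : q < 1 := Real.rpow_lt_one (by norm_num) (by norm_num) hγ
  refine ⟨((1 - q)⁻¹ * (1 / 8) ^ γ).toNNReal, fun J => ?_⟩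
  have h : ∀ j, dyadicRadius j ^ γ = q ^ j * (1 / 8) ^ γ := fun j => by
    rw [dyadicRadius, div_eq_mul_one_div, Real.mul_rpow (by positivity) (by positivity), hq,
      ← Real.rpow_natCast, ← Real.rpow_natCast, ← Real.rpow_mul (by positivity),
      ← Real.rpow_mul (by positivity), mul_comm γ]
  rw [← ENNReal.ofReal_sum_of_nonneg fun j _ => Real.rpow_nonneg (dyadicRadius_pos j).le _]
  refine ENNReal.ofReal_le_ofReal ?_
  simp only [h, ← Finset.sum_mul]
  gcongr
  rw [← tsum_geometric_of_lt_one hq0 hq1]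
  exact (summable_geometric_of_lt_one hq0 hq1).sum_le_tsum _ fun j _ => by positivity

/-- Each term is at most r_j^(η/p) times the p-th root of the weighted sum, and the factors
r_j^(η/p) form a convergent geometric series. The loss r_j^(-η) replaces a loss depending on the
number of scales. -/
theorem exists_sum_rpow_le_weighted {p η : ℝ} (hp : 1 ≤ p) (hη : 0 < η) : ∃ K : ℝ≥0, ∀ (J : ℕ)
    (a : ℕ → ℝ≥0∞), (∑ j ∈ Finset.range J, a j) ^ p ≤
      K * ∑ j ∈ Finset.range J, ENNReal.ofReal (dyadicRadius j ^ (-η)) * a j ^ p := by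
  have hp0 : 0 < p := by linarith
  obtain ⟨C, hC⟩ := exists_sum_dyadicRadius_rpow_le (div_pos hη hp0)
  refine ⟨C ^ p, fun J a => ?_⟩
  set S := ∑ j ∈ Finset.range J, ENNReal.ofReal (dyadicRadius j ^ (-η)) * a j ^ p with hS
  have h : ∀ j ∈ Finset.range J, a j ≤ ENNReal.ofReal (dyadicRadius j ^ (η / p)) * S ^ (1 / p) := by
    intro j hj
    have hr := dyadicRadius_pos j
    rw [← ENNReal.rpow_le_rpow_iff hp0, ENNReal.mul_rpow_of_nonneg _ _ hp0.le, ← ENNReal.rpow_mul,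
      one_div_mul_cancel hp0.ne', ENNReal.rpow_one,
      ENNReal.ofReal_rpow_of_pos (by positivity), ← Real.rpow_mul hr.le, div_mul_cancel₀ _ hp0.ne']
    calc a j ^ p = ENNReal.ofReal (dyadicRadius j ^ η) *
          (ENNReal.ofReal (dyadicRadius j ^ (-η)) * a j ^ p) := by
          rw [← mul_assoc, ← ENNReal.ofReal_mul (by positivity), ← Real.rpow_add hr, add_neg_cancel,
            Real.rpow_zero, ENNReal.ofReal_one, one_mul]
      _ ≤ _ := by
          gcongr
          exact Finset.single_le_sum (f := fun j => ENNReal.ofReal (dyadicRadius j ^ (-η)) * a j ^ p)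
            (fun _ _ => zero_le) hj
  calc (∑ j ∈ Finset.range J, a j) ^ p
      ≤ (∑ j ∈ Finset.range J, ENNReal.ofReal (dyadicRadius j ^ (η / p)) * S ^ (1 / p)) ^ p := by
        gcongr with j hj
        exact h j hj
    _ ≤ (C * S ^ (1 / p)) ^ p := by
        rw [← Finset.sum_mul]
        gcongr
        exact hC J
    _ = _ := by
        rw [ENNReal.mul_rpow_of_nonneg _ _ hp0.le, ← ENNReal.rpow_mul, one_div_mul_cancel hp0.ne',
          ENNReal.rpow_one, ENNReal.coe_rpow_of_nonneg _ hp0.le]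

theorem setLIntegral_rpow_le {α : Type*} [MeasurableSpace α] (μ : Measure α) {f : α → ℝ≥0∞}
    (hf : AEMeasurable f μ) {p : ℝ} (hp : 1 < p) (S : Set α) :
    (∫⁻ x in S, f x ∂μ) ^ p ≤ μ S ^ (p - 1) * ∫⁻ x in S, f x ^ p ∂μ := by
  have hpq := Real.HolderConjugate.conjExponent hp
  have hp0 : 0 < p := by linarith
  have h := ENNReal.lintegral_mul_le_Lp_mul_Lq (μ.restrict S) hpq hf.restrict
    (aemeasurable_const (b := (1 : ℝ≥0∞)))
  simp only [Pi.mul_apply, mul_one, ENNReal.one_rpow, lintegral_const,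
    Measure.restrict_apply_univ, one_mul] at h
  have h2 := ENNReal.rpow_le_rpow h hp0.le
  rw [ENNReal.mul_rpow_of_nonneg _ _ hp0.le, ← ENNReal.rpow_mul, ← ENNReal.rpow_mul,
    one_div_mul_cancel hp0.ne', ENNReal.rpow_one] at h2
  have e : 1 / p.conjExponent * p = p - 1 := by
    have : p - 1 ≠ 0 := by linarith
    rw [Real.conjExponent]
    field_simp
  rwa [e, mul_comm] at h2

/-! ### The estimate for iterated averages. -/

theorem PlateMaxBound.exists_lintegral_le {d k : ℕ} {h : k ≤ d} {p α : ℝ} (hp : 1 ≤ p)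
    (hb : PlateMaxBound h p (α / p)) : ∃ C : ℝ≥0, ∀ r : ℝ, 0 < r → r ≤ 1 →
      ∀ g : EuclideanSpace ℝ (Fin d) → ℝ, Measurable g →
        ∫⁻ σ, plateMax r (fun y => ‖g y‖ₑ) (Gr.rotate σ (Gr.coord h)) ^ p ∂orthHaar d ≤
          C * ENNReal.ofReal (r ^ (-α)) * ∫⁻ y, ‖g y‖ₑ ^ p := by
  obtain ⟨C, hC⟩ := hb
  have hp0 : 0 < p := by linarith
  have hpE : ENNReal.ofReal p ≠ 0 := by simpa using hp0
  have hpt : (ENNReal.ofReal p).toReal = p := ENNReal.toReal_ofReal hp0.le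
  -- The added 1 makes the constant positive, so that the bound is trivially true when the norm of g
  -- is infinite, 0 · ∞ being 0.
  refine ⟨(C + 1) ^ p, fun r hr hr1 g hg => ?_⟩
  have hm : Measurable (plateMax (k := k) r fun y => ‖g y‖ₑ) := measurable_plateMax h hr hg.enorm
  rw [← lintegral_grMeasure h (hm.pow_const p)]
  by_cases ht : ∫⁻ y, ‖g y‖ₑ ^ p = ∞
  · rw [ht, ENNReal.mul_top]
    · exact le_top
    · refine mul_ne_zero ?_ (by simpa using Real.rpow_pos_of_pos hr _)
      rw [ENNReal.coe_ne_zero]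
      positivity
  have hgL : MemLp g (ENNReal.ofReal p) volume := by
    refine ⟨hg.aestronglyMeasurable, ?_⟩
    rw [eLpNorm_lt_top_iff_lintegral_rpow_enorm_lt_top hpE ENNReal.ofReal_ne_top, hpt]
    exact lt_top_iff_ne_top.mpr ht
  have key := hC r hr hr1 g hgL
  rw [eLpNorm_eq_lintegral_rpow_enorm_toReal hpE ENNReal.ofReal_ne_top,
    eLpNorm_eq_lintegral_rpow_enorm_toReal hpE ENNReal.ofReal_ne_top, hpt] at key
  have key2 := ENNReal.rpow_le_rpow key hp0.le
  rw [ENNReal.mul_rpow_of_nonneg _ _ hp0.le, ENNReal.mul_rpow_of_nonneg _ _ hp0.le,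
    ← ENNReal.rpow_mul, ← ENNReal.rpow_mul, one_div_mul_cancel hp0.ne', ENNReal.rpow_one,
    ENNReal.rpow_one, ENNReal.ofReal_rpow_of_pos (by positivity), ← Real.rpow_mul hr.le,
    show -(α / p) * p = -α by field_simp] at key2
  simp only [enorm_eq_self] at key2
  refine key2.trans ?_
  gcongr
  rw [← ENNReal.coe_rpow_of_nonneg _ hp0.le]
  gcongr
  simp

theorem measurable_xray_apply {n : ℕ} {g : EuclideanSpace ℝ (Fin (n + 1)) → ℝ} (hg : Measurable g)
    (θ : Matrix.orthogonalGroup (Fin (n + 1)) ℝ) : Measurable (xray g θ) := by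
  have h := (measurable_xray hg).comp (measurable_prodMk_left (x := θ))
  exact h

theorem measurable_planeMax_avgE_avgE {d k : ℕ} (h : k ≤ d) {r : ℝ} (hr : 0 < r)
    {F : EuclideanSpace ℝ (Fin d) → ℝ≥0∞} (hF : Measurable F) :
    Measurable fun θ => planeMax (avgE r (avgE r F)) (Gr.rotate θ (Gr.coord h)) :=
  (lowerSemicontinuous_planeMax_rotate h
    (lowerSemicontinuous_avgE hr (lowerSemicontinuous_avgE hr hF).measurable)).measurable

theorem lintegral_mul_add_mul_sum {α : Type*} [MeasurableSpace α] (μ : Measure α)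
    [IsProbabilityMeasure μ] (D A K : ℝ≥0∞) (s : Finset ℕ) (w : ℕ → ℝ≥0∞) {P : ℕ → α → ℝ≥0∞}
    (hP : ∀ j, Measurable (P j)) :
    ∫⁻ x, D * (A + K * ∑ j ∈ s, w j * P j x) ∂μ =
      D * (A + K * ∑ j ∈ s, w j * ∫⁻ x, P j x ∂μ) := by
  have hm : Measurable fun x => ∑ j ∈ s, w j * P j x :=
    Finset.measurable_fun_sum _ fun j _ => (hP j).const_mul _
  have hm' : Measurable fun x => A + K * ∑ j ∈ s, w j * P j x := (hm.const_mul K).const_add A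
  rw [lintegral_const_mul _ hm', lintegral_add_left measurable_const, lintegral_const, measure_univ,
    mul_one, lintegral_const_mul _ hm, lintegral_finsetSum _ fun j _ => (hP j).const_mul _]
  simp only [lintegral_const_mul _ (hP _)]

/-- For fixed θ the hypothesis is applied in σ to the X-ray transforms, and smoothing is then
applied in θ. The exponent 1 - α - 2η is the sum of -η from the weights, -α from the hypothesis and
1 - η from smoothing. The constant depends neither on J nor on the bound B. -/
theorem PlateMaxBound.exists_lintegral_planeMax_le_of_bounded {m n : ℕ} (hn : 1 ≤ n) {h : m ≤ n}
    {p α : ℝ} (hp : 2 ≤ p) (hb : PlateMaxBound h p (α / p)) {η : ℝ} (hη : 0 < η) (hη1 : η < 1)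
    {R : ℝ} (hR : 0 ≤ R) : ∃ C : ℝ≥0, ∀ (J : ℕ)
      (f : EuclideanSpace ℝ (Fin (n + 1)) → ℝ) (B : ℝ), Measurable f → (∀ x, 0 ≤ f x) →
      (∀ x, f x ≤ B) → (∀ x, R < ‖x‖ → f x = 0) →
        ∫⁻ θ, planeMax (avgE (dyadicRadius J) (avgE (dyadicRadius J) fun x => ENNReal.ofReal (f x)))
          (Gr.rotate θ (Gr.coord (Nat.succ_le_succ h))) ^ p ∂orthHaar (n + 1) ≤
        C * (1 + ∑ j ∈ Finset.range J, ENNReal.ofReal (dyadicRadius j ^ (1 - α - 2 * η))) *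
          ∫⁻ x, ENNReal.ofReal (f x) ^ p := by
  have hp0 : 0 < p := by linarith
  obtain ⟨C₁, hC₁⟩ := exists_planeMax_avgE_le h hR
  obtain ⟨C₂, hC₂⟩ := hb.exists_lintegral_le (by linarith)
  obtain ⟨C₃, hC₃⟩ := exists_lintegral_xray_avgDiff_rpow_le hn hp hη hη1 hR
  obtain ⟨K, hK⟩ := exists_sum_rpow_le_weighted (p := p) (by linarith) hη
  set W : ℝ≥0∞ := volume (Metric.closedBall (0 : EuclideanSpace ℝ (Fin (n + 1))) R) ^ (p - 1)
    with hW
  have hWt : W ≠ ∞ := ENNReal.rpow_ne_top_of_nonneg (by linarith) (volume_closedBall_ne_top R)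
  set D : ℝ≥0∞ := (C₁ : ℝ≥0∞) ^ p * 2 ^ (p - 1) with hD
  have hDt : D ≠ ∞ := ENNReal.mul_ne_top (ENNReal.rpow_ne_top_of_nonneg hp0.le (by simp))
    (ENNReal.rpow_ne_top_of_nonneg (by linarith) (by simp))
  obtain ⟨A, hA⟩ : ∃ A : ℝ≥0, (A : ℝ≥0∞) = D * (W + K * (C₂ * C₃)) :=
    ⟨(D * (W + K * (C₂ * C₃))).toNNReal, ENNReal.coe_toNNReal (by finiteness)⟩
  refine ⟨A, fun J f B hf hf0 hfB h0 => ?_⟩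
  set I : ℝ≥0∞ := ∫⁻ x, ENNReal.ofReal (f x) with hI
  set N : ℝ≥0∞ := ∫⁻ x, ENNReal.ofReal (f x) ^ p with hN
  set r := dyadicRadius with hr
  have hr0 : ∀ j, 0 < r j := dyadicRadius_pos
  set X : ℕ → Matrix.orthogonalGroup (Fin (n + 1)) ℝ → EuclideanSpace ℝ (Fin n) → ℝ :=
    fun j => xray (avgDiff (r j) f) with hX
  have hXm : ∀ j, Measurable fun q : Matrix.orthogonalGroup (Fin (n + 1)) ℝ ×
      EuclideanSpace ℝ (Fin n) => X j q.1 q.2 := fun j => measurable_xray (measurable_avgDiff _ hf)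
  have hXθ : ∀ j θ, Measurable (X j θ) := fun j θ => measurable_xray_apply (measurable_avgDiff _ hf) θ
  have hPm : ∀ j θ, Measurable fun σ => plateMax (r j) (fun y => ‖X j θ y‖ₑ)
      (Gr.rotate σ (Gr.coord h)) := fun j θ => by
    have h1 : Measurable (plateMax (k := m) (r j) fun y => ‖X j θ y‖ₑ) :=
      measurable_plateMax h (hr0 j) (hXθ j θ).enorm
    exact h1.comp (Gr.continuous_rotate (Gr.coord h)).measurable
  -- Hölder on the ball carrying f turns the L¹ term into the p-th power norm.
  have hIN : I ^ p ≤ W * N := by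
    have hS : ∀ g : EuclideanSpace ℝ (Fin (n + 1)) → ℝ≥0∞, (∀ x, R < ‖x‖ → g x = 0) →
        ∫⁻ x, g x = ∫⁻ x in Metric.closedBall 0 R, g x := fun g hg => by
      rw [← lintegral_indicator Metric.isClosed_closedBall.measurableSet]
      congr 1 with x
      by_cases hx : x ∈ Metric.closedBall 0 R
      · rw [indicator_of_mem hx]
      · rw [indicator_of_notMem hx, hg]
        simpa using hx
    rw [hI, hN, hS _ fun x hx => by rw [h0 x hx, ENNReal.ofReal_zero],
      hS _ fun x hx => by rw [h0 x hx, ENNReal.ofReal_zero, ENNReal.zero_rpow_of_pos hp0]]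
    exact setLIntegral_rpow_le _ hf.ennreal_ofReal.aemeasurable (by linarith) _
  have hfN : ∫⁻ x, ‖f x‖ₑ ^ p = N := by
    simp only [hN, Real.enorm_eq_ofReal (hf0 _)]
  have hm := (measurable_planeMax_avgE_avgE (Nat.succ_le_succ h) (hr0 J)
    hf.ennreal_ofReal).pow_const p
  rw [lintegral_orthHaar_stabE hm]
  have hpt : ∀ θ σ, planeMax (avgE (r J) (avgE (r J) fun x => ENNReal.ofReal (f x)))
      (Gr.rotate (θ * stabE σ) (Gr.coord (Nat.succ_le_succ h))) ^ p ≤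
      D * (I ^ p + K * ∑ j ∈ Finset.range J, ENNReal.ofReal (r j ^ (-η)) *
        plateMax (r j) (fun y => ‖X j θ y‖ₑ) (Gr.rotate σ (Gr.coord h)) ^ p) := by
    intro θ σ
    refine (ENNReal.rpow_le_rpow (hC₁ f B hf hf0 hfB h0 J θ σ) hp0.le).trans ?_
    rw [ENNReal.mul_rpow_of_nonneg _ _ hp0.le, hD, mul_assoc]
    gcongr
    refine (ENNReal.rpow_add_le_mul_rpow_add_rpow _ _ (by linarith)).trans ?_
    gcongr
    exact hK _ _
  have hin : ∀ θ, ∫⁻ σ, planeMax (avgE (r J) (avgE (r J) fun x => ENNReal.ofReal (f x)))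
      (Gr.rotate (θ * stabE σ) (Gr.coord (Nat.succ_le_succ h))) ^ p ∂orthHaar n ≤
      D * (I ^ p + K * ∑ j ∈ Finset.range J, ENNReal.ofReal (r j ^ (-η)) *
        (C₂ * ENNReal.ofReal (r j ^ (-α)) * ∫⁻ y, ‖X j θ y‖ₑ ^ p)) := by
    intro θ
    refine (lintegral_mono (hpt θ)).trans ?_
    rw [lintegral_mul_add_mul_sum _ _ _ _ _ _ fun j => (hPm j θ).pow_const p]
    gcongr with j
    exact hC₂ _ (hr0 j) (dyadicRadius_le_one j) _ (hXθ j θ)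
  refine (lintegral_mono hin).trans ?_
  have hXp : ∀ j, Measurable fun θ => ∫⁻ y, ‖X j θ y‖ₑ ^ p := fun j =>
    ((hXm j).enorm.pow_const p).lintegral_prod_right'
  rw [lintegral_mul_add_mul_sum _ _ _ _ _ _ fun j => (hXp j).const_mul _]
  have hterm : ∀ j, ENNReal.ofReal (r j ^ (-η)) * ∫⁻ θ,
      C₂ * ENNReal.ofReal (r j ^ (-α)) * (∫⁻ y, ‖X j θ y‖ₑ ^ p) ∂orthHaar (n + 1) ≤
      C₂ * C₃ * N * ENNReal.ofReal (r j ^ (1 - α - 2 * η)) := by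
    intro j
    rw [lintegral_const_mul _ (hXp j)]
    calc _ ≤ ENNReal.ofReal (r j ^ (-η)) * (C₂ * ENNReal.ofReal (r j ^ (-α)) *
          (C₃ * ENNReal.ofReal (r j ^ (1 - η)) * N)) := by
          gcongr
          exact (hC₃ _ (hr0 j) (dyadicRadius_le_one j) f B hf hf0 hfB h0).trans_eq (by rw [hfN])
      _ = C₂ * C₃ * N * (ENNReal.ofReal (r j ^ (-η)) * ENNReal.ofReal (r j ^ (-α)) *
          ENNReal.ofReal (r j ^ (1 - η))) := by ring
      _ = _ := by
          have := hr0 j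
          rw [← ENNReal.ofReal_mul (by positivity), ← ENNReal.ofReal_mul (by positivity),
            ← Real.rpow_add this, ← Real.rpow_add this]
          congr 3
          ring
  rw [hA]
  set T := ∑ j ∈ Finset.range J, ENNReal.ofReal (r j ^ (1 - α - 2 * η)) with hT
  calc _ ≤ D * (W * N + K * ∑ j ∈ Finset.range J,
        C₂ * C₃ * N * ENNReal.ofReal (r j ^ (1 - α - 2 * η))) := by
        exact mul_le_mul_right (add_le_add hIN (mul_le_mul_right
          (Finset.sum_le_sum fun j _ => hterm j) _)) _
    _ = D * (W * 1 + K * (C₂ * C₃) * T) * N := by rw [← Finset.mul_sum]; ring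
    _ ≤ D * ((W + K * (C₂ * C₃)) * (1 + T)) * N := by
        gcongr
        rw [mul_add]
        gcongr
        · exact le_self_add
        · exact le_add_self
    _ = _ := by ring

theorem planeMax_iSup_of_monotone {d k : ℕ} {F : ℕ → EuclideanSpace ℝ (Fin d) → ℝ≥0∞}
    (hF : ∀ N, Measurable (F N)) (hmono : Monotone F) (L : Gr d k) :
    planeMax (fun x => ⨆ N, F N x) L = ⨆ N, planeMax (F N) L := by
  simp only [planeMax]
  rw [iSup_comm]
  congr 1 with x
  exact lintegral_iSup (fun N => (hF N).comp (measurable_subtype_coe.const_add x))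
    fun _ _ h _ => hmono h _

theorem avgE_iSup_of_monotone {d : ℕ} (r : ℝ) {F : ℕ → EuclideanSpace ℝ (Fin d) → ℝ≥0∞}
    (hF : ∀ N, Measurable (F N)) (hmono : Monotone F) :
    avgE r (fun x => ⨆ N, F N x) = fun x => ⨆ N, avgE r (F N) x := by
  funext x
  exact lintegral_iSup (fun N => (hF N).comp (measurable_const_add x)) fun _ _ h _ => hmono h _

/-- The bounded case does not depend on the bound, so truncating F at N and monotone convergence
remove it; the value ∞ becomes admissible. -/
theorem PlateMaxBound.exists_lintegral_planeMax_le {m n : ℕ} (hn : 1 ≤ n) {h : m ≤ n}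
    {p α : ℝ} (hp : 2 ≤ p) (hb : PlateMaxBound h p (α / p)) {η : ℝ} (hη : 0 < η) (hη1 : η < 1)
    {R : ℝ} (hR : 0 ≤ R) : ∃ C : ℝ≥0, ∀ (J : ℕ)
      (F : EuclideanSpace ℝ (Fin (n + 1)) → ℝ≥0∞), Measurable F → (∀ x, R < ‖x‖ → F x = 0) →
        ∫⁻ θ, planeMax (avgE (dyadicRadius J) (avgE (dyadicRadius J) F))
          (Gr.rotate θ (Gr.coord (Nat.succ_le_succ h))) ^ p ∂orthHaar (n + 1) ≤
        C * (1 + ∑ j ∈ Finset.range J, ENNReal.ofReal (dyadicRadius j ^ (1 - α - 2 * η))) *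
          ∫⁻ x, F x ^ p := by
  have hp0 : 0 < p := by linarith
  obtain ⟨C, hC⟩ := hb.exists_lintegral_planeMax_le_of_bounded hn hp hη hη1 hR
  refine ⟨C, fun J F hF h0 => ?_⟩
  set r := dyadicRadius J with hr
  have hr0 : 0 < r := dyadicRadius_pos J
  set G : ℕ → EuclideanSpace ℝ (Fin (n + 1)) → ℝ≥0∞ := fun N x => min (F x) N with hG
  have hGm : ∀ N, Measurable (G N) := fun N => hF.min measurable_const
  have hGmono : Monotone G := fun a b hab x => min_le_min le_rfl (by exact_mod_cast hab)
  have hGF : F = fun x => ⨆ N, G N x := by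
    funext x
    change F x = ⨆ N : ℕ, F x ⊓ (N : ℝ≥0∞)
    rw [← inf_iSup_eq, ENNReal.iSup_natCast, inf_top_eq]
  have hAm : ∀ N, Measurable (avgE r (G N)) := fun N =>
    (lowerSemicontinuous_avgE hr0 (hGm N)).measurable
  have hAmono : Monotone fun N => avgE r (G N) := fun a b hab x => avgE_mono (hGmono hab) x
  have hAAm : ∀ N, Measurable (avgE r (avgE r (G N))) := fun N =>
    (lowerSemicontinuous_avgE hr0 (hAm N)).measurable
  have hAAmono : Monotone fun N => avgE r (avgE r (G N)) := fun a b hab x =>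
    avgE_mono (hAmono hab) x
  have hP : ∀ L : Gr (n + 1) (m + 1), planeMax (avgE r (avgE r F)) L ^ p =
      ⨆ N, planeMax (avgE r (avgE r (G N))) L ^ p := by
    intro L
    conv_lhs => rw [hGF, avgE_iSup_of_monotone r hGm hGmono, avgE_iSup_of_monotone r hAm hAmono,
      planeMax_iSup_of_monotone hAAm hAAmono]
    exact (ENNReal.orderIsoRpow p hp0).map_iSup _
  simp only [hP]
  rw [lintegral_iSup]
  · refine iSup_le fun N => ?_
    have hfin : ∀ x, G N x ≠ ∞ := fun x => ne_top_of_le_ne_top (by simp) (min_le_right _ _)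
    have hGN : G N = fun x => ENNReal.ofReal (G N x).toReal := funext fun x =>
      (ENNReal.ofReal_toReal (hfin x)).symm
    rw [hGN]
    refine (hC J (fun x => (G N x).toReal) N (hGm N).ennreal_toReal
      (fun x => ENNReal.toReal_nonneg) (fun x => ?_) fun x hx => ?_).trans ?_
    · exact ENNReal.toReal_le_of_le_ofReal (by simp) (by simp [hG])
    · simp [hG, h0 x hx]
    · gcongr with x
      exact ENNReal.ofReal_toReal_le.trans (min_le_left _ _)
  · exact fun N => (measurable_planeMax_avgE_avgE _ hr0 (hGm N)).pow_const p
  · intro a b hab θ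
    refine ENNReal.rpow_le_rpow ?_ hp0.le
    exact iSup_mono fun x => lintegral_mono fun y => hAAmono hab _

/-! ### The case α < 1. -/

theorem planeMax_mono {d k : ℕ} {F G : EuclideanSpace ℝ (Fin d) → ℝ≥0∞} (h : ∀ x, F x ≤ G x)
    (L : Gr d k) : planeMax F L ≤ planeMax G L :=
  iSup_mono fun _ => lintegral_mono fun _ => h _

theorem planeMax_add_le {d k : ℕ} (F : EuclideanSpace ℝ (Fin d) → ℝ≥0∞)
    {G : EuclideanSpace ℝ (Fin d) → ℝ≥0∞} (hG : Measurable G) (L : Gr d k) :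
    planeMax (fun x => F x + G x) L ≤ planeMax F L + planeMax G L := by
  refine iSup_le fun x => ?_
  have hm : Measurable fun y : L.1 => G (x + y) := hG.comp (measurable_subtype_coe.const_add x)
  refine (lintegral_add_right (fun y : L.1 => F (x + y)) hm).trans_le ?_
  exact add_le_add (le_iSup (fun x => ∫⁻ y : L.1, F (x + y)) x)
    (le_iSup (fun x => ∫⁻ y : L.1, G (x + y)) x)

theorem lowerSemicontinuous_planeMax {d k : ℕ} (h : k ≤ d) {F : EuclideanSpace ℝ (Fin d) → ℝ≥0∞}
    (hF : LowerSemicontinuous F) : LowerSemicontinuous (planeMax (k := k) F) :=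
  Gr.lowerSemicontinuous_of_rotate h (lowerSemicontinuous_planeMax_rotate h hF)

theorem le_avgE {d : ℕ} {r : ℝ} (hr : 0 < r) {F : EuclideanSpace ℝ (Fin d) → ℝ≥0∞}
    {x : EuclideanSpace ℝ (Fin d)} {c : ℝ≥0∞} (h : ∀ z, ‖z‖ < r → c ≤ F (x + z)) :
    c ≤ avgE r F x := by
  have := isProbabilityMeasure_ballAvg d hr
  calc c = ∫⁻ _, c ∂ballAvg d r := by simp
    _ ≤ _ := lintegral_mono_ae (by filter_upwards [ae_ballAvg d r] with z hz using h z hz)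

theorem tendsto_dyadicRadius : Filter.Tendsto dyadicRadius Filter.atTop (nhds 0) := by
  have h := (tendsto_pow_atTop_nhds_zero_of_lt_one (r := (1 / 2 : ℝ)) (by norm_num)
    (by norm_num)).div_const 8
  rwa [zero_div] at h

/-- Near x a lower semicontinuous F exceeds any c' < F x, hence so do its averages over small balls.
The inequality holds at every point, as it must: affine planes may be null sets, so an almost
everywhere statement would be useless. -/
theorem le_liminf_avgE_avgE {d : ℕ} {F : EuclideanSpace ℝ (Fin d) → ℝ≥0∞}
    (hF : LowerSemicontinuous F) (x : EuclideanSpace ℝ (Fin d)) :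
    F x ≤ Filter.liminf (fun J => avgE (dyadicRadius J) (avgE (dyadicRadius J) F) x)
      Filter.atTop := by
  refine le_of_forall_lt fun c hc => ?_
  obtain ⟨c', hcc', hc'⟩ := exists_between hc
  refine hcc'.trans_le ?_
  obtain ⟨ε, hε, hball⟩ := Metric.eventually_nhds_iff.mp (hF x c' hc')
  refine Filter.le_liminf_of_le (by isBoundedDefault) ?_
  filter_upwards [tendsto_dyadicRadius.eventually_lt_const (half_pos hε)] with J hJ
  refine le_avgE (dyadicRadius_pos J) fun z hz => le_avgE (dyadicRadius_pos J) fun w hw =>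
    (hball ?_).le
  rw [add_assoc, dist_self_add_left]
  linarith [norm_add_le z w]

theorem planeMax_le_liminf {d k : ℕ} {F : EuclideanSpace ℝ (Fin d) → ℝ≥0∞}
    {G : ℕ → EuclideanSpace ℝ (Fin d) → ℝ≥0∞} (hG : ∀ J, Measurable (G J))
    (h : ∀ x, F x ≤ Filter.liminf (fun J => G J x) Filter.atTop) (L : Gr d k) :
    planeMax F L ≤ Filter.liminf (fun J => planeMax (G J) L) Filter.atTop := by
  refine iSup_le fun x => ?_
  calc ∫⁻ y : L.1, F (x + y) ≤ ∫⁻ y : L.1, Filter.liminf (fun J => G J (x + y)) Filter.atTop :=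
        lintegral_mono fun y => h _
    _ ≤ Filter.liminf (fun J => ∫⁻ y : L.1, G J (x + y)) Filter.atTop :=
        lintegral_liminf_le fun J => (hG J).comp (measurable_subtype_coe.const_add x)
    _ ≤ _ := Filter.liminf_le_liminf (Filter.Eventually.of_forall fun J =>
        le_iSup (fun x => ∫⁻ y : L.1, G J (x + y)) x)

theorem PlateMaxBound.exists_lintegral_planeMax_le_of_lowerSemicontinuous {m n : ℕ} (hn : 1 ≤ n)
    {h : m ≤ n} {p α : ℝ} (hp : 2 ≤ p) (hb : PlateMaxBound h p (α / p)) (hα : α < 1)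
    {R : ℝ} (hR : 0 ≤ R) : ∃ C : ℝ≥0,
      ∀ F : EuclideanSpace ℝ (Fin (n + 1)) → ℝ≥0∞, LowerSemicontinuous F →
        (∀ x, R < ‖x‖ → F x = 0) →
        ∫⁻ L, planeMax F L ^ p ∂grMeasure (Nat.succ_le_succ h) ≤ C * ∫⁻ x, F x ^ p := by
  have hp0 : 0 < p := by linarith
  -- This choice leaves the exponent 1 - α - 2η at least (1 - α) / 2, so the sum over scales is
  -- bounded uniformly in J and Fatou passes to the limit.
  set η : ℝ := min ((1 - α) / 4) (1 / 2) with hη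
  have hη0 : 0 < η := lt_min (by linarith) (by norm_num)
  have hη1 : η < 1 := (min_le_right _ _).trans_lt (by norm_num)
  have hγ : 0 < 1 - α - 2 * η := by linarith [min_le_left ((1 - α) / 4) (1 / 2)]
  obtain ⟨C₁, hC₁⟩ := hb.exists_lintegral_planeMax_le hn hp hη0 hη1 hR
  obtain ⟨C₂, hC₂⟩ := exists_sum_dyadicRadius_rpow_le hγ
  refine ⟨C₁ * (1 + C₂), fun F hF h0 => ?_⟩
  have hAm : ∀ J, Measurable (avgE (dyadicRadius J) (avgE (dyadicRadius J) F)) := fun J =>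
    (lowerSemicontinuous_avgE (dyadicRadius_pos J)
      (lowerSemicontinuous_avgE (dyadicRadius_pos J) hF.measurable).measurable).measurable
  refine (lintegral_grMeasure_le _ _).trans ?_
  calc ∫⁻ θ, planeMax F (Gr.rotate θ (Gr.coord (Nat.succ_le_succ h))) ^ p ∂orthHaar (n + 1)
      ≤ ∫⁻ θ, Filter.liminf (fun J => planeMax (avgE (dyadicRadius J) (avgE (dyadicRadius J) F))
          (Gr.rotate θ (Gr.coord (Nat.succ_le_succ h))) ^ p) Filter.atTop ∂orthHaar (n + 1) := by
        refine lintegral_mono fun θ => ?_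
        refine (ENNReal.rpow_le_rpow (planeMax_le_liminf hAm (le_liminf_avgE_avgE hF) _)
          hp0.le).trans_eq ?_
        exact (ENNReal.monotone_rpow_of_nonneg hp0.le).map_liminf_of_continuousAt _
          ENNReal.continuous_rpow_const.continuousAt
    _ ≤ Filter.liminf (fun J => ∫⁻ θ, planeMax (avgE (dyadicRadius J) (avgE (dyadicRadius J) F))
          (Gr.rotate θ (Gr.coord (Nat.succ_le_succ h))) ^ p ∂orthHaar (n + 1)) Filter.atTop :=
        lintegral_liminf_le fun J =>
          (measurable_planeMax_avgE_avgE _ (dyadicRadius_pos J) hF.measurable).pow_const p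
    _ ≤ _ := by
        refine Filter.liminf_le_of_le (by isBoundedDefault) fun b hbd => ?_
        obtain ⟨J, hJ⟩ := hbd.exists
        refine hJ.trans ((hC₁ J F hF.measurable h0).trans ?_)
        push_cast
        gcongr
        exact hC₂ J

/-- The Vitali–Carathéodory theorem applied to |f|^p, followed by a p-th root. Cutting off to an
open ball preserves lower semicontinuity, and the domination holds everywhere, null sets included.
-/
theorem exists_lowerSemicontinuous_ge {d : ℕ} {p : ℝ} (hp : 0 < p) {R : ℝ}
    {f : EuclideanSpace ℝ (Fin d) → ℝ} (hf : AEMeasurable f) (h0 : ∀ x, R < ‖x‖ → f x = 0)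
    {ε : ℝ≥0∞} (hε : ε ≠ 0) : ∃ g : EuclideanSpace ℝ (Fin d) → ℝ≥0∞, LowerSemicontinuous g ∧
      (∀ x, ‖f x‖ₑ ≤ g x) ∧ (∀ x, R + 1 < ‖x‖ → g x = 0) ∧
      ∫⁻ x, g x ^ p ≤ (∫⁻ x, ‖f x‖ₑ ^ p) + ε := by
  obtain ⟨g, hfg, hg, hgi⟩ := exists_lt_lowerSemicontinuous_lintegral_ge_of_aemeasurable
    (volume : Measure (EuclideanSpace ℝ (Fin d))) (fun x => ‖f x‖₊ ^ p) (hf.nnnorm.pow_const p) hε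
  have hcoe : ∀ x, ((‖f x‖₊ ^ p : ℝ≥0) : ℝ≥0∞) = ‖f x‖ₑ ^ p := fun x => by
    rw [ENNReal.coe_rpow_of_nonneg _ hp.le]; rfl
  simp only [hcoe] at hfg hgi
  have hp' : 0 ≤ 1 / p := by positivity
  refine ⟨(Metric.ball 0 (R + 1)).indicator fun x => g x ^ (1 / p), ?_, fun x => ?_, fun x hx => ?_,
    le_trans (lintegral_mono fun x => ?_) hgi⟩
  · exact lowerSemicontinuous_indicator_of_isOpen
      (ENNReal.continuous_rpow_const.comp_lowerSemicontinuous hg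
        (ENNReal.monotone_rpow_of_nonneg hp')) Metric.isOpen_ball
  · by_cases hx : x ∈ Metric.ball 0 (R + 1)
    · rw [indicator_of_mem hx, one_div]
      exact ENNReal.le_rpow_inv_iff hp |>.mpr (hfg x).le
    · rw [h0 x, enorm_zero]
      · exact zero_le
      · rw [mem_ball_zero_iff, not_lt] at hx
        linarith
  · refine indicator_of_notMem ?_ _
    rw [mem_ball_zero_iff, not_lt]
    exact hx.le
  · by_cases hx : x ∈ Metric.ball 0 (R + 1)
    · rw [indicator_of_mem hx, ← ENNReal.rpow_mul, one_div_mul_cancel hp.ne', ENNReal.rpow_one]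
    · rw [indicator_of_notMem hx, ENNReal.zero_rpow_of_pos hp]
      exact zero_le

theorem eLpNorm_rpow_eq_lintegral {α ε : Type*} [MeasurableSpace α] [ENorm ε] {μ : Measure α}
    {p : ℝ} (hp : 0 < p) (f : α → ε) :
    eLpNorm f (ENNReal.ofReal p) μ ^ p = ∫⁻ x, ‖f x‖ₑ ^ p ∂μ := by
  rw [eLpNorm_eq_lintegral_rpow_enorm_toReal (by simpa using hp) ENNReal.ofReal_ne_top,
    ENNReal.toReal_ofReal hp.le, ← ENNReal.rpow_mul, one_div_mul_cancel hp.ne', ENNReal.rpow_one]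

theorem PlateMaxBound.exists_eLpNorm_planeMax_le {m n : ℕ} (hn : 1 ≤ n) {h : m ≤ n} {p α : ℝ}
    (hp : 2 ≤ p) (hb : PlateMaxBound h p (α / p)) (hα : α < 1) : ∃ C : ℝ≥0,
      ∀ f : EuclideanSpace ℝ (Fin (n + 1)) → ℝ, MemLp f (ENNReal.ofReal p) volume →
        Function.support f ⊆ Metric.closedBall 0 1 →
        AEMeasurable (planeMax (k := m + 1) fun y => ‖f y‖ₑ) (grMeasure (Nat.succ_le_succ h)) ∧
        eLpNorm (planeMax (k := m + 1) fun y => ‖f y‖ₑ) (ENNReal.ofReal p)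
          (grMeasure (Nat.succ_le_succ h)) ≤ C * eLpNorm f (ENNReal.ofReal p) volume := by
  have hp0 : 0 < p := by linarith
  -- The errors below live in the ball of radius 2, and majorants enlarge supports by 1; hence R =
  -- 3.
  obtain ⟨C, hC⟩ := hb.exists_lintegral_planeMax_le_of_lowerSemicontinuous hn hp hα
    (R := 3) (by norm_num)
  refine ⟨C ^ (1 / p), fun f hf hsupp => ?_⟩
  have h0 : ∀ x, 1 < ‖x‖ → f x = 0 := fun x hx => by
    by_contra hne
    have := hsupp (Function.mem_support.mpr hne)
    rw [mem_closedBall_zero_iff] at this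
    linarith
  constructor
  -- Measurability by approximation: continuous c j approximate f with summable p-th power errors.
  -- The maximal functions of the lower semicontinuous majorants g j of the errors have summable
  -- p-th powers almost everywhere, so they tend to 0, and they squeeze the maximal function of f
  -- between those of the lower semicontinuous b j.
  · obtain ⟨δ, hδ, hδs⟩ := ENNReal.exists_pos_sum_of_countable' one_ne_zero ℕ
    have hδ' : ∀ j, δ j ^ (1 / p) ≠ 0 := fun j =>
      (ENNReal.rpow_pos_of_nonneg (hδ j) (by positivity)).ne'
    choose c hcs hcf hcc hcL using fun j =>
      hf.exists_hasCompactSupport_eLpNorm_sub_le ENNReal.ofReal_ne_top (hδ' j)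
    set U : Set (EuclideanSpace ℝ (Fin (n + 1))) := Metric.ball 0 2 with hU
    set e : ℕ → EuclideanSpace ℝ (Fin (n + 1)) → ℝ := fun j => U.indicator (f - c j) with he
    have hUo : IsOpen U := Metric.isOpen_ball
    have hem : ∀ j, AEMeasurable (e j) := fun j =>
      (hf.1.aemeasurable.sub (hcc j).aemeasurable).indicator hUo.measurableSet
    have he0 : ∀ j x, 2 < ‖x‖ → e j x = 0 := fun j x hx => indicator_of_notMem (by
      rw [hU, mem_ball_zero_iff]; linarith) _
    have hei : ∀ j, ∫⁻ x, ‖e j x‖ₑ ^ p ≤ δ j := fun j => by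
      have h1 := ENNReal.rpow_le_rpow (hcf j) hp0.le
      rw [eLpNorm_rpow_eq_lintegral hp0, ← ENNReal.rpow_mul, one_div_mul_cancel hp0.ne',
        ENNReal.rpow_one] at h1
      refine (lintegral_mono fun x => ?_).trans h1
      simp only [he, enorm_indicator_eq_indicator_enorm]
      gcongr
      exact indicator_le_self _ _ _
    choose g hgl hge hg0 hgi using fun j =>
      exists_lowerSemicontinuous_ge hp0 (hem j) (he0 j) (hδ j).ne'
    set b : ℕ → EuclideanSpace ℝ (Fin (n + 1)) → ℝ≥0∞ := fun j =>
      U.indicator fun x => ‖c j x‖ₑ with hbdef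
    have hbl : ∀ j, LowerSemicontinuous (b j) := fun j =>
      lowerSemicontinuous_indicator_of_isOpen (hcc j).enorm.lowerSemicontinuous hUo
    have hfU : ∀ x, x ∉ U → f x = 0 := fun x hx => h0 x (by
      rw [hU, mem_ball_zero_iff, not_lt] at hx; linarith)
    have hfb : ∀ j x, ‖f x‖ₑ ≤ b j x + g j x := fun j x => by
      refine le_trans ?_ (add_le_add_right (hge j x) _)
      by_cases hx : x ∈ U
      · simp only [hbdef, he, indicator_of_mem hx, Pi.sub_apply]
        calc ‖f x‖ₑ = ‖c j x + (f x - c j x)‖ₑ := by rw [add_sub_cancel]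
          _ ≤ _ := enorm_add_le _ _
      · rw [hfU x hx, enorm_zero]
        exact zero_le
    have hbf : ∀ j x, b j x ≤ ‖f x‖ₑ + g j x := fun j x => by
      refine le_trans ?_ (add_le_add_right (hge j x) _)
      by_cases hx : x ∈ U
      · simp only [hbdef, he, indicator_of_mem hx, Pi.sub_apply]
        calc ‖c j x‖ₑ = ‖f x - (f x - c j x)‖ₑ := by rw [sub_sub_cancel]
          _ ≤ _ := enorm_sub_le
      · simp only [hbdef, indicator_of_notMem hx]
        exact zero_le
    have hNg : ∀ j, Measurable (planeMax (k := m + 1) (g j)) := fun j =>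
      (lowerSemicontinuous_planeMax (Nat.succ_le_succ h) (hgl j)).measurable
    have hNb : ∀ j, Measurable (planeMax (k := m + 1) (b j)) := fun j =>
      (lowerSemicontinuous_planeMax (Nat.succ_le_succ h) (hbl j)).measurable
    have hsum : ∫⁻ L, ∑' j, planeMax (g j) L ^ p ∂grMeasure (Nat.succ_le_succ h) ≠ ∞ := by
      rw [lintegral_tsum fun j => ((hNg j).pow_const p).aemeasurable]
      refine ne_top_of_le_ne_top (b := ∑' j, C * (2 * δ j)) ?_ (ENNReal.tsum_le_tsum fun j => ?_)
      · rw [ENNReal.tsum_mul_left, ENNReal.tsum_mul_left]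
        exact ENNReal.mul_ne_top (by simp)
          (ENNReal.mul_ne_top (by simp) (hδs.trans ENNReal.one_lt_top).ne)
      · refine (hC (g j) (hgl j) fun x hx => hg0 j x (by linarith)).trans ?_
        gcongr
        rw [two_mul]
        exact (hgi j).trans (by gcongr; exact hei j)
    refine aemeasurable_of_tendsto_metrizable_ae Filter.atTop (fun j => (hNb j).aemeasurable) ?_
    filter_upwards [ae_lt_top (Measurable.tsum fun j => (hNg j).pow_const p) hsum] with L hL
    have hp1 := ENNReal.tendsto_atTop_zero_of_tsum_ne_top hL.ne
    have hg1 : Filter.Tendsto (fun j => planeMax (g j) L) Filter.atTop (nhds 0) := by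
      have h2 := hp1.ennrpow_const (1 / p)
      simp only [← ENNReal.rpow_mul, mul_one_div_cancel hp0.ne', ENNReal.rpow_one] at h2
      rwa [ENNReal.zero_rpow_of_pos (by positivity)] at h2
    have hlo := ENNReal.Tendsto.sub (tendsto_const_nhds
      (x := planeMax (fun y => ‖f y‖ₑ) L)) hg1 (Or.inr ENNReal.zero_ne_top)
    have hhi := (tendsto_const_nhds (x := planeMax (fun y => ‖f y‖ₑ) L)).add hg1
    rw [tsub_zero] at hlo
    rw [add_zero] at hhi
    refine tendsto_of_tendsto_of_tendsto_of_le_of_le hlo hhi (fun j => ?_) fun j => ?_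
    · exact tsub_le_iff_right.mpr ((planeMax_mono (hfb j) L).trans
        (planeMax_add_le _ (hgl j).measurable L))
    · exact (planeMax_mono (hbf j) L).trans (planeMax_add_le _ (hgl j).measurable L)
  · rw [← ENNReal.rpow_le_rpow_iff hp0, ENNReal.mul_rpow_of_nonneg _ _ hp0.le,
      eLpNorm_rpow_eq_lintegral hp0, eLpNorm_rpow_eq_lintegral hp0,
      ← ENNReal.coe_rpow_of_nonneg _ hp0.le, ← NNReal.rpow_mul, one_div_mul_cancel hp0.ne',
      NNReal.rpow_one]
    simp only [enorm_eq_self]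
    refine ENNReal.le_of_forall_pos_le_add fun ε hε _ => ?_
    -- The error is multiplied by C below; dividing by C + 1 also covers C = 0.
    have hε' : ((ε / (C + 1) : ℝ≥0) : ℝ≥0∞) ≠ 0 := by
      rw [ENNReal.coe_ne_zero]; positivity
    obtain ⟨g, hgl, hge, hg0, hgi⟩ := exists_lowerSemicontinuous_ge hp0 hf.1.aemeasurable h0 hε'
    calc _ ≤ ∫⁻ L, planeMax g L ^ p ∂grMeasure (Nat.succ_le_succ h) := by
          gcongr with L
          exact planeMax_mono hge L
      _ ≤ C * ∫⁻ x, g x ^ p := hC g hgl fun x hx => hg0 x (by linarith)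
      _ ≤ C * ((∫⁻ x, ‖f x‖ₑ ^ p) + (ε / (C + 1) : ℝ≥0)) := by gcongr
      _ ≤ _ := by
          rw [mul_add]
          gcongr
          rw [← ENNReal.coe_mul, ENNReal.coe_le_coe, ← mul_div_assoc]
          refine div_le_of_le_mul₀ zero_le zero_le ?_
          rw [mul_comm]
          gcongr
          exact le_self_add

/-! ### The case α ≥ 1: localization and plates of width δ. -/

theorem planeMax_comp_add_left {d k : ℕ} (c : EuclideanSpace ℝ (Fin d))
    (F : EuclideanSpace ℝ (Fin d) → ℝ≥0∞) (L : Gr d k) :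
    planeMax (fun x => F (c + x)) L = planeMax F L := by
  refine (Equiv.addLeft c).iSup_congr fun x => ?_
  simp only [Equiv.coe_addLeft, add_assoc]

theorem avgE_comp_add_left {d : ℕ} (r : ℝ) (c : EuclideanSpace ℝ (Fin d))
    (F : EuclideanSpace ℝ (Fin d) → ℝ≥0∞) :
    avgE r (fun x => F (c + x)) = fun x => avgE r F (c + x) := by
  funext x
  simp only [avgE, add_assoc]

theorem plate_subset_ball {d k : ℕ} (L : Gr d k) (δ : ℝ) (a : EuclideanSpace ℝ (Fin d)) :
    plate L δ a ⊆ Metric.ball a (1 / 2 + δ) := by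
  intro x hx
  obtain ⟨z, ⟨hz, -⟩, hxz⟩ := Metric.mem_thickening_iff.mp hx
  rw [Metric.mem_ball] at hz ⊢
  linarith [dist_triangle x z a]

theorem ball_subset_plate {d k : ℕ} (L : Gr d k) (δ : ℝ) (a : EuclideanSpace ℝ (Fin d)) :
    Metric.ball a δ ⊆ plate L δ a := fun x hx =>
  Metric.mem_thickening_iff.mpr ⟨a, ⟨by simp, by simp⟩, hx⟩

theorem plateMax_congr_ae {d k : ℕ} {F G : EuclideanSpace ℝ (Fin d) → ℝ≥0∞}
    (h : F =ᵐ[volume] G) (δ : ℝ) (L : Gr d k) : plateMax δ F L = plateMax δ G L := by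
  unfold plateMax
  congr 1 with a
  rw [lintegral_congr_ae (ae_restrict_of_ae h)]

theorem rpow_plateMax_le {d k : ℕ} {p : ℝ} (hp : 0 < p) {δ : ℝ}
    {F : EuclideanSpace ℝ (Fin d) → ℝ≥0∞} {L : Gr d k} {X : ℝ≥0∞}
    (h : ∀ a, ((volume (plate L δ a))⁻¹ * ∫⁻ y in plate L δ a, F y) ^ p ≤ X) :
    plateMax δ F L ^ p ≤ X := by
  rw [← ENNReal.le_rpow_inv_iff hp]
  exact iSup_le fun a => (ENNReal.le_rpow_inv_iff hp).mpr (h a)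

/-- For δ bounded below a plate contains a ball of radius δ₀ and lies in one of radius 2, so Hölder
suffices. This covers the widths above the coarsest dyadic scale. -/
theorem exists_plateMax_rpow_le {d : ℕ} {p : ℝ} (hp : 1 < p) {δ₀ : ℝ} (hδ₀ : 0 < δ₀) :
    ∃ C : ℝ≥0, ∀ δ : ℝ, δ₀ ≤ δ → δ ≤ 1 → ∀ F : EuclideanSpace ℝ (Fin d) → ℝ≥0∞, Measurable F →
      ∀ {k : ℕ} (L : Gr d k), plateMax δ F L ^ p ≤ C * ∫⁻ x, F x ^ p := by
  have hp0 : 0 < p := by linarith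
  set V : ℝ≥0∞ := volume (Metric.ball (0 : EuclideanSpace ℝ (Fin d)) δ₀) with hV
  set W : ℝ≥0∞ := volume (Metric.ball (0 : EuclideanSpace ℝ (Fin d)) 2) with hW
  have hVt : V⁻¹ ≠ ∞ := ENNReal.inv_ne_top.mpr (volume_ball_ne_zero _ hδ₀)
  have hWt : W ≠ ∞ := volume_ball_ne_top _ _
  have hT : V⁻¹ ^ p * W ^ (p - 1) ≠ ∞ := ENNReal.mul_ne_top
    (ENNReal.rpow_ne_top_of_nonneg hp0.le hVt) (ENNReal.rpow_ne_top_of_nonneg (by linarith) hWt)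
  refine ⟨(V⁻¹ ^ p * W ^ (p - 1)).toNNReal, fun δ hδ hδ1 F hF k L =>
    rpow_plateMax_le hp0 fun a => ?_⟩
  rw [ENNReal.coe_toNNReal hT, ENNReal.mul_rpow_of_nonneg _ _ hp0.le, mul_assoc]
  gcongr
  · rw [hV, Measure.addHaar_ball_center volume (0 : EuclideanSpace ℝ (Fin d)),
      ← Measure.addHaar_ball_center volume a]
    exact measure_mono ((Metric.ball_subset_ball hδ).trans (ball_subset_plate L δ a))
  · calc (∫⁻ y in plate L δ a, F y) ^ p ≤ (∫⁻ y in Metric.ball a 2, F y) ^ p := by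
          gcongr
          exact (plate_subset_ball L δ a).trans (Metric.ball_subset_ball (by linarith))
      _ ≤ volume (Metric.ball a 2) ^ (p - 1) * ∫⁻ y in Metric.ball a 2, F y ^ p :=
          setLIntegral_rpow_le _ hF.aemeasurable hp _
      _ ≤ _ := by
          rw [Measure.addHaar_ball_center volume a]
          gcongr
          exact Measure.restrict_le_self

/-- Plate averages are controlled by plane integrals of a localized and mollified function. -/
theorem exists_plate_average_le {d k : ℕ} (h : k ≤ d) : ∃ K : ℝ≥0, ∀ δ r : ℝ, 0 < δ → δ ≤ 1 →
    4 * δ ≤ r → r ≤ 8 * δ → ∀ F : EuclideanSpace ℝ (Fin d) → ℝ≥0∞, Measurable F →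
    ∀ (θ : Matrix.orthogonalGroup (Fin d) ℝ) (a c : EuclideanSpace ℝ (Fin d)), dist c a < 1 →
      (volume (plate (Gr.rotate θ (Gr.coord h)) δ a))⁻¹ *
        ∫⁻ y in plate (Gr.rotate θ (Gr.coord h)) δ a, F y ≤
      K * planeMax (avgE r (avgE r ((Metric.ball c 3).indicator F)))
        (Gr.rotate θ (Gr.coord h)) := by
  set K₁ : ℝ≥0∞ := (volume (Metric.ball (0 : EuclideanSpace ℝ (Fin k)) (1 / 2)))⁻¹ *
    (2 ^ k * 2 ^ d) with hK₁
  have hK₁t : K₁ ≠ ∞ := ENNReal.mul_ne_top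
    (ENNReal.inv_ne_top.mpr (volume_ball_ne_zero _ (by norm_num))) (by finiteness)
  obtain ⟨K, hK⟩ : ∃ K : ℝ≥0, (K : ℝ≥0∞) = K₁ * (2 ^ d * (2 ^ d * 2 ^ d)) :=
    ⟨_, ENNReal.coe_toNNReal (ENNReal.mul_ne_top hK₁t (by finiteness))⟩
  refine ⟨K, fun δ r hδ hδ1 h4 h8 F hF θ a c hca => ?_⟩
  have hr : 0 < r := by linarith
  set P := plate (Gr.rotate θ (Gr.coord h)) δ a with hP
  set G := (Metric.ball c 3).indicator F with hG
  have hGm : Measurable G := hF.indicator Metric.isOpen_ball.measurableSet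
  -- The plate lies within 1/2 + δ ≤ 3/2 of a, and c is within 1 of a, so the cutoff to the ball of
  -- radius 3 around c is invisible.
  have hFG : ∫⁻ y in P, F y = ∫⁻ y in P, G y := by
    refine setLIntegral_congr_fun (isOpen_plate _ _ _).measurableSet fun y hy => ?_
    refine (indicator_of_mem ?_ _).symm
    have := plate_subset_ball _ _ _ hy
    rw [Metric.mem_ball] at this ⊢
    linarith [dist_triangle y a c, dist_comm a c]
  rw [hFG]
  have hι := (planeE h θ).continuous
  have hAm : Measurable (avgE r (avgE r G)) :=
    (lowerSemicontinuous_avgE hr (lowerSemicontinuous_avgE hr hGm).measurable).measurable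
  have hAm' : Measurable fun z => avgE r (avgE r G) (a + planeE h θ z) :=
    hAm.comp (by fun_prop)
  calc _ ≤ K₁ * ∫⁻ z, avgE (2 * δ) G (a + planeE h θ z) := plate_average_le h θ hδ a hGm
    _ ≤ K₁ * ∫⁻ z, 2 ^ d * (2 ^ d * 2 ^ d) * avgE r (avgE r G) (a + planeE h θ z) := by
        gcongr with z
        rw [mul_assoc]
        -- Since 2δ ≤ r / 2 ≤ 4δ, the average at radius 2δ is controlled by the one at r / 2, and
        -- this by the iterated average at r.
        refine (avgE_mono_left (r := r / 2) (by linarith) (by linarith) (by linarith) G _).trans ?_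
        gcongr
        exact avgE_half_le_avgE_avgE hr G _
    _ = K * ∫⁻ z, avgE r (avgE r G) (a + planeE h θ z) := by
        rw [lintegral_const_mul _ hAm', hK]; ring
    _ ≤ _ := by
        rw [planeMax_rotate]
        gcongr
        exact le_iSup (fun x => ∫⁻ z, avgE r (avgE r G) (x + planeE h θ z)) a

theorem indicator_ball_comm {d : ℕ} (F : EuclideanSpace ℝ (Fin d) → ℝ≥0∞) (ρ : ℝ)
    (c x : EuclideanSpace ℝ (Fin d)) :
    (Metric.ball c ρ).indicator F x = (Metric.ball x ρ).indicator (fun _ => F x) c := by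
  by_cases hx : x ∈ Metric.ball c ρ
  · rw [indicator_of_mem hx, indicator_of_mem (Metric.mem_ball_comm.mp hx)]
  · rw [indicator_of_notMem hx, indicator_of_notMem (mt Metric.mem_ball_comm.mp hx)]

/-- Joint measurability in centre and rotation is what permits exchanging the integrals over
localizations and over planes. The cutoff is to an open ball, so it is lower semicontinuous in the
centre. -/
theorem measurable_planeMax_avgE_avgE_indicator {d k : ℕ} (h : k ≤ d) {r : ℝ} (hr : 0 < r)
    {F : EuclideanSpace ℝ (Fin d) → ℝ≥0∞} (hF : Measurable F) (ρ : ℝ) :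
    Measurable fun q : EuclideanSpace ℝ (Fin d) × Matrix.orthogonalGroup (Fin d) ℝ =>
      planeMax (avgE r (avgE r ((Metric.ball q.1 ρ).indicator F)))
        (Gr.rotate q.2 (Gr.coord h)) := by
  have h0 : ∀ c, Measurable ((Metric.ball c ρ).indicator F) := fun c =>
    hF.indicator Metric.isOpen_ball.measurableSet
  have h1 : ∀ z, LowerSemicontinuous fun c => (Metric.ball c ρ).indicator F z := fun z => by
    simp only [indicator_ball_comm F ρ _ z]
    exact lowerSemicontinuous_indicator_of_isOpen lowerSemicontinuous_const Metric.isOpen_ball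
  have h2 := lowerSemicontinuous_avgE_param hr h0 h1
  have h3 := lowerSemicontinuous_avgE_param (X := EuclideanSpace ℝ (Fin d)) hr
    (G := fun c => avgE r ((Metric.ball c ρ).indicator F))
    (fun c => (lowerSemicontinuous_avgE hr (h0 c)).measurable)
    (fun z => h2.comp (g := fun c => (c, z)) (by fun_prop))
  exact (lowerSemicontinuous_planeMax_param h h3).measurable

theorem lintegral_lintegral_indicator_ball {d : ℕ} {F : EuclideanSpace ℝ (Fin d) → ℝ≥0∞}
    (hF : Measurable F) (ρ : ℝ) :
    ∫⁻ c, ∫⁻ x, (Metric.ball c ρ).indicator F x =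
      volume (Metric.ball (0 : EuclideanSpace ℝ (Fin d)) ρ) * ∫⁻ x, F x := by
  have hm : Measurable fun q : EuclideanSpace ℝ (Fin d) × EuclideanSpace ℝ (Fin d) =>
      (Metric.ball q.1 ρ).indicator F q.2 := by
    have hU : IsOpen {q : EuclideanSpace ℝ (Fin d) × EuclideanSpace ℝ (Fin d) |
        dist q.2 q.1 < ρ} := isOpen_lt (by fun_prop) continuous_const
    exact (hF.comp measurable_snd).indicator hU.measurableSet
  rw [lintegral_lintegral_swap hm.aemeasurable]
  simp only [indicator_ball_comm F ρ, lintegral_indicator Metric.isOpen_ball.measurableSet, setLIntegral_const,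
    Measure.addHaar_ball_center]
  rw [lintegral_mul_const _ hF, mul_comm]

/-- A plate sees only the part of F in a ball of fixed radius. The plate average at a is therefore
controlled by the localized maximal function for every centre c within 1 of a. Integrating p-th
powers over all c removes the dependence on a, and the localized norms recombine to the full norm of
F. -/
theorem PlateMaxBound.exists_lintegral_plateMax_le {m n : ℕ} (hn : 1 ≤ n) {h : m ≤ n} {p α : ℝ}
    (hp : 2 ≤ p) (hb : PlateMaxBound h p (α / p)) (hα : 1 ≤ α) {ε : ℝ} (hε : 0 < ε) : ∃ C : ℝ≥0,
      ∀ δ : ℝ, 0 < δ → 32 * δ ≤ 1 → ∀ F : EuclideanSpace ℝ (Fin (n + 1)) → ℝ≥0∞, Measurable F →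
        ∫⁻ θ, plateMax δ F (Gr.rotate θ (Gr.coord (Nat.succ_le_succ h))) ^ p ∂orthHaar (n + 1) ≤
          C * ENNReal.ofReal (δ ^ (-(α - 1 + ε))) * ∫⁻ x, F x ^ p := by
  have hp0 : 0 < p := by linarith
  set η : ℝ := min (ε / 4) (1 / 2) with hη
  have hη0 : 0 < η := lt_min (by linarith) (by norm_num)
  have hη1 : η < 1 := (min_le_right _ _).trans_lt (by norm_num)
  have hηε : η ≤ ε / 4 := min_le_left _ _
  obtain ⟨C₁, hC₁⟩ := hb.exists_lintegral_planeMax_le hn hp hη0 hη1 (R := 3) (by norm_num)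
  obtain ⟨C₂, hC₂⟩ := exists_sum_dyadicRadius_rpow_le (γ := ε - 2 * η) (by linarith)
  obtain ⟨K, hK⟩ := exists_plate_average_le (Nat.succ_le_succ h)
  set V := volume (Metric.ball (0 : EuclideanSpace ℝ (Fin (n + 1))) 1) with hV
  set W := volume (Metric.ball (0 : EuclideanSpace ℝ (Fin (n + 1))) 3) with hW
  have hV0 : V ≠ 0 := volume_ball_ne_zero _ one_pos
  have hVt : V ≠ ∞ := volume_ball_ne_top _ _
  have hWt : W ≠ ∞ := volume_ball_ne_top _ _
  have hKt : (K : ℝ≥0∞) ^ p ≠ ∞ := ENNReal.rpow_ne_top_of_nonneg hp0.le (by simp)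
  obtain ⟨C, hC⟩ : ∃ C : ℝ≥0, (C : ℝ≥0∞) = V⁻¹ * K ^ p * (C₁ * (1 + C₂) * W) :=
    ⟨_, ENNReal.coe_toNNReal (by finiteness)⟩
  refine ⟨C, fun δ hδ hδ1 F hF => ?_⟩
  set D := ENNReal.ofReal (δ ^ (-(α - 1 + ε))) with hD
  -- The inequalities (1/2)^(J+1) < 32δ ≤ (1/2)^J say exactly that 4δ ≤ r < 8δ for r = 2^(-J)/8.
  obtain ⟨J, hJ1, hJ2⟩ := exists_nat_pow_near_of_lt_one (x := 32 * δ) (y := (1 / 2 : ℝ))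
    (by linarith) hδ1 (by norm_num) (by norm_num)
  set r := dyadicRadius J with hr
  have hr0 : 0 < r := dyadicRadius_pos J
  have h4 : 4 * δ ≤ r := by rw [hr, dyadicRadius]; linarith
  have h8 : r ≤ 8 * δ := by rw [hr, dyadicRadius]; rw [pow_succ] at hJ1; linarith
  -- All radii in the sum are at least δ. The factor r_j^(-(α-1+ε)) is thus at most D, and the
  -- remaining r_j^(ε-2η) is summable because η ≤ ε / 4.
  have hsum : 1 + ∑ j ∈ Finset.range J, ENNReal.ofReal (dyadicRadius j ^ (1 - α - 2 * η)) ≤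
      (1 + C₂) * D := by
    rw [add_mul, one_mul]
    gcongr
    · rw [hD, ← ENNReal.ofReal_one]
      exact ENNReal.ofReal_le_ofReal
        (Real.one_le_rpow_of_pos_of_le_one_of_nonpos hδ (by linarith) (by linarith))
    · calc _ ≤ ∑ j ∈ Finset.range J, ENNReal.ofReal (dyadicRadius j ^ (ε - 2 * η)) * D := by
            refine Finset.sum_le_sum fun j hj => ?_
            have hj0 := dyadicRadius_pos j
            have hδj : δ ≤ dyadicRadius j := by
              have : (1 / 2 : ℝ) ^ J ≤ (1 / 2) ^ j :=
                pow_le_pow_of_le_one (by norm_num) (by norm_num) (Finset.mem_range.mp hj).le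
              rw [dyadicRadius]
              linarith
            rw [hD, ← ENNReal.ofReal_mul (by positivity)]
            refine ENNReal.ofReal_le_ofReal ?_
            rw [show 1 - α - 2 * η = ε - 2 * η + -(α - 1 + ε) by ring, Real.rpow_add hj0]
            exact mul_le_mul_of_nonneg_left
              (Real.rpow_le_rpow_of_nonpos hδ hδj (by linarith)) (by positivity)
        _ ≤ _ := by
            rw [← Finset.sum_mul]
            gcongr
            exact hC₂ J
  set P : EuclideanSpace ℝ (Fin (n + 1)) → Matrix.orthogonalGroup (Fin (n + 1)) ℝ → ℝ≥0∞ :=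
    fun c θ => planeMax (avgE r (avgE r ((Metric.ball c 3).indicator F)))
      (Gr.rotate θ (Gr.coord (Nat.succ_le_succ h))) with hPdef
  have hPm : Measurable fun q : EuclideanSpace ℝ (Fin (n + 1)) ×
      Matrix.orthogonalGroup (Fin (n + 1)) ℝ => P q.1 q.2 ^ p :=
    (measurable_planeMax_avgE_avgE_indicator _ hr0 hF 3).pow_const p
  have hPm' : ∀ θ, Measurable fun c => P c θ ^ p := fun θ => by
    have h1 := hPm.comp (measurable_prodMk_right (y := θ))
    exact h1
  have hPs : Measurable fun q : Matrix.orthogonalGroup (Fin (n + 1)) ℝ ×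
      EuclideanSpace ℝ (Fin (n + 1)) => P q.2 q.1 ^ p := by
    have h1 := hPm.comp measurable_swap
    exact h1
  have hpt : ∀ θ, plateMax δ F (Gr.rotate θ (Gr.coord (Nat.succ_le_succ h))) ^ p ≤
      V⁻¹ * K ^ p * ∫⁻ c, P c θ ^ p := by
    intro θ
    refine rpow_plateMax_le hp0 fun a => ?_
    set A := (volume (plate (Gr.rotate θ (Gr.coord (Nat.succ_le_succ h))) δ a))⁻¹ *
      ∫⁻ y in plate (Gr.rotate θ (Gr.coord (Nat.succ_le_succ h))) δ a, F y with hA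
    calc A ^ p = V⁻¹ * ∫⁻ _ in Metric.ball a 1, A ^ p := by
          rw [setLIntegral_const, Measure.addHaar_ball_center, mul_comm (A ^ p), ← mul_assoc,
            ENNReal.inv_mul_cancel hV0 hVt, one_mul]
      _ ≤ V⁻¹ * ∫⁻ c in Metric.ball a 1, K ^ p * P c θ ^ p := by
          gcongr 1
          refine setLIntegral_mono ((hPm' θ).const_mul _) fun c hc => ?_
          rw [← ENNReal.mul_rpow_of_nonneg _ _ hp0.le]
          exact ENNReal.rpow_le_rpow (hK δ r hδ (by linarith) h4 h8 F hF θ a c hc) hp0.le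
      _ ≤ V⁻¹ * ∫⁻ c, K ^ p * P c θ ^ p := by
          gcongr 1
          exact setLIntegral_le_lintegral _ _
      _ = _ := by rw [lintegral_const_mul _ (hPm' θ), mul_assoc]
  -- Translating c to the origin reduces to functions supported in the fixed ball of radius 3.
  have hcore : ∀ c, ∫⁻ θ, P c θ ^ p ∂orthHaar (n + 1) ≤
      C₁ * ((1 + C₂) * D) * ∫⁻ x, (Metric.ball c 3).indicator (fun x => F x ^ p) x := by
    intro c
    set G : EuclideanSpace ℝ (Fin (n + 1)) → ℝ≥0∞ := fun x =>
      (Metric.ball c 3).indicator F (c + x) with hG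
    have hGm : Measurable G :=
      (hF.indicator Metric.isOpen_ball.measurableSet).comp (measurable_const_add c)
    have hPG : ∀ θ, P c θ =
        planeMax (avgE r (avgE r G)) (Gr.rotate θ (Gr.coord (Nat.succ_le_succ h))) := by
      intro θ
      rw [hG, avgE_comp_add_left, avgE_comp_add_left, planeMax_comp_add_left]
    simp only [hPG]
    refine (hC₁ J G hGm fun x hx => ?_).trans ?_
    · refine indicator_of_notMem ?_ _
      rw [Metric.mem_ball, dist_self_add_left]
      linarith
    · have e : ∫⁻ x, G x ^ p = ∫⁻ x, (Metric.ball c 3).indicator (fun x => F x ^ p) x := by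
        refine Eq.trans ?_ (lintegral_add_left_eq_self
          ((Metric.ball c 3).indicator fun x => F x ^ p) c)
        congr 1 with x
        by_cases hx : c + x ∈ Metric.ball c 3
        · simp only [hG, indicator_of_mem hx]
        · simp only [hG, indicator_of_notMem hx, ENNReal.zero_rpow_of_pos hp0]
      rw [e]
      gcongr
  calc _ ≤ ∫⁻ θ, V⁻¹ * K ^ p * (∫⁻ c, P c θ ^ p) ∂orthHaar (n + 1) := lintegral_mono hpt
    _ = V⁻¹ * K ^ p * ∫⁻ c, ∫⁻ θ, P c θ ^ p ∂orthHaar (n + 1) := by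
        rw [lintegral_const_mul _ hPs.lintegral_prod_right', lintegral_lintegral_swap
          hPs.aemeasurable]
    _ ≤ V⁻¹ * K ^ p * ∫⁻ c, C₁ * ((1 + C₂) * D) *
          ∫⁻ x, (Metric.ball c 3).indicator (fun x => F x ^ p) x := by
        gcongr with c
        exact hcore c
    _ ≤ V⁻¹ * K ^ p * (C₁ * ((1 + C₂) * D) * (W * ∫⁻ x, F x ^ p)) := by
        rw [lintegral_const_mul' _ _ (by finiteness),
          lintegral_lintegral_indicator_ball (hF.pow_const p)]
    _ = _ := by rw [hC]; ring

theorem PlateMaxBound.succ {m n : ℕ} (hn : 1 ≤ n) {h : m ≤ n} {p α : ℝ}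
    (hp : 2 ≤ p) (hb : PlateMaxBound h p (α / p)) (hα : 1 ≤ α) {ε : ℝ} (hε : 0 < ε) :
    PlateMaxBound (Nat.succ_le_succ h) p ((α - 1 + ε) / p) := by
  have hp0 : 0 < p := by linarith
  obtain ⟨C₁, hC₁⟩ := hb.exists_lintegral_plateMax_le hn hp hα hε
  obtain ⟨C₂, hC₂⟩ := exists_plateMax_rpow_le (d := n + 1) (p := p) (by linarith)
    (δ₀ := 1 / 32) (by norm_num)
  have key : ∀ δ : ℝ, 0 < δ → δ ≤ 1 → ∀ F : EuclideanSpace ℝ (Fin (n + 1)) → ℝ≥0∞, Measurable F →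
      ∫⁻ L, plateMax δ F L ^ p ∂grMeasure (Nat.succ_le_succ h) ≤
        (C₁ + C₂) * ENNReal.ofReal (δ ^ (-(α - 1 + ε))) * ∫⁻ x, F x ^ p := by
    intro δ hδ hδ1 F hF
    refine (lintegral_grMeasure_le _ _).trans ?_
    rcases le_total (32 * δ) 1 with h32 | h32
    · refine (hC₁ δ hδ h32 F hF).trans ?_
      gcongr
      exact le_self_add
    · refine (lintegral_mono fun θ => hC₂ δ (by linarith) hδ1 F hF _).trans ?_
      rw [lintegral_const, measure_univ, mul_one]
      gcongr
      have h1 : (1 : ℝ≥0∞) ≤ ENNReal.ofReal (δ ^ (-(α - 1 + ε))) := by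
        rw [← ENNReal.ofReal_one]
        exact ENNReal.ofReal_le_ofReal
          (Real.one_le_rpow_of_pos_of_le_one_of_nonpos hδ hδ1 (by linarith))
      calc (C₂ : ℝ≥0∞) ≤ (C₁ + C₂) * 1 := by rw [mul_one]; exact le_add_self
        _ ≤ _ := by gcongr
  refine ⟨(C₁ + C₂) ^ (1 / p), fun δ hδ hδ1 f hf => ?_⟩
  rw [← ENNReal.rpow_le_rpow_iff hp0, ENNReal.mul_rpow_of_nonneg _ _ hp0.le,
    ENNReal.mul_rpow_of_nonneg _ _ hp0.le, eLpNorm_rpow_eq_lintegral hp0,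
    eLpNorm_rpow_eq_lintegral hp0, ← ENNReal.coe_rpow_of_nonneg _ hp0.le, ← NNReal.rpow_mul,
    one_div_mul_cancel hp0.ne', NNReal.rpow_one, ENNReal.ofReal_rpow_of_pos (by positivity),
    ← Real.rpow_mul hδ.le, neg_mul, div_mul_cancel₀ _ hp0.ne', ENNReal.coe_add]
  -- Plates have the full dimension, so f may be replaced by a measurable representative.
  have hfg : (fun y => ‖f y‖ₑ) =ᵐ[volume] fun y => ‖hf.1.mk f y‖ₑ := by
    filter_upwards [hf.1.ae_eq_mk] with y hy
    rw [hy]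
  have hfg' : ∫⁻ y, ‖f y‖ₑ ^ p = ∫⁻ y, ‖hf.1.mk f y‖ₑ ^ p := lintegral_congr_ae (by
    filter_upwards [hfg] with y hy
    rw [hy])
  simp only [enorm_eq_self, plateMax_congr_ae hfg, hfg']
  exact key δ hδ hδ1 _ hf.1.stronglyMeasurable_mk.measurable.enorm

end

/-! ### Conclusion. -/

theorem mainTheorem5 (d k : ℕ) (hk : 2 ≤ k) (hkd : k ≤ d) (p : ℝ) (hp : 2 ≤ p) (α : ℝ)
    (hbound : PlateMaxBound (d := d - 1) (k := k - 1) (Nat.sub_le_sub_right hkd 1) p (α / p)) :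
    (1 ≤ α → ∀ ε : ℝ, 0 < ε → PlateMaxBound hkd p ((α - 1 + ε) / p)) ∧
    (α < 1 → ∃ C : ℝ≥0, ∀ f : EuclideanSpace ℝ (Fin d) → ℝ,
      MemLp f (ENNReal.ofReal p) volume →
      Function.support f ⊆ Metric.closedBall 0 1 →
        AEMeasurable (planeMax (k := k) (fun y => ‖f y‖ₑ)) (grMeasure hkd) ∧
        eLpNorm (planeMax (k := k) (fun y => ‖f y‖ₑ)) (ENNReal.ofReal p) (grMeasure hkd)
          ≤ C * eLpNorm f (ENNReal.ofReal p) volume) := by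
  obtain ⟨m, rfl⟩ : ∃ m, k = m + 1 := ⟨k - 1, by omega⟩
  obtain ⟨n, rfl⟩ : ∃ n, d = n + 1 := ⟨d - 1, by omega⟩
  have hn : 1 ≤ n := by omega
  exact ⟨fun hα ε hε => PlateMaxBound.succ hn hp hbound hα hε,
    fun hα => PlateMaxBound.exists_eLpNorm_planeMax_le hn hp hbound hα⟩
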